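/- **Setting.** Let $k$ be a commutative ring containing $\mathbb{Q}$. For a $\mathbb{Z}$-graded $k$-module $W$ let $S(W)$ be its graded symmetric algebra, with product $\odot$ and unshuffle comultiplication $\Delta$ (so $\Delta(1)=1\otimes 1$, $\Delta(w)=w\otimes 1+1\otimes w$ for $w\in W$, and $\Delta$ is multiplicative for the graded tensor product). The Koszul sign rule is used throughout, with the linear grading. A *vector field* of degree $j$ on $W$ is a coderivation $Q$ of degree $j$ of $S(W)$; its Taylor coefficients are $Q_n=\operatorname{pr}_W\circ Q|_{W^{\odot n}}$, $n\ge 0$, and they determine $Q$. A *formal DG manifold* is a pair $(W,Q)$ with $Q$ a vector field of degree $1$ such that $Q^2=0$; it is *local* if $Q(1)=0$. A morphism $f:(V,P)\to(W,Q)$ is a coalgebra map $S(V)\to S(W)$ of degree $0$ with $1\mapsto 1$ that commutes with $P$ and $Q$; its Taylor coefficients are $f_n=\operatorname{pr}_W\circ f|_{V^{\odot n}}$, $n\geq 1$. Let $(M,Q^M)$ be a formal DG manifold and $(B,Q^B)$ a local one. A *deformation* of $(M,Q^M)$ with base $(B,Q^B)$ is a vector field $Q'$ of degree $1$ on $B\times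 M$ with $Q'(1)=0$ such that $Q'$ vanishes on $S(M)=S(\{0\}\times M)$, $\tilde Q':=Q^M+Q^B+Q'$ satisfies $\tilde Q'^2=0$, and the projection $(B\times M,\tilde Q')\to (B,Q^B)$ is a morphism. A *morphism* $(B,Q^B,Q')\to(C,Q^C,P)$ of deformations of $(M,Q^M)$ is a pair of morphisms of formal DG manifolds $F:B\times M\to C\times M$, $f:B\to C$, such that $F$ and $f$ form with the projections a cartesian square of formal DG manifolds, and $F$ restricts to the inclusion on $\{0\}\times M$. A deformation $(C,Q^C,P)$ (with local base) is *universal* if for every deformation $(B,Q^B,Q')$ with local base there is exactly one $f:B\to C$ such that $(f\times\operatorname{Id}_M,f)$ is a morphism of deformations $(B,Q^B,Q')\to(C,Q^C,P)$. Let $L$ be the differential graded Lie algebra of coderivations of $S(M)$, with $[s,t]=s\circ t-(-1)^{st}t\circ s$ and $d(s)=(-1)^s[s,Q^M]$ (signs $(-1)^s$, $(-1)^{st}$ refer to degrees). Put $U=L[1]$, $U^i=L^{i+1}$, with the canonical map $\uparrow:U\to L$ and its inverse $\downarrow$. Let $Q^U$ be the vector field on $U$ whose Taylor coefficients are $Q^U_1(a)=\downarrow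 d(\uparrow a)$ and $Q^U_2(a\odot b)=-(-1)^a\downarrow[\uparrow a,\uparrow b]$, the others being $0$. Let $Q$ be the vector field of degree $1$ on $U\times M$ with Taylor coefficients $Q_{n+1}(u,m_1,\dots,m_n)=(\uparrow u)_n(m_1,\dots,m_n)\in M$ for $u\in U$, $m_i\in M$, $n\ge 0$, which vanish on products with no factor or with at least two factors in $U$. **Theorem.** $(U,Q^U)$ is a local formal DG manifold, and $(U,Q^U,Q)$ is a universal deformation of $(M,Q^M)$. More precisely, for every local formal DG manifold $(B,Q^B)$, the rule $$(\uparrow f_n(b_1\odot\cdots\odot b_n))_r(m_1,\dots,m_r)=Q'_{n+r}(b_1,\dots,b_n,m_1,\dots,m_r),\qquad n\ge 1,\ r\ge 0,$$ defines a bijection $Q'\mapsto f$ between the deformations $Q'$ of $(M,Q^M)$ with base $(B,Q^B)$ and the morphisms $f:(B,Q^B)\to(U,Q^U)$ of formal DG manifolds. -/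

import Mathlib

open scoped TensorProduct DirectSum

universe u v w z

namespace FormalDG

noncomputable section

/-! A `ℤ`-graded `k`-module is a family `W : ℤ → Type v` of `k`-modules; its total module
is `⨁ i, W i`. -/

/-- The sign `(-1)^n`, as an element of `k`. -/
def sgn (k : Type u) [CommRing k] (n : ℤ) : k := ((Int.negOnePow n : ℤ) : k)

section Signs

variable (k : Type u) [CommRing k]

theorem sgn_add (m n : ℤ) : sgn k (m + n) = sgn k m * sgn k n := by
  simp [sgn, Int.negOnePow_add]

theorem sgn_zero : sgn k 0 = 1 := by simp [sgn]

theorem sgn_mul_self (m : ℤ) : sgn k m * sgn k m = 1 := by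
  rw [← sgn_add, sgn, Int.negOnePow_even _ ⟨m, rfl⟩]; simp

end Signs

/-! ### The graded symmetric algebra and its coalgebra structure -/

section SymAlgebra

variable (k : Type u) [CommRing k]
variable (W : ℤ → Type v) [∀ i, AddCommGroup (W i)] [∀ i, Module k (W i)]

/-- The relations `a ⊗ b = (-1)^{ij} b ⊗ a`, for `a` of degree `i` and `b` of degree `j`. -/
inductive SymRel : TensorAlgebra k (⨁ i, W i) → TensorAlgebra k (⨁ i, W i) → Prop
  | comm (i j : ℤ) (a : W i) (b : W j) :
      SymRel
        (TensorAlgebra.ι k (DirectSum.lof k ℤ W i a) * TensorAlgebra.ι k (DirectSum.lof k ℤ W j b))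
        (sgn k (i * j) •
          (TensorAlgebra.ι k (DirectSum.lof k ℤ W j b) *
            TensorAlgebra.ι k (DirectSum.lof k ℤ W i a)))

/-- The graded symmetric algebra `S(W)`: its product is `⊙`. -/
def Sym : Type (max u v) := RingQuot (SymRel k W)

instance : Ring (Sym k W) := inferInstanceAs (Ring (RingQuot (SymRel k W)))

instance : Algebra k (Sym k W) := inferInstanceAs (Algebra k (RingQuot (SymRel k W)))

namespace Sym

/-- The inclusion `W → S(W)`. -/
def incl : (⨁ i, W i) →ₗ[k] Sym k W :=
  (RingQuot.mkAlgHom k (SymRel k W)).toLinearMap ∘ₗ TensorAlgebra.ι k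

/-- The inclusion of the homogeneous elements of degree `i`. -/
def gen (i : ℤ) : W i →ₗ[k] Sym k W := incl k W ∘ₗ DirectSum.lof k ℤ W i

/-- The product `w₁ ⊙ ⋯ ⊙ wₙ` of a list of homogeneous elements. -/
def monomial (l : List (Σ i, W i)) : Sym k W := (l.map fun p => gen k W p.1 p.2).prod

/-- The elements of linear degree `n`. -/
def deg (n : ℤ) : Submodule k (Sym k W) :=
  Submodule.span k {x | ∃ l : List (Σ i, W i), (l.map Sigma.fst).sum = n ∧ monomial k W l = x}

variable {k W}

theorem gen_mul_gen (i j : ℤ) (a : W i) (b : W j) :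
    gen k W i a * gen k W j b = sgn k (i * j) • (gen k W j b * gen k W i a) := by
  have h := RingQuot.mkAlgHom_rel k (SymRel.comm (k := k) i j a b)
  rw [map_mul, map_smul, map_mul] at h
  exact h

/-- The universal property of `S(W)`. -/
def lift {A : Type*} [Ring A] [Algebra k A] (g : ∀ i, W i →ₗ[k] A)
    (hg : ∀ i j (a : W i) (b : W j), g i a * g j b = sgn k (i * j) • (g j b * g i a)) :
    Sym k W →ₐ[k] A :=
  RingQuot.liftAlgHom k ⟨TensorAlgebra.lift k (DirectSum.toModule k ℤ A g), by
    rintro _ _ ⟨i, j, a, b⟩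
    simpa using hg i j a b⟩

theorem lift_gen {A : Type*} [Ring A] [Algebra k A] (g : ∀ i, W i →ₗ[k] A)
    (hg : ∀ i j (a : W i) (b : W j), g i a * g j b = sgn k (i * j) • (g j b * g i a))
    (i : ℤ) (a : W i) : lift g hg (gen k W i a) = g i a := by
  have h := RingQuot.liftAlgHom_mkAlgHom_apply k
    (TensorAlgebra.lift k (DirectSum.toModule k ℤ A g)) (s := SymRel k W) (by
      rintro _ _ ⟨i, j, a, b⟩
      simpa using hg i j a b) (TensorAlgebra.ι k (DirectSum.lof k ℤ W i a))
  rw [TensorAlgebra.lift_ι_apply, DirectSum.toModule_lof] at h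
  exact h

theorem span_monomial :
    Submodule.span k (Set.range (monomial k W)) = ⊤ := by
  set T := Submodule.span k (Set.range (monomial k W)) with hT
  have hone : (1 : Sym k W) ∈ T := Submodule.subset_span ⟨[], by simp [monomial]⟩
  have hmul : ∀ x ∈ T, ∀ y ∈ T, x * y ∈ T := by
    intro x hx y hy
    refine Submodule.span_induction₂ (p := fun x y _ _ => x * y ∈ T) ?_ ?_ ?_ ?_ ?_ ?_ ?_ hx hy
    · rintro _ _ ⟨l, rfl⟩ ⟨m, rfl⟩
      exact Submodule.subset_span ⟨l ++ m, by simp [monomial]⟩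
    · intro y _; simp
    · intro y _; simp
    · intro x y z _ _ _ h1 h2; rw [add_mul]; exact T.add_mem h1 h2
    · intro x y z _ _ _ h1 h2; rw [mul_add]; exact T.add_mem h1 h2
    · intro r x y _ _ h; rw [smul_mul_assoc]; exact T.smul_mem _ h
    · intro r x y _ _ h; rw [mul_smul_comm]; exact T.smul_mem _ h
  rw [eq_top_iff]
  intro x _
  obtain ⟨t, rfl⟩ := RingQuot.mkAlgHom_surjective k (SymRel k W) x
  induction t using TensorAlgebra.induction with
  | algebraMap r =>
    rw [AlgHom.commutes, Algebra.algebraMap_eq_smul_one]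
    exact T.smul_mem _ hone
  | ι m =>
    induction m using DirectSum.induction_on with
    | zero => rw [map_zero, map_zero]; exact T.zero_mem
    | of i a => exact Submodule.subset_span ⟨[⟨i, a⟩], by simp [monomial]; rfl⟩
    | add a b ha hb => rw [map_add, map_add]; exact T.add_mem (ha trivial) (hb trivial)
  | mul a b ha hb => rw [map_mul]; exact hmul _ (ha trivial) _ (hb trivial)
  | add a b ha hb => rw [map_add]; exact T.add_mem (ha trivial) (hb trivial)

/-- The algebra map `S(W) → S(V)` induced by a linear map `W → V` of degree zero. -/
def map {V : ℤ → Type w} [∀ i, AddCommGroup (V i)] [∀ i, Module k (V i)]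
    (φ : ∀ i, W i →ₗ[k] V i) : Sym k W →ₐ[k] Sym k V :=
  lift (fun i => gen k V i ∘ₗ φ i) fun i j a b => gen_mul_gen i j (φ i a) (φ j b)

variable (k W)

/-- The Koszul sign of moving a symbol of degree `i` past an element of `S(W)`:
`koszul i x = (-1)^{i n} x` for `x` of linear degree `n`. -/
def koszul (i : ℤ) : Sym k W →ₐ[k] Sym k W :=
  lift (fun j => sgn k (i * j) • gen k W j) fun j l a b => by
    simp only [LinearMap.smul_apply, smul_mul_assoc, mul_smul_comm]
    rw [gen_mul_gen]
    simp only [smul_smul]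
    congr 1; ring

/-- Left multiplication by `w ⊗ 1 + 1 ⊗ w` on `S(W) ⊗ S(W)`, for `w` of degree `i`:
`x ⊗ y ↦ (w ⊙ x) ⊗ y + (-1)^{i |x|} x ⊗ (w ⊙ y)`. -/
def comulGen (i : ℤ) : W i →ₗ[k] Module.End k (Sym k W ⊗[k] Sym k W) where
  toFun a := TensorProduct.map (LinearMap.mulLeft k (gen k W i a)) LinearMap.id +
    TensorProduct.map (koszul k W i).toLinearMap (LinearMap.mulLeft k (gen k W i a))
  map_add' a b := by
    apply TensorProduct.ext'
    intro x y
    simp [add_mul, TensorProduct.add_tmul, TensorProduct.tmul_add]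
    abel
  map_smul' r a := by
    apply TensorProduct.ext'
    intro x y
    simp [TensorProduct.smul_tmul']

variable {k W}

theorem koszul_gen (i j : ℤ) (b : W j) :
    koszul k W i (gen k W j b) = sgn k (i * j) • gen k W j b :=
  lift_gen _ _ j b

theorem comulGen_tmul (i : ℤ) (a : W i) (x y : Sym k W) :
    comulGen k W i a (x ⊗ₜ y) =
      (gen k W i a * x) ⊗ₜ[k] y + koszul k W i x ⊗ₜ[k] (gen k W i a * y) := rfl

theorem koszul_comm (i j : ℤ) (x : Sym k W) :
    koszul k W i (koszul k W j x) = koszul k W j (koszul k W i x) := by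
  have hx : x ∈ Submodule.span k (Set.range (monomial k W)) := by
    rw [span_monomial]; trivial
  induction hx using Submodule.span_induction with
  | mem x h =>
    obtain ⟨l, rfl⟩ := h
    induction l with
    | nil => simp [monomial]
    | cons p l ih =>
      have h : monomial k W (p :: l) = gen k W p.1 p.2 * monomial k W l := by simp [monomial]
      simp only [h, map_mul, koszul_gen, map_smul, ih, smul_smul]
      rw [mul_comm (sgn k (j * p.1))]
  | zero => simp
  | add x y _ _ hx hy => simp [hx, hy]
  | smul r x _ hx => simp [hx]

theorem comulGen_mul_comulGen (i j : ℤ) (a : W i) (b : W j) :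
    comulGen k W i a * comulGen k W j b =
      sgn k (i * j) • (comulGen k W j b * comulGen k W i a) := by
  apply TensorProduct.ext'
  intro x y
  have e : sgn k (i * j) * sgn k (j * i) = 1 := by rw [mul_comm j i, sgn_mul_self]
  have h1 : gen k W i a * (gen k W j b * x) =
      sgn k (i * j) • (gen k W j b * (gen k W i a * x)) := by
    rw [← mul_assoc, gen_mul_gen, smul_mul_assoc, mul_assoc]
  have h2 : gen k W i a * (gen k W j b * y) =
      sgn k (i * j) • (gen k W j b * (gen k W i a * y)) := by
    rw [← mul_assoc, gen_mul_gen, smul_mul_assoc, mul_assoc]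
  simp only [Module.End.mul_apply, LinearMap.smul_apply, comulGen_tmul, map_add, map_mul,
    koszul_gen, h1, h2, smul_mul_assoc, TensorProduct.smul_tmul', TensorProduct.tmul_smul,
    smul_add, smul_smul, e, one_smul, koszul_comm i j x]
  abel

variable (k W)

/-- The comultiplication `Δ : S(W) → S(W) ⊗ S(W)`: `Δ(1) = 1 ⊗ 1` and
`Δ(w ⊙ x) = (w ⊗ 1 + 1 ⊗ w) Δ(x)`, so that `Δ(w₁ ⊙ ⋯ ⊙ wₙ)` is the sum of all the signed
unshuffles of `w₁, …, wₙ` into two factors. -/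
def comul : Sym k W →ₗ[k] Sym k W ⊗[k] Sym k W :=
  (LinearMap.applyₗ (1 ⊗ₜ[k] 1 : Sym k W ⊗[k] Sym k W)) ∘ₗ
    (lift (comulGen k W) comulGen_mul_comulGen).toLinearMap

theorem comul_one : comul k W 1 = 1 ⊗ₜ[k] 1 := by simp [comul]

theorem comul_gen_mul (i : ℤ) (a : W i) (x : Sym k W) :
    comul k W (gen k W i a * x) = comulGen k W i a (comul k W x) := by
  simp [comul, lift_gen]

/-- The action of `w` on `k × W` by `(c, w') ↦ (0, c w)`. -/
def prGen (i : ℤ) : W i →ₗ[k] Module.End k (k × ⨁ i, W i) where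
  toFun a := LinearMap.inr k k (⨁ i, W i) ∘ₗ
    (LinearMap.toSpanSingleton k (⨁ i, W i) (DirectSum.lof k ℤ W i a)) ∘ₗ
      LinearMap.fst k k (⨁ i, W i)
  map_add' a b := by ext <;> simp
  map_smul' r a := by ext <;> simp [smul_comm]

/-- The projection `pr : S(W) → W` onto polynomial degree one. It is the identity on `W` and it
vanishes on `1` and on the products `w₁ ⊙ ⋯ ⊙ wₙ` with `n ≥ 2`. -/
def pr : Sym k W →ₗ[k] ⨁ i, W i :=
  LinearMap.snd k k (⨁ i, W i) ∘ₗ (LinearMap.applyₗ ((1, 0) : k × ⨁ i, W i)) ∘ₗ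
    (lift (prGen k W) fun i j a b => by ext <;> simp [prGen]).toLinearMap

theorem pr_one : pr k W 1 = 0 := by simp [pr]

theorem pr_gen (i : ℤ) (a : W i) : pr k W (gen k W i a) = DirectSum.lof k ℤ W i a := by
  simp [pr, lift_gen, prGen]

theorem pr_gen_mul_gen_mul (i j : ℤ) (a : W i) (b : W j) (x : Sym k W) :
    pr k W (gen k W i a * (gen k W j b * x)) = 0 := by
  simp [pr, lift_gen, prGen]

end Sym

/-! ### Vector fields -/

/-- The vector fields of degree `j` on the formal supermanifold `W`: the `k`-linear maps
`Q : S(W) → S(W)` of linear degree `j` with `Δ ∘ Q = (Q ⊗ 1 + 1 ⊗ Q) ∘ Δ`, where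
`(1 ⊗ Q)(x ⊗ y) = (-1)^{j |x|} x ⊗ Q y`. -/
def Coder (j : ℤ) : Submodule k (Module.End k (Sym k W)) where
  carrier := {Q | (∀ n, ∀ x ∈ Sym.deg k W n, Q x ∈ Sym.deg k W (n + j)) ∧
    Sym.comul k W ∘ₗ Q =
      (TensorProduct.map Q LinearMap.id + TensorProduct.map (Sym.koszul k W j).toLinearMap Q) ∘ₗ
        Sym.comul k W}
  zero_mem' := by
    refine ⟨fun n x _ => by simp, ?_⟩
    simp
  add_mem' := by
    rintro P Q ⟨hP, hP'⟩ ⟨hQ, hQ'⟩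
    refine ⟨fun n x hx => Submodule.add_mem _ (hP n x hx) (hQ n x hx), ?_⟩
    rw [LinearMap.comp_add, hP', hQ', TensorProduct.map_add_left, TensorProduct.map_add_right,
      ← LinearMap.add_comp]
    congr 1
    abel
  smul_mem' := by
    rintro r Q ⟨hQ, hQ'⟩
    refine ⟨fun n x hx => Submodule.smul_mem _ r (hQ n x hx), ?_⟩
    rw [LinearMap.comp_smul, hQ', TensorProduct.map_smul_left, TensorProduct.map_smul_right,
      ← smul_add, LinearMap.smul_comp]

variable {k W}

theorem koszul_of_mem_deg (i n : ℤ) (x : Sym k W) (hx : x ∈ Sym.deg k W n) :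
    Sym.koszul k W i x = sgn k (i * n) • x := by
  induction hx using Submodule.span_induction with
  | mem x h =>
    obtain ⟨l, rfl, rfl⟩ := h
    induction l with
    | nil => simp [Sym.monomial, sgn_zero]
    | cons p l ih =>
      have h : Sym.monomial k W (p :: l) = Sym.gen k W p.1 p.2 * Sym.monomial k W l := by
        simp [Sym.monomial]
      rw [h, map_mul, ih, Sym.koszul_gen, List.map_cons, List.sum_cons, mul_add, sgn_add,
        smul_mul_smul_comm]
  | zero => simp
  | add x y _ _ hx hy => simp [hx, hy]
  | smul r x _ hx => rw [map_smul, hx, smul_comm]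

theorem hom_ext_deg {V : Type*} [AddCommGroup V] [Module k V] (f g : Sym k W →ₗ[k] V)
    (h : ∀ n, ∀ x ∈ Sym.deg k W n, f x = g x) : f = g := by
  apply LinearMap.ext_on Sym.span_monomial
  rintro _ ⟨l, rfl⟩
  exact h _ _ (Submodule.subset_span ⟨l, rfl, rfl⟩)

theorem koszul_comp_of_mem {j : ℤ} {Q : Module.End k (Sym k W)} (hQ : Q ∈ Coder k W j) (i : ℤ) :
    (Sym.koszul k W i).toLinearMap ∘ₗ Q =
      sgn k (i * j) • (Q ∘ₗ (Sym.koszul k W i).toLinearMap) := by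
  apply hom_ext_deg
  intro n x hx
  simp only [LinearMap.comp_apply, AlgHom.toLinearMap_apply, LinearMap.smul_apply]
  rw [koszul_of_mem_deg i _ _ (hQ.1 n x hx), koszul_of_mem_deg i n x hx, map_smul, smul_smul,
    mul_add, sgn_add, mul_comm (sgn k (i * n))]

theorem koszul_add (i j : ℤ) :
    (Sym.koszul k W (i + j)).toLinearMap =
      (Sym.koszul k W i).toLinearMap ∘ₗ (Sym.koszul k W j).toLinearMap := by
  apply hom_ext_deg
  intro n x hx
  simp only [LinearMap.comp_apply, AlgHom.toLinearMap_apply]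
  rw [koszul_of_mem_deg _ n x hx, koszul_of_mem_deg _ n x hx, map_smul,
    koszul_of_mem_deg _ n x hx, smul_smul, add_mul, sgn_add, mul_comm]

theorem comul_comp_comp {i j : ℤ} {s t : Module.End k (Sym k W)}
    (hs : s ∈ Coder k W i) (ht : t ∈ Coder k W j) :
    Sym.comul k W ∘ₗ (s ∘ₗ t) =
      (TensorProduct.map (s ∘ₗ t) LinearMap.id
        + TensorProduct.map (s ∘ₗ (Sym.koszul k W j).toLinearMap) t
        + sgn k (i * j) • TensorProduct.map (t ∘ₗ (Sym.koszul k W i).toLinearMap) s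
        + TensorProduct.map (Sym.koszul k W (i + j)).toLinearMap (s ∘ₗ t)) ∘ₗ Sym.comul k W := by
  rw [← LinearMap.comp_assoc, hs.2, LinearMap.comp_assoc, ht.2, ← LinearMap.comp_assoc]
  congr 1
  rw [LinearMap.add_comp, LinearMap.comp_add, LinearMap.comp_add, ← TensorProduct.map_comp,
    ← TensorProduct.map_comp, ← TensorProduct.map_comp, ← TensorProduct.map_comp,
    koszul_comp_of_mem ht i, TensorProduct.map_smul_left, koszul_add]
  simp only [LinearMap.id_comp, LinearMap.comp_id]
  abel

theorem bracket_mem {i j : ℤ} {s t : Module.End k (Sym k W)}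
    (hs : s ∈ Coder k W i) (ht : t ∈ Coder k W j) :
    s ∘ₗ t - sgn k (i * j) • (t ∘ₗ s) ∈ Coder k W (i + j) := by
  refine ⟨fun n x hx => ?_, ?_⟩
  · have h1 := hs.1 _ _ (ht.1 n x hx)
    have h2 := ht.1 _ _ (hs.1 n x hx)
    rw [add_assoc, add_comm j i] at h1
    rw [add_assoc] at h2
    exact Submodule.sub_mem _ h1 (Submodule.smul_mem _ _ h2)
  · have e : sgn k (i * j) * sgn k (j * i) = 1 := by rw [mul_comm j i, sgn_mul_self]
    rw [LinearMap.comp_sub, LinearMap.comp_smul, comul_comp_comp hs ht, comul_comp_comp ht hs,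
      ← LinearMap.smul_comp, ← LinearMap.sub_comp]
    congr 1
    have hl : TensorProduct.map (s ∘ₗ t - sgn k (i * j) • (t ∘ₗ s)) (LinearMap.id (M := Sym k W)) =
        TensorProduct.map (s ∘ₗ t) LinearMap.id -
          sgn k (i * j) • TensorProduct.map (t ∘ₗ s) LinearMap.id := by
      apply TensorProduct.ext'
      intro x y
      simp [TensorProduct.sub_tmul, TensorProduct.smul_tmul']
    have hr : TensorProduct.map (Sym.koszul k W (i + j)).toLinearMap
          (s ∘ₗ t - sgn k (i * j) • (t ∘ₗ s)) =
        TensorProduct.map (Sym.koszul k W (i + j)).toLinearMap (s ∘ₗ t) -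
          sgn k (i * j) • TensorProduct.map (Sym.koszul k W (i + j)).toLinearMap (t ∘ₗ s) := by
      apply TensorProduct.ext'
      intro x y
      simp [TensorProduct.tmul_sub]
    rw [hl, hr, add_comm j i, smul_add, smul_add, smul_add, smul_smul, e, one_smul]
    abel

variable (k W)

/-- The coderivation with Taylor coefficients `q : S(W) → W`, given by
`w₁ ⊙ ⋯ ⊙ wₙ ↦ ∑_l ∑_{σ ∈ Sh(l,n)} ε(σ) q(w_{σ(1)} ⊙ ⋯ ⊙ w_{σ(l)}) ⊙ w_{σ(l+1)} ⊙ ⋯ ⊙ w_{σ(n)}`,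
that is, as the composite `S(W) → S(W) ⊗ S(W) → W ⊗ S(W) → S(W)`. -/
def ofTaylor (q : Sym k W →ₗ[k] ⨁ i, W i) : Module.End k (Sym k W) :=
  LinearMap.mul' k (Sym k W) ∘ₗ TensorProduct.map (Sym.incl k W ∘ₗ q) LinearMap.id ∘ₗ
    Sym.comul k W

variable {k W}

/-- `Q` is a DG structure on `W`: a vector field of degree `1` with `Q² = 0`. -/
structure IsDG (Q : Module.End k (Sym k W)) : Prop where
  mem_coder : Q ∈ Coder k W 1
  sq_zero : Q ∘ₗ Q = 0

/-- `(W, Q)` is a formal DG manifold with `Q₀ = 0`. -/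
structure IsLocalDG (Q : Module.End k (Sym k W)) : Prop extends IsDG Q where
  map_one : Q 1 = 0

end SymAlgebra

/-! ### Morphisms and products -/

section Morphisms

variable {k : Type u} [CommRing k]
variable {V : ℤ → Type v} [∀ i, AddCommGroup (V i)] [∀ i, Module k (V i)]
variable {W : ℤ → Type w} [∀ i, AddCommGroup (W i)] [∀ i, Module k (W i)]

/-- `F : S(V) → S(W)` is (the coalgebra map induced by) a morphism of formal supermanifolds
`V → W`: a map of coalgebras of linear degree zero with `F(1) = 1`. -/
structure IsFormalMap (F : Sym k V →ₗ[k] Sym k W) : Prop where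
  mem_deg : ∀ n, ∀ x ∈ Sym.deg k V n, F x ∈ Sym.deg k W n
  comul_comp : Sym.comul k W ∘ₗ F = TensorProduct.map F F ∘ₗ Sym.comul k V
  map_one : F 1 = 1

/-- `F` is a morphism of formal DG manifolds `(V, P) → (W, Q)`. -/
structure IsDGMor (P : Module.End k (Sym k V)) (Q : Module.End k (Sym k W))
    (F : Sym k V →ₗ[k] Sym k W) : Prop extends IsFormalMap F where
  equivariant : F ∘ₗ P = Q ∘ₗ F

/-- The product of two formal supermanifolds. -/
abbrev Prd (V : ℤ → Type v) (W : ℤ → Type w) : ℤ → Type (max v w) := fun i => V i × W i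

variable (k V W)

/-- The projection `V × W → V`. -/
def pFst : Sym k (Prd V W) →ₗ[k] Sym k V :=
  (Sym.map fun i => LinearMap.fst k (V i) (W i)).toLinearMap

/-- The projection `V × W → W`. -/
def pSnd : Sym k (Prd V W) →ₗ[k] Sym k W :=
  (Sym.map fun i => LinearMap.snd k (V i) (W i)).toLinearMap

/-- The inclusion `V = V × {0} → V × W`. -/
def iFst : Sym k V →ₗ[k] Sym k (Prd V W) :=
  (Sym.map fun i => LinearMap.inl k (V i) (W i)).toLinearMap

/-- The inclusion `W = {0} × W → V × W`. -/
def iSnd : Sym k W →ₗ[k] Sym k (Prd V W) :=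
  (Sym.map fun i => LinearMap.inr k (V i) (W i)).toLinearMap

/-- The inclusion `V → V × W` of total modules. -/
def inlTot : (⨁ i, V i) →ₗ[k] ⨁ i, Prd V W i :=
  DirectSum.lmap fun i => LinearMap.inl k (V i) (W i)

/-- The inclusion `W → V × W` of total modules. -/
def inrTot : (⨁ i, W i) →ₗ[k] ⨁ i, Prd V W i :=
  DirectSum.lmap fun i => LinearMap.inr k (V i) (W i)

/-- The projection `V × W → V` of total modules. -/
def fstTot : (⨁ i, Prd V W i) →ₗ[k] ⨁ i, V i :=
  DirectSum.lmap fun i => LinearMap.fst k (V i) (W i)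

variable {k V}

/-- A vector field on `V`, seen as a vector field on `V × W`: its Taylor coefficients are
those of `Q` on products of elements of `V`, and zero on the other products. -/
def extFst (Q : Module.End k (Sym k V)) : Module.End k (Sym k (Prd V W)) :=
  ofTaylor k (Prd V W) (inlTot k V W ∘ₗ Sym.pr k V ∘ₗ Q ∘ₗ pFst k V W)

variable (V) {W}

/-- A vector field on `W`, seen as a vector field on `V × W`. -/
def extSnd (Q : Module.End k (Sym k W)) : Module.End k (Sym k (Prd V W)) :=
  ofTaylor k (Prd V W) (inrTot k V W ∘ₗ Sym.pr k W ∘ₗ Q ∘ₗ pSnd k V W)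

end Morphisms

/-! ### Deformations -/

section Deformations

variable {k : Type u} [CommRing k]
variable {M : ℤ → Type v} [∀ i, AddCommGroup (M i)] [∀ i, Module k (M i)]
variable {B : ℤ → Type w} [∀ i, AddCommGroup (B i)] [∀ i, Module k (B i)]
variable {C : ℤ → Type z} [∀ i, AddCommGroup (C i)] [∀ i, Module k (C i)]

/-- The vector field `Q^M + Q^B + Q` on `B × M`. -/
def total (QM : Module.End k (Sym k M)) (QB : Module.End k (Sym k B))
    (Q : Module.End k (Sym k (Prd B M))) : Module.End k (Sym k (Prd B M)) :=
  extSnd B QM + extFst M QB + Q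

/-- `Q` is a deformation of the formal DG manifold `(M, QM)` with base `(B, QB)`. -/
structure IsDeformation (QM : Module.End k (Sym k M)) (QB : Module.End k (Sym k B))
    (Q : Module.End k (Sym k (Prd B M))) : Prop where
  mem_coder : Q ∈ Coder k (Prd B M) 1
  map_one : Q 1 = 0
  restrict : Q ∘ₗ iSnd k B M = 0
  isDG : IsDG (total QM QB Q)
  proj : IsDGMor (total QM QB Q) QB (pFst k B M)

/-- `(F, f)` is a morphism of deformations `(B, QB, Q) → (C, QC, P)` of `(M, QM)`: a pair of
morphisms `F : B × M → C × M` and `f : B → C` of formal DG manifolds for which the square over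
`f` is cartesian in the category of formal DG manifolds and the restriction of `F` to
`M = {0} × M` is the inclusion. -/
structure IsDefMor (QM : Module.End k (Sym k M))
    (QB : Module.End k (Sym k B)) (Q : Module.End k (Sym k (Prd B M)))
    (QC : Module.End k (Sym k C)) (P : Module.End k (Sym k (Prd C M)))
    (F : Sym k (Prd B M) →ₗ[k] Sym k (Prd C M)) (f : Sym k B →ₗ[k] Sym k C) : Prop where
  top : IsDGMor (total QM QB Q) (total QM QC P) F
  base : IsDGMor QB QC f
  comm : pFst k C M ∘ₗ F = f ∘ₗ pFst k B M
  cartesian : ∀ (A : ℤ → Type (max v w z)) [∀ i, AddCommGroup (A i)] [∀ i, Module k (A i)]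
    (QA : Module.End k (Sym k A)), IsDG QA →
    ∀ (g : Sym k A →ₗ[k] Sym k B) (h : Sym k A →ₗ[k] Sym k (Prd C M)),
      IsDGMor QA QB g → IsDGMor QA (total QM QC P) h → f ∘ₗ g = pFst k C M ∘ₗ h →
      ∃! j : Sym k A →ₗ[k] Sym k (Prd B M),
        IsDGMor QA (total QM QB Q) j ∧ pFst k B M ∘ₗ j = g ∧ F ∘ₗ j = h
  fiber : F ∘ₗ iSnd k B M = iSnd k C M

/-- `(C, QC, P)` is a universal deformation of `(M, QM)`, for deformations with bases in `Type w`.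
Deformations are embedded ones: the morphisms of deformations `(F, f)` in which `f` is required to
be unique are those over `M`, that is, with `pr_M ∘ F = pr_M`. Equivalently, `F = f × Id`. -/
def IsUniversal (QM : Module.End k (Sym k M)) (QC : Module.End k (Sym k C))
    (P : Module.End k (Sym k (Prd C M))) : Prop :=
  IsLocalDG QC ∧ IsDeformation QM QC P ∧
    ∀ (B : ℤ → Type w) [∀ i, AddCommGroup (B i)] [∀ i, Module k (B i)]
      (QB : Module.End k (Sym k B)), IsLocalDG QB →
      ∀ Q' : Module.End k (Sym k (Prd B M)), IsDeformation QM QB Q' →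
        ∃! f : Sym k B →ₗ[k] Sym k C, ∃ F : Sym k (Prd B M) →ₗ[k] Sym k (Prd C M),
          IsDefMor QM QB Q' QC P F f ∧ pSnd k C M ∘ₗ F = pSnd k B M

end Deformations

/-! ### The shifted DGL of coderivations and the canonical deformation -/

section Universal

variable (k : Type u) [CommRing k]
variable (M : ℤ → Type v) [∀ i, AddCommGroup (M i)] [∀ i, Module k (M i)]

/-- The tangent complex `L = Coder(S(M), S(M))`, as a graded module. -/
abbrev Tangent (i : ℤ) : Type (max u v) := Coder k M i

/-- The shift `U = L[1]`, that is, `U^i = L^{i+1}`. -/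
abbrev UMod (i : ℤ) : Type (max u v) := Tangent k M (i + 1)

variable {k M}

/-- The bracket `[s, t] = s ∘ t - (-1)^{ij} t ∘ s` of `s ∈ L^i` and `t ∈ L^j`. -/
def bracket (i j : ℤ) : Tangent k M i →ₗ[k] Tangent k M j →ₗ[k] Tangent k M (i + j) :=
  LinearMap.mk₂ k
    (fun s t => ⟨s.1 ∘ₗ t.1 - sgn k (i * j) • (t.1 ∘ₗ s.1), bracket_mem s.2 t.2⟩)
    (fun s s' t => Subtype.ext (by
      simp only [Submodule.coe_add, LinearMap.add_comp, LinearMap.comp_add, smul_add]; abel))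
    (fun c s t => Subtype.ext (by
      simp only [Submodule.coe_smul, LinearMap.smul_comp, LinearMap.comp_smul, smul_sub,
        smul_comm c]))
    (fun s t t' => Subtype.ext (by
      simp only [Submodule.coe_add, LinearMap.add_comp, LinearMap.comp_add, smul_add]; abel))
    (fun c s t => Subtype.ext (by
      simp only [Submodule.coe_smul, LinearMap.smul_comp, LinearMap.comp_smul, smul_sub,
        smul_comm c]))

/-- The differential `d(s) = (-1)^i [s, QM]` of `s ∈ L^i`. -/
def diff (QM : Coder k M 1) (i : ℤ) : Tangent k M i →ₗ[k] Tangent k M (i + 1) :=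
  sgn k i • (bracket i 1).flip QM

variable (k M)

/-- The canonical map `↓ : L → L[1]`, on elements of degree `i`. -/
def down (i : ℤ) : Tangent k M i →ₗ[k] ⨁ n, UMod k M n :=
  DirectSum.lof k ℤ (UMod k M) (i - 1) ∘ₗ
    Submodule.inclusion (le_of_eq (by rw [sub_add_cancel]))

/-- The inverse `↑` of `↓`, with values in the `k`-linear endomorphisms of `S(M)`. -/
def up : (⨁ n, UMod k M n) →ₗ[k] Module.End k (Sym k M) :=
  DirectSum.toModule k ℤ _ fun n => (Coder k M (n + 1)).subtype

variable {k M}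

/-- `Q₁^U = ↓ ∘ d ∘ ↑`. -/
def qU1 (QM : Coder k M 1) : (⨁ n, UMod k M n) →ₗ[k] ⨁ n, UMod k M n :=
  DirectSum.toModule k ℤ _ fun i => down k M (i + 1 + 1) ∘ₗ diff QM (i + 1)

variable (k M)

/-- `Q₂^U = -↓ ∘ [·, ·] ∘ (↑ ⊗ ↑)`, that is, `Q₂^U(a, b) = -(-1)^i ↓[↑a, ↑b]` for `a ∈ U^i`. -/
def qU2 : (⨁ n, UMod k M n) →ₗ[k] (⨁ n, UMod k M n) →ₗ[k] ⨁ n, UMod k M n :=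
  DirectSum.toModule k ℤ _ fun i => LinearMap.flip <| DirectSum.toModule k ℤ _ fun j =>
    LinearMap.flip <|
      (-sgn k i) • (bracket (k := k) (M := M) (i + 1) (j + 1)).compr₂ (down k M (i + 1 + (j + 1)))

variable {k M}

/-- The vector field `Q^U` on `U` that corresponds to the DGL structure on `L`. Its Taylor
coefficients are `Q₁^U`, `Q₂^U` (here `(pr ⊗ pr)(Δ(a ⊙ b)) = a ⊗ b ± b ⊗ a`, whence the factor
`1/2`) and zero in the other polynomial degrees. -/
def QU [Algebra ℚ k] (QM : Coder k M 1) : Module.End k (Sym k (UMod k M)) :=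
  ofTaylor k (UMod k M)
    (qU1 QM ∘ₗ Sym.pr k (UMod k M) +
      algebraMap ℚ k (1 / 2) • (TensorProduct.lift (qU2 k M) ∘ₗ
        TensorProduct.map (Sym.pr k (UMod k M)) (Sym.pr k (UMod k M)) ∘ₗ Sym.comul k (UMod k M)))

variable (k M)

/-- The evaluation `u ⊗ m₁ ⊙ ⋯ ⊙ mₙ ↦ (↑u)ₙ(m₁, …, mₙ) ∈ M`. -/
def evalU : (⨁ n, UMod k M n) ⊗[k] Sym k M →ₗ[k] ⨁ n, M n :=
  TensorProduct.lift ((up k M).compr₂ (Sym.pr k M))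

/-- The canonical perturbation `Q` on `U × M`: its Taylor coefficients are
`Q_{n+1}(u, m₁, …, mₙ) = (↑u)ₙ(m₁, …, mₙ)` for one factor `u` in `U` and the other factors in `M`,
and zero on products with no factor or with several factors in `U`. -/
def canonicalQ : Module.End k (Sym k (Prd (UMod k M) M)) :=
  ofTaylor k (Prd (UMod k M) M)
    (inrTot k (UMod k M) M ∘ₗ evalU k M ∘ₗ
      TensorProduct.map (fstTot k (UMod k M) M ∘ₗ Sym.pr k (Prd (UMod k M) M))
        (pSnd k (UMod k M) M) ∘ₗ
      Sym.comul k (Prd (UMod k M) M))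

variable {k M}

/-- `(↑fₙ(b₁ ⊙ ⋯ ⊙ bₙ))_r(m₁, …, m_r) = Q'_{n+r}(b₁, …, bₙ, m₁, …, m_r)` for all `n ≥ 1`, `r ≥ 0`,
where `fₙ` are the Taylor coefficients of `f`. -/
def Classifies {B : ℤ → Type w} [∀ i, AddCommGroup (B i)] [∀ i, Module k (B i)]
    (Q' : Module.End k (Sym k (Prd B M))) (f : Sym k B →ₗ[k] Sym k (UMod k M)) : Prop :=
  ∀ (bs : List (Σ i, B i)) (ms : List (Σ i, M i)), bs ≠ [] →
    inrTot k B M (Sym.pr k M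
      (up k M (Sym.pr k (UMod k M) (f (Sym.monomial k B bs))) (Sym.monomial k M ms))) =
    Sym.pr k (Prd B M)
      (Q' (iFst k B M (Sym.monomial k B bs) * iSnd k B M (Sym.monomial k M ms)))

end Universal

end

end FormalDG

namespace FormalDG

noncomputable section

/-! ### Signs, monomials and the bialgebra structure of S(W) -/

section

/-! The theorem is an exponential law. Multiplication identifies S(B) ⊗ S(M) with S(B × M) (`nu_mu`,
`mu_nu`), and a vector field T on B × M is determined by its projections to B and to M
(`IsCoderAlong.prd_ext`). The M-component is a family `fibre T` : S(B) → End S(M), x ↦ (y ↦ pr_M T(x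
⊙ y)), whose value at x of degree n is a coderivation of S(M) of degree n + |T| (`fibre_mem_coder`).
For a deformation Q' the B-component vanishes because the projection is a morphism, and the fibre at
1 vanishes because Q' is zero on S(M) (`isDeformation_iff`). What remains is a map g : S(B) → U =
L[1] of degree zero with g(1) = 0, and such maps are exactly the Taylor coefficients of formal maps
f : B → U.

Integrability matches as well. The fibre of (Q^M + Q^B + Q')² at x is g(Q^B x) + Q^M g(x) + g(κx)
Q^M + (gκ * g)(x), with * the convolution and κ the parity automorphism (`fibre_total_sq`). The last
three terms are minus the Taylor coefficient of Q^U ∘ f at x (`up_taylorQU`). Since f ∘ Q^B and Q^U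
∘ f are coderivations along f, they agree as soon as their linear parts do, so the square vanishes
exactly when f is equivariant (`isDG_total_iff_equivariant`).

The same computation with f = Id gives (Q^U)² = 0 without expanding the Jacobi identity: T = Q^M +
Q^U + Q has pr_M T² = 0 whatever (Q^U)² is, and reading off the fibre of T ∘ T² in two ways kills
(Q^U)² (`QU_sq`).

For universality, a map F over f and over M sends x ⊙ y to f(x) ⊙ y. It is compatible with the
perturbations exactly when the fibre of Q' is that of the canonical Q composed with f
(`pSnd_canonicalQ_comp`), which is the classifying rule; the square is cartesian by the universal
property of products (`isDefMor_cartesian`).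

The background is that Taylor coefficients determine coderivations and formal maps, by the Euler
field and division by integers, and that all admissible coefficients occur, for formal maps through
a convolution exponential. These divisions, and the factor one half in Q^U and in the graded flip,
use that k contains the rationals. -/

theorem sgn_congr (k : Type u) [CommRing k] {m n : ℤ} (h : Even (m - n)) : sgn k m = sgn k n := by
  have : m = n + (m - n) := by ring
  rw [this, sgn_add, sgn, sgn, Int.negOnePow_even _ h]
  simp

theorem sgn_add_one (k : Type u) [CommRing k] (n : ℤ) : sgn k (n + 1) = - sgn k n := by
  simp [sgn, Int.negOnePow_succ]

theorem sgn_eq_one_or (k : Type u) [CommRing k] (n : ℤ) :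
    (Even n ∧ sgn k n = 1) ∨ (Odd n ∧ sgn k n = -1) := by
  rcases Int.even_or_odd n with h | h
  · exact Or.inl ⟨h, by simp [sgn, Int.negOnePow_even _ h]⟩
  · exact Or.inr ⟨h, by simp [sgn, Int.negOnePow_odd _ h]⟩

section Basic

variable {k : Type u} [CommRing k]
variable {W : ℤ → Type v} [∀ i, AddCommGroup (W i)] [∀ i, Module k (W i)]

namespace Sym

theorem monomial_nil : monomial k W [] = 1 := rfl

theorem monomial_cons (p : Σ i, W i) (l : List (Σ i, W i)) :
    monomial k W (p :: l) = gen k W p.1 p.2 * monomial k W l := by simp [monomial]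

theorem monomial_append (l l' : List (Σ i, W i)) :
    monomial k W (l ++ l') = monomial k W l * monomial k W l' := by simp [monomial]

theorem incl_lof (i : ℤ) (a : W i) : incl k W (DirectSum.lof k ℤ W i a) = gen k W i a := rfl

theorem hom_ext_monomial {V : Type*} [AddCommGroup V] [Module k V] {f g : Sym k W →ₗ[k] V}
    (h : ∀ l, f (monomial k W l) = g (monomial k W l)) : f = g := by
  apply LinearMap.ext_on span_monomial
  rintro _ ⟨l, rfl⟩
  exact h l

theorem hom_ext_gen_mul {V : Type*} [AddCommGroup V] [Module k V] {f g : Sym k W →ₗ[k] V}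
    (one : f 1 = g 1)
    (gen_mul : ∀ i (a : W i) (l : List (Σ i, W i)), f (monomial k W l) = g (monomial k W l) →
      f (gen k W i a * monomial k W l) = g (gen k W i a * monomial k W l)) : f = g := by
  apply hom_ext_monomial
  intro l
  induction l with
  | nil => exact one
  | cons p l ih => rw [monomial_cons]; exact gen_mul _ _ _ ih

@[elab_as_elim]
theorem induction_monomial {p : Sym k W → Prop} (mono : ∀ l, p (monomial k W l))
    (add : ∀ x y, p x → p y → p (x + y)) (smul : ∀ (r : k) x, p x → p (r • x)) (x : Sym k W) :
    p x := by
  have hx : x ∈ Submodule.span k (Set.range (monomial k W)) := by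
    rw [span_monomial]; trivial
  induction hx using Submodule.span_induction with
  | mem x h => obtain ⟨l, rfl⟩ := h; exact mono l
  | zero => simpa using smul 0 _ (mono [])
  | add x y _ _ hx hy => exact add _ _ hx hy
  | smul r x _ hx => exact smul _ _ hx

theorem tensor_ext_deg {V : ℤ → Type w} [∀ i, AddCommGroup (V i)] [∀ i, Module k (V i)]
    {X : Type*} [AddCommGroup X] [Module k X] {f g : Sym k W ⊗[k] Sym k V →ₗ[k] X}
    (h : ∀ m n, ∀ x ∈ deg k W m, ∀ y ∈ deg k V n, f (x ⊗ₜ y) = g (x ⊗ₜ y)) : f = g := by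
  apply TensorProduct.ext
  apply hom_ext_deg
  intro m x hx
  apply hom_ext_deg
  intro n y hy
  exact h m n x hx y hy

/-! ### Degrees -/

theorem monomial_mem_deg (l : List (Σ i, W i)) : monomial k W l ∈ deg k W (l.map Sigma.fst).sum :=
  Submodule.subset_span ⟨l, rfl, rfl⟩

theorem one_mem_deg : (1 : Sym k W) ∈ deg k W 0 := Submodule.subset_span ⟨[], by simp, rfl⟩

theorem gen_mem_deg (i : ℤ) (a : W i) : gen k W i a ∈ deg k W i :=
  Submodule.subset_span ⟨[⟨i, a⟩], by simp, by simp [monomial]⟩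

theorem mul_mem_deg {m n : ℤ} {x y : Sym k W} (hx : x ∈ deg k W m) (hy : y ∈ deg k W n) :
    x * y ∈ deg k W (m + n) := by
  refine Submodule.span_induction₂ (p := fun x y _ _ => x * y ∈ deg k W (m + n))
    ?_ ?_ ?_ ?_ ?_ ?_ ?_ hx hy
  · rintro _ _ ⟨l, hl, rfl⟩ ⟨l', hl', rfl⟩
    exact Submodule.subset_span ⟨l ++ l', by simp [hl, hl'], monomial_append l l'⟩
  · intro y _; simp
  · intro y _; simp
  · intro x y z _ _ _ h1 h2; rw [add_mul]; exact Submodule.add_mem _ h1 h2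
  · intro x y z _ _ _ h1 h2; rw [mul_add]; exact Submodule.add_mem _ h1 h2
  · intro r x y _ _ h; rw [smul_mul_assoc]; exact Submodule.smul_mem _ _ h
  · intro r x y _ _ h; rw [mul_smul_comm]; exact Submodule.smul_mem _ _ h

theorem map_mem_of_monomial {X : Type*} [AddCommGroup X] [Module k X] (f : Sym k W →ₗ[k] X)
    (p : ℤ → Submodule k X)
    (h : ∀ l : List (Σ i, W i), f (monomial k W l) ∈ p (l.map Sigma.fst).sum)
    {n : ℤ} {x : Sym k W} (hx : x ∈ deg k W n) : f x ∈ p n := by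
  have : deg k W n ≤ (p n).comap f := by
    rw [deg, Submodule.span_le]
    rintro _ ⟨l, rfl, rfl⟩
    exact h l
  exact this hx

/-- Graded commutativity with the sign stored in `koszul`, so that no homogeneity of x is required.
This is what lets a factor be moved inside an arbitrary coproduct. -/
theorem koszul_mul_gen (i : ℤ) (a : W i) (x : Sym k W) :
    koszul k W i x * gen k W i a = gen k W i a * x := by
  have : (LinearMap.mulRight k (gen k W i a)) ∘ₗ (koszul k W i).toLinearMap =
      LinearMap.mulLeft k (gen k W i a) := by
    apply hom_ext_gen_mul
    · simp
    · intro j b l h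
      simp only [LinearMap.comp_apply, AlgHom.toLinearMap_apply, LinearMap.mulRight_apply,
        LinearMap.mulLeft_apply, map_mul, koszul_gen, smul_mul_assoc] at h ⊢
      rw [mul_assoc, h, ← mul_assoc, ← mul_assoc, gen_mul_gen i j, smul_mul_assoc]
  exact LinearMap.congr_fun this x

theorem koszul_one (i : ℤ) : koszul k W i 1 = 1 := map_one _

theorem koszul_even {i : ℤ} (hi : Even i) (x : Sym k W) : koszul k W i x = x := by
  have : (koszul k W i).toLinearMap = LinearMap.id := by
    apply hom_ext_deg
    intro n x hx
    rw [AlgHom.toLinearMap_apply, koszul_of_mem_deg i n x hx,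
      sgn_congr k (n := 0) (by simpa using hi.mul_right n), sgn_zero, one_smul]
    rfl
  exact LinearMap.congr_fun this x

/-! ### The counit -/

variable (k W) in
/-- The counit of `S(W)`, that is, the projection onto polynomial degree zero. -/
def counit : Sym k W →ₐ[k] k :=
  lift (fun _ => 0) (by simp)

theorem counit_gen (i : ℤ) (a : W i) : counit k W (gen k W i a) = 0 := by
  simp [counit, lift_gen]

theorem counit_koszul (i : ℤ) (x : Sym k W) : counit k W (koszul k W i x) = counit k W x := by
  have : (counit k W).toLinearMap ∘ₗ (koszul k W i).toLinearMap = (counit k W).toLinearMap := by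
    apply hom_ext_gen_mul
    · simp
    · intro j b l _
      simp [koszul_gen, counit_gen]
  exact LinearMap.congr_fun this x

theorem counit_comul (x : Sym k W) :
    TensorProduct.lid k _ (TensorProduct.map (counit k W).toLinearMap LinearMap.id
      (comul k W x)) = x := by
  have : (TensorProduct.lid k (Sym k W)).toLinearMap ∘ₗ
      TensorProduct.map (counit k W).toLinearMap LinearMap.id ∘ₗ comul k W = LinearMap.id := by
    apply hom_ext_gen_mul
    · simp [comul_one]
    · intro i a l h
      simp only [LinearMap.comp_apply, comul_gen_mul, LinearMap.id_apply,
        LinearEquiv.coe_coe] at h ⊢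
      -- Both sides now depend linearly on the coproduct of the tail alone, so it can be replaced by
      -- an arbitrary tensor and the claim checked on pure tensors.
      conv_rhs => rw [← h]
      generalize comul k W (monomial k W l) = t
      induction t using TensorProduct.induction_on with
      | zero => simp
      | tmul x y => simp [comulGen_tmul, counit_gen, counit_koszul]
      | add x y hx hy => simp only [map_add, hx, hy, mul_add]
  exact LinearMap.congr_fun this x

theorem comul_counit (x : Sym k W) :
    TensorProduct.rid k _ (TensorProduct.map LinearMap.id (counit k W).toLinearMap
      (comul k W x)) = x := by
  have : (TensorProduct.rid k (Sym k W)).toLinearMap ∘ₗ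
      TensorProduct.map LinearMap.id (counit k W).toLinearMap ∘ₗ comul k W = LinearMap.id := by
    apply hom_ext_gen_mul
    · simp [comul_one]
    · intro i a l h
      simp only [LinearMap.comp_apply, comul_gen_mul, LinearMap.id_apply,
        LinearEquiv.coe_coe] at h ⊢
      conv_rhs => rw [← h]
      generalize comul k W (monomial k W l) = t
      induction t using TensorProduct.induction_on with
      | zero => simp
      | tmul x y => simp [comulGen_tmul, counit_gen]
      | add x y hx hy => simp only [map_add, hx, hy, mul_add]
  exact LinearMap.congr_fun this x

/-! ### The projection onto polynomial degree one -/

theorem pr_gen_mul (i : ℤ) (a : W i) (x : Sym k W) :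
    pr k W (gen k W i a * x) = counit k W x • DirectSum.lof k ℤ W i a := by
  have : pr k W ∘ₗ LinearMap.mulLeft k (gen k W i a) =
      (LinearMap.toSpanSingleton k _ (DirectSum.lof k ℤ W i a)) ∘ₗ (counit k W).toLinearMap := by
    apply hom_ext_gen_mul
    · simp [pr_gen]
    · intro j b l _
      simp [pr_gen_mul_gen_mul, counit_gen]
  exact LinearMap.congr_fun this x

theorem pr_incl_mul (a : ⨁ i, W i) (x : Sym k W) :
    pr k W (incl k W a * x) = counit k W x • a := by
  induction a using DirectSum.induction_on with
  | zero => simp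
  | of i a => exact pr_gen_mul i a x
  | add a b ha hb => rw [map_add, add_mul, map_add, ha, hb, smul_add]

theorem counit_incl (a : ⨁ i, W i) : counit k W (incl k W a) = 0 := by
  induction a using DirectSum.induction_on with
  | zero => simp
  | of i a => exact counit_gen i a
  | add a b ha hb => rw [map_add, map_add, ha, hb, add_zero]

theorem comul_gen (i : ℤ) (a : W i) :
    comul k W (gen k W i a) = gen k W i a ⊗ₜ 1 + 1 ⊗ₜ gen k W i a := by
  have := comul_gen_mul k W i a 1
  rwa [mul_one, comul_one, comulGen_tmul, mul_one, koszul_one] at this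

/-- The homogeneous linear maps of degree `j` from `S(W)` to a graded module. -/
def IsHom {V : ℤ → Type w} [∀ i, AddCommGroup (V i)] [∀ i, Module k (V i)] (j : ℤ)
    (q : Sym k W →ₗ[k] ⨁ i, V i) : Prop :=
  ∀ n, ∀ x ∈ deg k W n, ∃ a : V (n + j), q x = DirectSum.lof k ℤ V (n + j) a

theorem exists_pr_eq {n : ℤ} {x : Sym k W} (hx : x ∈ deg k W n) :
    ∃ a : W n, pr k W x = DirectSum.lof k ℤ W n a := by
  have := map_mem_of_monomial (pr k W) (fun n => LinearMap.range (DirectSum.lof k ℤ W n)) ?_ hx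
  · obtain ⟨a, ha⟩ := this
    exact ⟨a, ha.symm⟩
  · rintro (_ | ⟨p, _ | ⟨q, l⟩⟩)
    · rw [monomial_nil, pr_one]; exact Submodule.zero_mem _
    · rw [monomial_cons, monomial_nil, mul_one, pr_gen]
      have e : ([p].map Sigma.fst).sum = p.1 := by simp
      rw [e]
      exact ⟨_, rfl⟩
    · rw [monomial_cons, monomial_cons, pr_gen_mul_gen_mul]; exact Submodule.zero_mem _

theorem incl_pr_koszul (i : ℤ) (x : Sym k W) :
    incl k W (pr k W (koszul k W i x)) = koszul k W i (incl k W (pr k W x)) := by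
  have : incl k W ∘ₗ pr k W ∘ₗ (koszul k W i).toLinearMap =
      (koszul k W i).toLinearMap ∘ₗ incl k W ∘ₗ pr k W := by
    apply hom_ext_deg
    intro n x hx
    obtain ⟨a, ha⟩ := exists_pr_eq hx
    simp only [LinearMap.comp_apply, AlgHom.toLinearMap_apply]
    rw [koszul_of_mem_deg i n x hx, map_smul, map_smul, ha, incl_lof, koszul_gen]
  exact LinearMap.congr_fun this x

/-! ### The Koszul automorphisms and the comultiplication -/

theorem map_koszul_comulGen (j i : ℤ) (a : W i) (t : Sym k W ⊗[k] Sym k W) :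
    TensorProduct.map (koszul k W j).toLinearMap (koszul k W j).toLinearMap (comulGen k W i a t) =
      sgn k (j * i) • comulGen k W i a
        (TensorProduct.map (koszul k W j).toLinearMap (koszul k W j).toLinearMap t) := by
  induction t using TensorProduct.induction_on with
  | zero => simp
  | tmul x y =>
    simp [comulGen_tmul, koszul_gen, koszul_comm j i, TensorProduct.smul_tmul']
  | add x y hx hy => simp only [map_add, hx, hy, smul_add]

theorem comul_koszul (j : ℤ) (x : Sym k W) :
    comul k W (koszul k W j x) =
      TensorProduct.map (koszul k W j).toLinearMap (koszul k W j).toLinearMap (comul k W x) := by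
  have : comul k W ∘ₗ (koszul k W j).toLinearMap =
      TensorProduct.map (koszul k W j).toLinearMap (koszul k W j).toLinearMap ∘ₗ comul k W := by
    apply hom_ext_gen_mul
    · simp [comul_one]
    · intro i a l h
      simp only [LinearMap.comp_apply, AlgHom.toLinearMap_apply] at h ⊢
      rw [comul_gen_mul, map_koszul_comulGen, ← h, map_mul, koszul_gen, smul_mul_assoc, map_smul,
        comul_gen_mul]
  exact LinearMap.congr_fun this x

/-! ### Coassociativity -/

theorem coassoc (x : Sym k W) :
    TensorProduct.assoc k _ _ _ (TensorProduct.map (comul k W) LinearMap.id (comul k W x)) =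
      TensorProduct.map LinearMap.id (comul k W) (comul k W x) := by
  have : (TensorProduct.assoc k _ _ _).toLinearMap ∘ₗ TensorProduct.map (comul k W) LinearMap.id ∘ₗ
      comul k W = TensorProduct.map LinearMap.id (comul k W) ∘ₗ comul k W := by
    apply hom_ext_gen_mul
    · simp [comul_one]
    · intro i a l h
      simp only [LinearMap.comp_apply, LinearEquiv.coe_coe, comul_gen_mul] at h ⊢
      -- Both iterated coproducts obey the same recursion: a new letter w acts by w ⊗ 1 ⊗ 1 + 1 ⊗ w
      -- ⊗ 1 + 1 ⊗ 1 ⊗ w with Koszul signs, which is the operator displayed here and in `h2`.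
      have h1 : ∀ t : Sym k W ⊗[k] Sym k W,
          TensorProduct.assoc k _ _ _ (TensorProduct.map (comul k W) LinearMap.id
            (comulGen k W i a t)) =
          (TensorProduct.map (LinearMap.mulLeft k (gen k W i a))
              (LinearMap.id : Module.End k (Sym k W ⊗[k] Sym k W)) +
            TensorProduct.map (koszul k W i).toLinearMap (comulGen k W i a) :
              Module.End k (Sym k W ⊗[k] (Sym k W ⊗[k] Sym k W)))
            (TensorProduct.assoc k _ _ _ (TensorProduct.map (comul k W) LinearMap.id t)) := by
        intro t
        induction t using TensorProduct.induction_on with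
        | zero => simp
        | tmul x y =>
          simp only [comulGen_tmul, map_add, TensorProduct.map_tmul, comul_gen_mul, comul_koszul,
            LinearMap.id_apply]
          generalize comul k W x = s
          induction s using TensorProduct.induction_on with
          | zero => simp
          | tmul x' x'' =>
            simp [comulGen_tmul, TensorProduct.add_tmul, TensorProduct.tmul_add]
            abel
          | add s t hs ht =>
            simp only [map_add, TensorProduct.add_tmul] at hs ht ⊢
            rw [← hs, ← ht]
            abel
        | add x y hx hy => simp only [map_add, hx, hy]
      have h2 : ∀ t : Sym k W ⊗[k] Sym k W,
          TensorProduct.map LinearMap.id (comul k W) (comulGen k W i a t) =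
          (TensorProduct.map (LinearMap.mulLeft k (gen k W i a))
              (LinearMap.id : Module.End k (Sym k W ⊗[k] Sym k W)) +
            TensorProduct.map (koszul k W i).toLinearMap (comulGen k W i a) :
              Module.End k (Sym k W ⊗[k] (Sym k W ⊗[k] Sym k W)))
            (TensorProduct.map LinearMap.id (comul k W) t) := by
        intro t
        induction t using TensorProduct.induction_on with
        | zero => simp
        | tmul x y => simp [comulGen_tmul, comul_gen_mul]
        | add x y hx hy => simp only [map_add, hx, hy]
      rw [h1, h2, h]
  exact LinearMap.congr_fun this x

/-! ### Cocommutativity -/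

variable (k W) in
/-- The graded flip `x ⊗ y ↦ (-1)^{|x| |y|} y ⊗ x`, expressed through the parity automorphism. -/
def swap [Algebra ℚ k] : Sym k W ⊗[k] Sym k W →ₗ[k] Sym k W ⊗[k] Sym k W :=
  (TensorProduct.comm k _ _).toLinearMap ∘ₗ (algebraMap ℚ k (1 / 2) •
    (LinearMap.id + TensorProduct.map (koszul k W 1).toLinearMap LinearMap.id +
      TensorProduct.map LinearMap.id (koszul k W 1).toLinearMap -
      TensorProduct.map (koszul k W 1).toLinearMap (koszul k W 1).toLinearMap))

theorem half_add_half (k : Type u) [CommRing k] [Algebra ℚ k] :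
    algebraMap ℚ k (1 / 2) * 2 = 1 := by
  have : (2 : k) = algebraMap ℚ k 2 := (map_ofNat _ 2).symm
  rw [this, ← map_mul]
  norm_num

theorem swap_tmul [Algebra ℚ k] {m n : ℤ} {x y : Sym k W} (hx : x ∈ deg k W m)
    (hy : y ∈ deg k W n) : swap k W (x ⊗ₜ y) = sgn k (m * n) • (y ⊗ₜ x) := by
  -- For signs ε = (-1)^m and δ = (-1)^n, the number (1 + ε + δ - εδ)/2 is -1 if both are -1, and 1
  -- otherwise. Hence parity automorphisms and one half suffice to write the graded flip.
  have key : algebraMap ℚ k (1 / 2) * (1 + sgn k m + sgn k n - sgn k m * sgn k n) =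
      sgn k (m * n) := by
    have h2 := half_add_half k
    rcases sgn_eq_one_or k m with ⟨hm, em⟩ | ⟨hm, em⟩
    · rw [em, sgn_congr k (m := m * n) (n := 0) (by simpa using hm.mul_right n), sgn_zero]
      linear_combination h2
    · rcases sgn_eq_one_or k n with ⟨hn, en⟩ | ⟨hn, en⟩
      · rw [em, en, sgn_congr k (m := m * n) (n := 0) (by simpa using hn.mul_left m), sgn_zero]
        linear_combination h2
      · rw [em, en, sgn, Int.negOnePow_odd _ (hm.mul hn)]
        push_cast
        linear_combination -h2
  simp only [swap, LinearMap.comp_apply, LinearMap.smul_apply, LinearMap.add_apply,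
    LinearMap.sub_apply, LinearMap.id_apply, TensorProduct.map_tmul, AlgHom.toLinearMap_apply,
    koszul_of_mem_deg _ _ _ hx, koszul_of_mem_deg _ _ _ hy, one_mul, LinearEquiv.coe_coe,
    map_smul, map_add, map_sub, TensorProduct.comm_tmul, TensorProduct.tmul_smul,
    ← TensorProduct.smul_tmul']
  rw [← key]
  module

theorem swap_comul [Algebra ℚ k] (x : Sym k W) : swap k W (comul k W x) = comul k W x := by
  have : swap k W ∘ₗ comul k W = comul k W := by
    apply hom_ext_gen_mul
    · simp only [LinearMap.comp_apply, comul_one]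
      rw [swap_tmul one_mem_deg one_mem_deg, mul_zero, sgn_zero, one_smul]
    · intro i a l h
      simp only [LinearMap.comp_apply, comul_gen_mul] at h ⊢
      -- Left multiplication by w ⊗ 1 + 1 ⊗ w is symmetric, so it commutes with the flip: the two
      -- summands are exchanged.
      have h1 : swap k W ∘ₗ comulGen k W i a = comulGen k W i a ∘ₗ swap k W := by
        apply tensor_ext_deg
        intro m n x hx y hy
        simp only [LinearMap.comp_apply, comulGen_tmul, swap_tmul hx hy, map_add, map_smul]
        rw [swap_tmul (mul_mem_deg (gen_mem_deg i a) hx) hy, koszul_of_mem_deg i m x hx,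
          koszul_of_mem_deg i n y hy, ← TensorProduct.smul_tmul', map_smul,
          swap_tmul hx (mul_mem_deg (gen_mem_deg i a) hy), ← TensorProduct.smul_tmul', smul_smul,
          smul_add, smul_smul, ← sgn_add, ← sgn_add, add_comm]
        congr 2
        · exact sgn_congr k ⟨i * m, by ring⟩
        · exact sgn_congr k ⟨0, by ring⟩
      have h2 := LinearMap.congr_fun h1 (comul k W (monomial k W l))
      simp only [LinearMap.comp_apply] at h2
      rw [h2, h]
  exact LinearMap.congr_fun this x

end Sym

end Basic

end

/-! ### Convolution, polynomial degree and the Euler field -/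

section

namespace Sym

variable {k : Type u} [CommRing k]
variable {V : ℤ → Type v} [∀ i, AddCommGroup (V i)] [∀ i, Module k (V i)]
variable {W : ℤ → Type w} [∀ i, AddCommGroup (W i)] [∀ i, Module k (W i)]

/-! ### The length filtration and the comultiplication -/

variable (k) in
/-- The tensors of two monomials whose lengths and whose linear degrees add up to the given ones. -/
def splitSpan (l : List (Σ i, W i)) : Submodule k (Sym k W ⊗[k] Sym k W) :=
  Submodule.span k {t | ∃ l₁ l₂ : List (Σ i, W i), l₁.length + l₂.length = l.length ∧
    (l₁.map Sigma.fst).sum + (l₂.map Sigma.fst).sum = (l.map Sigma.fst).sum ∧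
    monomial k W l₁ ⊗ₜ monomial k W l₂ = t}

/-- A substitute for the unshuffle formula: the degree and finiteness arguments only need that Δ
preserves total length and total degree. -/
theorem comul_monomial_mem (l : List (Σ i, W i)) : comul k W (monomial k W l) ∈ splitSpan k l := by
  induction l with
  | nil => exact Submodule.subset_span ⟨[], [], rfl, by simp, by rw [monomial_nil, comul_one]⟩
  | cons p l ih =>
    rw [monomial_cons, comul_gen_mul]
    generalize comul k W (monomial k W l) = t at ih
    have : splitSpan k l ≤ (splitSpan k (p :: l)).comap (comulGen k W p.1 p.2) := by
      conv_lhs => rw [splitSpan]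
      rw [Submodule.span_le]
      rintro _ ⟨l₁, l₂, h1, h2, rfl⟩
      rw [SetLike.mem_coe, Submodule.mem_comap, comulGen_tmul,
        koszul_of_mem_deg _ _ _ (monomial_mem_deg l₁), ← monomial_cons, ← monomial_cons,
        ← TensorProduct.smul_tmul']
      refine Submodule.add_mem _ (Submodule.subset_span ⟨p :: l₁, l₂, ?_, ?_, rfl⟩)
        (Submodule.smul_mem _ _ (Submodule.subset_span ⟨l₁, p :: l₂, ?_, ?_, rfl⟩)) <;>
      simp <;> lia
    exact this ih

/-! ### Convolution -/

section Conv

variable {A : Type*} [Ring A] [Algebra k A]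

/-- The convolution product of linear maps on `S(W)` (without signs). -/
def conv (p q : Sym k W →ₗ[k] A) : Sym k W →ₗ[k] A :=
  LinearMap.mul' k A ∘ₗ TensorProduct.map p q ∘ₗ comul k W

theorem conv_apply (p q : Sym k W →ₗ[k] A) (x : Sym k W) :
    conv p q x = LinearMap.mul' k A (TensorProduct.map p q (comul k W x)) := rfl

theorem conv_one (p q : Sym k W →ₗ[k] A) : conv p q 1 = p 1 * q 1 := by
  simp [conv_apply, comul_one]

theorem conv_sub_left (p p' q : Sym k W →ₗ[k] A) : conv (p - p') q = conv p q - conv p' q := by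
  ext x
  simp only [conv_apply, LinearMap.sub_apply]
  induction comul k W x using TensorProduct.induction_on with
  | zero => simp
  | tmul x y => simp [sub_mul]
  | add x y hx hy => simp only [map_add, hx, hy]; abel

theorem conv_sub_right (p q q' : Sym k W →ₗ[k] A) : conv p (q - q') = conv p q - conv p q' := by
  ext x
  simp only [conv_apply, LinearMap.sub_apply]
  induction comul k W x using TensorProduct.induction_on with
  | zero => simp
  | tmul x y => simp [mul_sub]
  | add x y hx hy => simp only [map_add, hx, hy]; abel

theorem conv_zero_left (q : Sym k W →ₗ[k] A) : conv 0 q = 0 := by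
  simp [conv]

theorem conv_zero_right (q : Sym k W →ₗ[k] A) : conv q 0 = 0 := by
  simp [conv]

variable (k W A) in
/-- The unit of the convolution product. -/
def convUnit : Sym k W →ₗ[k] A := Algebra.linearMap k A ∘ₗ (counit k W).toLinearMap

theorem convUnit_apply (x : Sym k W) : convUnit k W A x = algebraMap k A (counit k W x) := rfl

theorem conv_convUnit (p : Sym k W →ₗ[k] A) : conv p (convUnit k W A) = p := by
  have : LinearMap.mul' k A ∘ₗ TensorProduct.map p (convUnit k W A) =
      p ∘ₗ (TensorProduct.rid k _).toLinearMap ∘ₗ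
        TensorProduct.map LinearMap.id (counit k W).toLinearMap := by
    apply TensorProduct.ext'
    intro x y
    simp [convUnit_apply, Algebra.algebraMap_eq_smul_one]
  rw [conv, ← LinearMap.comp_assoc, this]
  ext x
  simp [comul_counit]

theorem convUnit_conv (p : Sym k W →ₗ[k] A) : conv (convUnit k W A) p = p := by
  have : LinearMap.mul' k A ∘ₗ TensorProduct.map (convUnit k W A) p =
      p ∘ₗ (TensorProduct.lid k _).toLinearMap ∘ₗ
        TensorProduct.map (counit k W).toLinearMap LinearMap.id := by
    apply TensorProduct.ext'
    intro x y
    simp [convUnit_apply, Algebra.algebraMap_eq_smul_one]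
  rw [conv, ← LinearMap.comp_assoc, this]
  ext x
  simp [counit_comul]

theorem convUnit_koszul (i : ℤ) :
    convUnit k W A ∘ₗ (koszul k W i).toLinearMap = convUnit k W A := by
  ext x
  simp [convUnit_apply, counit_koszul]

end Conv

theorem conv_mem_deg {i j : ℤ} {p q : Sym k V →ₗ[k] Sym k W}
    (hp : ∀ n, ∀ x ∈ deg k V n, p x ∈ deg k W (n + i))
    (hq : ∀ n, ∀ x ∈ deg k V n, q x ∈ deg k W (n + j)) :
    ∀ n, ∀ x ∈ deg k V n, conv p q x ∈ deg k W (n + (i + j)) := by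
  intro n x hx
  refine map_mem_of_monomial (conv p q) (fun n => deg k W (n + (i + j))) (fun l => ?_) hx
  have h : splitSpan k l ≤ (deg k W ((l.map Sigma.fst).sum + (i + j))).comap
      (LinearMap.mul' k _ ∘ₗ TensorProduct.map p q) := by
    rw [splitSpan, Submodule.span_le]
    rintro _ ⟨l₁, l₂, -, h, rfl⟩
    have := mul_mem_deg (hp _ _ (monomial_mem_deg l₁)) (hq _ _ (monomial_mem_deg l₂))
    rw [add_add_add_comm, h] at this
    simpa using this
  exact h (comul_monomial_mem l)

/-! ### Polynomial degrees -/

variable (k W) in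
/-- The algebra map `S(W) → S(W)[X]` which multiplies the elements of polynomial degree `n`
by `X ^ n`. -/
def polyDeg : Sym k W →ₐ[k] Polynomial (Sym k W) :=
  lift (fun i => ((Polynomial.monomial 1).restrictScalars k).comp (gen k W i)) (by
    intro i j a b
    simp only [LinearMap.comp_apply, LinearMap.restrictScalars_apply,
      Polynomial.monomial_mul_monomial]
    rw [gen_mul_gen, ← Polynomial.smul_monomial])

theorem polyDeg_gen (i : ℤ) (a : W i) :
    polyDeg k W (gen k W i a) = Polynomial.C (gen k W i a) * Polynomial.X := by
  simp [polyDeg, lift_gen, Polynomial.C_mul_X_eq_monomial]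

theorem polyDeg_gen_mul (i : ℤ) (a : W i) (x : Sym k W) :
    polyDeg k W (gen k W i a * x) = Polynomial.C (gen k W i a) * (polyDeg k W x * Polynomial.X) := by
  rw [map_mul, polyDeg_gen, mul_assoc, Polynomial.X_mul]

variable (k W) in
/-- The projection of `S(W)` onto polynomial degree `n`. -/
def proj (n : ℕ) : Sym k W →ₗ[k] Sym k W where
  toFun x := (polyDeg k W x).coeff n
  map_add' x y := by simp
  map_smul' r x := by simp

theorem proj_gen_mul_succ (n : ℕ) (i : ℤ) (a : W i) (x : Sym k W) :
    proj k W (n + 1) (gen k W i a * x) = gen k W i a * proj k W n x := by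
  simp [proj, polyDeg_gen_mul]

theorem proj_gen_mul_zero (i : ℤ) (a : W i) (x : Sym k W) :
    proj k W 0 (gen k W i a * x) = 0 := by
  simp [proj, polyDeg_gen_mul]

theorem proj_incl_mul_succ (n : ℕ) (a : ⨁ i, W i) (x : Sym k W) :
    proj k W (n + 1) (incl k W a * x) = incl k W a * proj k W n x := by
  induction a using DirectSum.induction_on with
  | zero => simp
  | of i a => exact proj_gen_mul_succ n i a x
  | add a b ha hb => rw [map_add, add_mul, map_add, ha, hb, add_mul]

theorem proj_zero (x : Sym k W) : proj k W 0 x = algebraMap k _ (counit k W x) := by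
  have : proj k W 0 = convUnit k W (Sym k W) := by
    apply hom_ext_gen_mul
    · simp [proj, convUnit_apply]
    · intro i a l _
      simp [proj_gen_mul_zero, convUnit_apply, counit_gen]
  rw [this]; rfl

theorem eval_polyDeg (x : Sym k W) : (polyDeg k W x).eval 1 = x := by
  induction x using induction_monomial with
  | mono l =>
    induction l with
    | nil => simp [monomial_nil]
    | cons p l ih =>
      rw [monomial_cons, polyDeg_gen_mul, Polynomial.eval_C_mul, Polynomial.eval_mul_X, ih, mul_one]
  | add x y hx hy => rw [map_add, Polynomial.eval_add, hx, hy]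
  | smul r x hx => rw [map_smul, Polynomial.eval_smul, hx]

/-- The components are the coefficients of `polyDeg`, and setting X = 1 recovers the element from
them. -/
theorem eq_zero_of_proj {x : Sym k W} (h : ∀ n, proj k W n x = 0) : x = 0 := by
  have h1 : polyDeg k W x = 0 := Polynomial.ext h
  rw [← eval_polyDeg x, h1, Polynomial.eval_zero]

variable (k W) in
/-- The Euler vector field, which multiplies the elements of polynomial degree `n` by `n`. -/
def euler : Sym k W →ₗ[k] Sym k W := conv (incl k W ∘ₗ pr k W) LinearMap.id

/-- In the coproduct either the new letter itself is split off as the linear factor, leaving the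
counit of the rest, or it stays in the second factor and is pulled out in front; the sign of Δ
cancels the sign of that move. -/
theorem euler_gen_mul (i : ℤ) (a : W i) (x : Sym k W) :
    euler k W (gen k W i a * x) = gen k W i a * x + gen k W i a * euler k W x := by
  have h : ∀ t : Sym k W ⊗[k] Sym k W,
      LinearMap.mul' k _ (TensorProduct.map (incl k W ∘ₗ pr k W) LinearMap.id (comulGen k W i a t))
        = gen k W i a * (TensorProduct.lid k _ (TensorProduct.map (counit k W).toLinearMap
          LinearMap.id t)) + gen k W i a * LinearMap.mul' k _
            (TensorProduct.map (incl k W ∘ₗ pr k W) LinearMap.id t) := by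
    intro t
    induction t using TensorProduct.induction_on with
    | zero => simp
    | tmul x y =>
      simp only [comulGen_tmul, map_add, TensorProduct.map_tmul, LinearMap.comp_apply,
        LinearMap.mul'_apply, LinearMap.id_apply, pr_gen_mul, map_smul, incl_lof,
        incl_pr_koszul, TensorProduct.lid_tmul, AlgHom.toLinearMap_apply]
      rw [← mul_assoc (koszul k W i _), koszul_mul_gen, mul_assoc, smul_mul_assoc, mul_smul_comm]
    | add x y hx hy => simp only [map_add, mul_add, hx, hy]; abel
  rw [euler, conv_apply, comul_gen_mul, h, counit_comul]
  rfl

/-- Over the rationals this recovers the component of degree n + 1 from a convolution of linear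
parts with components of degree n. All uniqueness results for Taylor coefficients rest on it. -/
theorem proj_euler (n : ℕ) (x : Sym k W) : proj k W n (euler k W x) = (n : k) • proj k W n x := by
  have : ∀ n, proj k W n ∘ₗ euler k W = (n : k) • proj k W n := by
    intro n
    apply hom_ext_monomial
    intro l
    induction l generalizing n with
    | nil =>
      rw [monomial_nil, LinearMap.comp_apply, euler, conv_one]
      simp [pr_one]
      rcases n with _ | n
      · simp
      · simp [proj, Polynomial.coeff_one]
    | cons p l ih =>
      simp only [LinearMap.comp_apply, LinearMap.smul_apply, monomial_cons] at ih ⊢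
      rw [euler_gen_mul, map_add]
      rcases n with _ | n
      · simp [proj_gen_mul_zero]
      · rw [proj_gen_mul_succ, proj_gen_mul_succ, ih, Nat.cast_succ, add_smul, one_smul,
          mul_smul_comm, add_comm]
  exact LinearMap.congr_fun (this n) x

theorem smul_eq_zero_of_rat [Algebra ℚ k] {X : Type*} [AddCommGroup X] [Module k X] (n : ℕ) {x : X}
    (h : ((n + 1 : ℕ) : k) • x = 0) : x = 0 := by
  have : algebraMap ℚ k (1 / (n + 1 : ℕ)) * ((n + 1 : ℕ) : k) = 1 := by
    rw [← map_natCast (algebraMap ℚ k), ← map_mul, one_div_mul_cancel (by positivity), map_one]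
  rw [← one_smul k x, ← this, mul_smul, h, smul_zero]

end Sym

end

/-! ### Coderivations along a formal map, and uniqueness from Taylor coefficients -/

section

open FormalDG.Sym

variable {k : Type u} [CommRing k]
variable {U : ℤ → Type z} [∀ i, AddCommGroup (U i)] [∀ i, Module k (U i)]
variable {V : ℤ → Type v} [∀ i, AddCommGroup (V i)] [∀ i, Module k (V i)]
variable {W : ℤ → Type w} [∀ i, AddCommGroup (W i)] [∀ i, Module k (W i)]

theorem map_apply_of_comp_eq {X Y Z X' Y' Z' : Type*} [AddCommGroup X] [AddCommGroup Y]
    [AddCommGroup X'] [AddCommGroup Y'] [AddCommGroup Z] [AddCommGroup Z'] [Module k X] [Module k Y]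
    [Module k X'] [Module k Y'] [Module k Z] [Module k Z']
    (f : Y →ₗ[k] Z) (g : X →ₗ[k] Y) (f' : Y' →ₗ[k] Z') (g' : X' →ₗ[k] Y') (t : X ⊗[k] X') :
    TensorProduct.map f f' (TensorProduct.map g g' t) =
      TensorProduct.map (f ∘ₗ g) (f' ∘ₗ g') t := by
  rw [TensorProduct.map_comp]; rfl

/-- A linear map `D : S(V) → S(W)` is a coderivation of degree `j` along `F`. -/
def IsCoderAlong (j : ℤ) (F D : Sym k V →ₗ[k] Sym k W) : Prop :=
  comul k W ∘ₗ D = (TensorProduct.map D F +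
    TensorProduct.map (F ∘ₗ (koszul k V j).toLinearMap) D) ∘ₗ comul k V

theorem IsCoderAlong.sub {j : ℤ} {F D D' : Sym k V →ₗ[k] Sym k W} (h : IsCoderAlong j F D)
    (h' : IsCoderAlong j F D') : IsCoderAlong j F (D - D') := by
  unfold IsCoderAlong at *
  rw [LinearMap.comp_sub, h, h', ← LinearMap.sub_comp]
  congr 1
  apply TensorProduct.ext'
  intro x y
  simp [TensorProduct.sub_tmul, TensorProduct.tmul_sub]
  abel

/-- The co-Leibniz rule in the form that applies to `euler`, which is itself a convolution. -/
theorem IsCoderAlong.conv_comp {A : Type*} [Ring A] [Algebra k A] {j : ℤ}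
    {F D : Sym k V →ₗ[k] Sym k W} (h : IsCoderAlong j F D) (p q : Sym k W →ₗ[k] A) :
    conv p q ∘ₗ D = conv (p ∘ₗ D) (q ∘ₗ F) +
      conv (p ∘ₗ F ∘ₗ (koszul k V j).toLinearMap) (q ∘ₗ D) := by
  rw [conv, LinearMap.comp_assoc, LinearMap.comp_assoc, h]
  simp only [conv, TensorProduct.map_comp, LinearMap.add_comp, LinearMap.comp_add,
    LinearMap.comp_assoc]

namespace IsFormalMap

theorem conv_comp {A : Type*} [Ring A] [Algebra k A] {F : Sym k V →ₗ[k] Sym k W}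
    (hF : IsFormalMap F) (p q : Sym k W →ₗ[k] A) :
    conv p q ∘ₗ F = conv (p ∘ₗ F) (q ∘ₗ F) := by
  rw [conv, conv, LinearMap.comp_assoc, LinearMap.comp_assoc, hF.comul_comp,
    TensorProduct.map_comp]
  rfl

theorem id : IsFormalMap (LinearMap.id : Sym k W →ₗ[k] Sym k W) :=
  ⟨fun _ _ h => h, by simp, rfl⟩

theorem comp {F : Sym k V →ₗ[k] Sym k W} {G : Sym k U →ₗ[k] Sym k V}
    (hF : IsFormalMap F) (hG : IsFormalMap G) : IsFormalMap (F ∘ₗ G) where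
  mem_deg n x hx := hF.mem_deg _ _ (hG.mem_deg _ _ hx)
  comul_comp := by
    rw [← LinearMap.comp_assoc, hF.comul_comp, LinearMap.comp_assoc, hG.comul_comp,
      TensorProduct.map_comp, LinearMap.comp_assoc]
  map_one := by rw [LinearMap.comp_apply, hG.map_one, hF.map_one]

theorem koszul_comp {F : Sym k V →ₗ[k] Sym k W} (hF : IsFormalMap F) (i : ℤ) :
    (koszul k W i).toLinearMap ∘ₗ F = F ∘ₗ (koszul k V i).toLinearMap := by
  apply hom_ext_deg
  intro n x hx
  simp only [LinearMap.comp_apply, AlgHom.toLinearMap_apply]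
  rw [koszul_of_mem_deg i n _ (hF.mem_deg n x hx), koszul_of_mem_deg i n x hx, map_smul]

/-- The counit is not part of the definition of a formal map. Its pullback `c` is idempotent for
convolution, so d = c - e satisfies d * d = -d. As d(1) = 0, only splittings into two strictly
shorter monomials can contribute to d * d, and d vanishes by induction on length. -/
theorem counit_comp {F : Sym k V →ₗ[k] Sym k W} (hF : IsFormalMap F) :
    (counit k W).toLinearMap ∘ₗ F = (counit k V).toLinearMap := by
  set e : Sym k V →ₗ[k] k := (counit k V).toLinearMap with he
  set c : Sym k V →ₗ[k] k := (counit k W).toLinearMap ∘ₗ F with hc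
  have eu : e = convUnit k V k := rfl
  have hcc : conv c c = c := by
    rw [hc, ← hF.conv_comp]
    congr 1
    exact convUnit_conv _
  have hu : conv (c - e) (c - e) = -(c - e) := by
    rw [conv_sub_left, conv_sub_right, conv_sub_right, hcc, eu, conv_convUnit, convUnit_conv,
      convUnit_conv]
    abel
  have hz : ∀ n, ∀ l : List (Σ i, V i), l.length = n → (c - e) (monomial k V l) = 0 := by
    intro n
    induction n using Nat.strong_induction_on with
    | _ n ih =>
      rintro l rfl
      rw [← neg_eq_zero, ← LinearMap.neg_apply, ← hu, conv_apply]
      have h : splitSpan k l ≤ LinearMap.ker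
          (LinearMap.mul' k k ∘ₗ TensorProduct.map (c - e) (c - e)) := by
        rw [splitSpan, Submodule.span_le]
        rintro _ ⟨l₁, l₂, h, -, rfl⟩
        rw [SetLike.mem_coe, LinearMap.mem_ker, LinearMap.comp_apply, TensorProduct.map_tmul,
          LinearMap.mul'_apply]
        have h1 : (c - e) 1 = 0 := by simp [hc, he, hF.map_one]
        rcases l₁ with _ | ⟨p, l₁⟩
        · rw [monomial_nil, h1, zero_mul]
        rcases l₂ with _ | ⟨q, l₂⟩
        · rw [monomial_nil, h1, mul_zero]
        · rw [ih _ _ (p :: l₁) rfl, zero_mul]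
          rw [← h]; simp
      exact h (comul_monomial_mem l)
  rw [← sub_eq_zero]
  apply hom_ext_monomial
  intro l
  rw [hz _ l rfl]; rfl

theorem ext [Algebra ℚ k] {F G : Sym k V →ₗ[k] Sym k W} (hF : IsFormalMap F) (hG : IsFormalMap G)
    (h : pr k W ∘ₗ F = pr k W ∘ₗ G) : F = G := by
  -- The Euler field evaluated on F: the component of F in degree n + 1 is determined by its linear
  -- part and by its component in degree n. The recursion starts at the counit.
  have key : ∀ {F : Sym k V →ₗ[k] Sym k W}, IsFormalMap F → ∀ n x,
      ((n + 1 : ℕ) : k) • proj k W (n + 1) (F x) =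
        conv (incl k W ∘ₗ pr k W ∘ₗ F) (proj k W n ∘ₗ F) x := by
    intro F hF n x
    rw [← proj_euler, ← LinearMap.comp_apply (euler k W), euler, hF.conv_comp]
    simp only [conv_apply]
    induction comul k V x using TensorProduct.induction_on with
    | zero => simp
    | tmul x y => simp [proj_incl_mul_succ]
    | add x y hx hy => simp only [map_add, hx, hy]
  have hp : ∀ n, proj k W n ∘ₗ F = proj k W n ∘ₗ G := by
    intro n
    induction n with
    | zero =>
      ext x
      have := LinearMap.congr_fun (hF.counit_comp.trans hG.counit_comp.symm) x
      simp only [LinearMap.comp_apply, proj_zero, AlgHom.toLinearMap_apply] at this ⊢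
      rw [this]
    | succ n ih =>
      ext x
      rw [← sub_eq_zero]
      apply smul_eq_zero_of_rat (k := k) n
      rw [smul_sub, LinearMap.comp_apply, LinearMap.comp_apply, key hF, key hG, ih, h, sub_self]
  ext x
  rw [← sub_eq_zero]
  apply eq_zero_of_proj
  intro n
  rw [map_sub, sub_eq_zero]
  exact LinearMap.congr_fun (hp n) x

end IsFormalMap

namespace IsCoderAlong

/-- Applying the counit to both factors of the co-Leibniz rule gives εD = εD + εD. -/
theorem counit_comp {j : ℤ} {F D : Sym k V →ₗ[k] Sym k W}
    (hF : IsFormalMap F) (hD : IsCoderAlong j F D) : (counit k W).toLinearMap ∘ₗ D = 0 := by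
  have h := hD.conv_comp (convUnit k W k) (convUnit k W k)
  have e : convUnit k W k ∘ₗ F = convUnit k V k := hF.counit_comp
  rw [convUnit_conv, e, conv_convUnit, ← LinearMap.comp_assoc, e, convUnit_koszul,
    convUnit_conv] at h
  exact left_eq_add.mp h

/-- The recursion of `IsFormalMap.ext` again. With vanishing linear part, one term of the co-Leibniz
rule disappears and the other only involves the component of D in degree n. -/
theorem eq_zero [Algebra ℚ k] {j : ℤ} {F D : Sym k V →ₗ[k] Sym k W} (hF : IsFormalMap F)
    (hD : IsCoderAlong j F D) (h : pr k W ∘ₗ D = 0) : D = 0 := by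
  have hp : ∀ n, proj k W n ∘ₗ D = 0 := by
    intro n
    induction n with
    | zero =>
      ext x
      have := LinearMap.congr_fun (hD.counit_comp hF) x
      simp only [LinearMap.comp_apply, proj_zero, AlgHom.toLinearMap_apply] at this ⊢
      rw [this]
      simp
    | succ n ih =>
      ext x
      apply smul_eq_zero_of_rat (k := k) n
      rw [LinearMap.comp_apply, ← proj_euler, ← LinearMap.comp_apply (euler k W), euler,
        hD.conv_comp, LinearMap.comp_assoc, h, LinearMap.comp_zero, conv_zero_left, zero_add]
      have : proj k W (n + 1) (conv ((incl k W ∘ₗ pr k W) ∘ₗ F ∘ₗ (koszul k V j).toLinearMap)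
          (LinearMap.id ∘ₗ D) x) = conv ((incl k W ∘ₗ pr k W) ∘ₗ F ∘ₗ (koszul k V j).toLinearMap)
          (proj k W n ∘ₗ D) x := by
        simp only [conv_apply]
        induction comul k V x using TensorProduct.induction_on with
        | zero => simp
        | tmul x y => simp [proj_incl_mul_succ]
        | add x y hx hy => simp only [map_add, hx, hy]
      rw [this, ih, conv_zero_right]
      rfl
  ext x
  exact eq_zero_of_proj fun n => LinearMap.congr_fun (hp n) x

theorem ext [Algebra ℚ k] {j : ℤ} {F D D' : Sym k V →ₗ[k] Sym k W} (hF : IsFormalMap F)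
    (hD : IsCoderAlong j F D) (hD' : IsCoderAlong j F D')
    (h : pr k W ∘ₗ D = pr k W ∘ₗ D') : D = D' := by
  rw [← sub_eq_zero]
  apply (hD.sub hD').eq_zero hF
  rw [LinearMap.comp_sub, h, sub_self]

end IsCoderAlong

theorem isCoderAlong_of_mem {j : ℤ} {Q : Module.End k (Sym k W)} (hQ : Q ∈ Coder k W j) :
    IsCoderAlong j LinearMap.id Q := hQ.2

theorem IsFormalMap.comp_coder {j : ℤ} {F : Sym k V →ₗ[k] Sym k W} (hF : IsFormalMap F)
    {P : Module.End k (Sym k V)} (hP : P ∈ Coder k V j) : IsCoderAlong j F (F ∘ₗ P) := by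
  rw [IsCoderAlong, ← LinearMap.comp_assoc, hF.comul_comp, LinearMap.comp_assoc, hP.2,
    ← LinearMap.comp_assoc, LinearMap.comp_add, ← TensorProduct.map_comp, ← TensorProduct.map_comp]
  rfl

theorem IsFormalMap.coder_comp {j : ℤ} {F : Sym k V →ₗ[k] Sym k W} (hF : IsFormalMap F)
    {Q : Module.End k (Sym k W)} (hQ : Q ∈ Coder k W j) : IsCoderAlong j F (Q ∘ₗ F) := by
  rw [IsCoderAlong, ← LinearMap.comp_assoc, hQ.2, LinearMap.comp_assoc, hF.comul_comp,
    ← LinearMap.comp_assoc, LinearMap.add_comp, ← TensorProduct.map_comp, ← TensorProduct.map_comp,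
    hF.koszul_comp]
  rfl

theorem coder_ext [Algebra ℚ k] {j : ℤ} {P Q : Module.End k (Sym k W)} (hP : P ∈ Coder k W j)
    (hQ : Q ∈ Coder k W j) (h : pr k W ∘ₗ P = pr k W ∘ₗ Q) : P = Q :=
  IsCoderAlong.ext IsFormalMap.id (isCoderAlong_of_mem hP) (isCoderAlong_of_mem hQ) h

theorem counit_coder {j : ℤ} {P : Module.End k (Sym k W)} (hP : P ∈ Coder k W j) (x : Sym k W) :
    counit k W (P x) = 0 :=
  LinearMap.congr_fun ((isCoderAlong_of_mem hP).counit_comp IsFormalMap.id) x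

/-- For an odd field, Q² is half of [Q, Q]. -/
theorem sq_mem_coder [Algebra ℚ k] {Q : Module.End k (Sym k W)} (hQ : Q ∈ Coder k W 1) :
    Q ∘ₗ Q ∈ Coder k W (1 + 1) := by
  have h := Submodule.smul_mem _ (algebraMap ℚ k (1 / 2)) (bracket_mem hQ hQ)
  have e : Q ∘ₗ Q - sgn k (1 * 1) • (Q ∘ₗ Q) = (2 : k) • (Q ∘ₗ Q) := by
    ext x
    simp [sgn, two_smul]
  rwa [e, smul_smul, half_add_half, one_smul] at h

/-! ### Vector fields with given Taylor coefficients -/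

theorem ofTaylor_eq_conv (q : Sym k W →ₗ[k] ⨁ i, W i) :
    ofTaylor k W q = conv (incl k W ∘ₗ q) LinearMap.id := rfl

theorem ofTaylor_one (q : Sym k W →ₗ[k] ⨁ i, W i) : ofTaylor k W q 1 = incl k W (q 1) := by
  rw [ofTaylor_eq_conv, conv_one]; simp

/-- The linear part of a product with a factor in W sees only the counit of the other factor, and
the counit axiom collapses the coproduct. -/
theorem pr_ofTaylor (q : Sym k W →ₗ[k] ⨁ i, W i) : pr k W ∘ₗ ofTaylor k W q = q := by
  have : pr k W ∘ₗ LinearMap.mul' k _ ∘ₗ TensorProduct.map (incl k W ∘ₗ q) LinearMap.id =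
      q ∘ₗ (TensorProduct.rid k _).toLinearMap ∘ₗ
        TensorProduct.map LinearMap.id (counit k W).toLinearMap := by
    apply TensorProduct.ext'
    intro x y
    simp [pr_incl_mul]
  ext x : 1
  have h := LinearMap.congr_fun this (comul k W x)
  simp only [LinearMap.comp_apply, LinearEquiv.coe_coe, comul_counit] at h
  exact h

theorem Sym.IsHom.incl_mem {j : ℤ} {q : Sym k V →ₗ[k] ⨁ i, W i} (hq : IsHom j q) :
    ∀ n, ∀ x ∈ deg k V n, (incl k W ∘ₗ q) x ∈ deg k W (n + j) := by
  intro n x hx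
  obtain ⟨a, ha⟩ := hq n x hx
  rw [LinearMap.comp_apply, ha, incl_lof]
  exact gen_mem_deg _ _

theorem koszul_comp_of_deg {j : ℤ} {f : Sym k V →ₗ[k] Sym k W}
    (hf : ∀ n, ∀ x ∈ deg k V n, f x ∈ deg k W (n + j)) (i : ℤ) (x : Sym k V) :
    f (koszul k V i x) = sgn k (i * j) • koszul k W i (f x) := by
  have : f ∘ₗ (koszul k V i).toLinearMap =
      sgn k (i * j) • ((koszul k W i).toLinearMap ∘ₗ f) := by
    apply hom_ext_deg
    intro n x hx
    simp only [LinearMap.comp_apply, AlgHom.toLinearMap_apply, LinearMap.smul_apply]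
    rw [koszul_of_mem_deg i _ _ (hf n x hx), koszul_of_mem_deg i n x hx, map_smul, smul_smul,
      ← sgn_add]
    congr 1
    exact sgn_congr k ⟨-(i * j), by ring⟩
  exact LinearMap.congr_fun this x

theorem ofTaylor_mem_deg {j : ℤ} {q : Sym k W →ₗ[k] ⨁ i, W i} (hq : IsHom j q) :
    ∀ n, ∀ x ∈ deg k W n, ofTaylor k W q x ∈ deg k W (n + j) := by
  have := conv_mem_deg (j := 0) hq.incl_mem (q := LinearMap.id) (fun n x hx => by simpa using hx)
  rwa [add_zero] at this

theorem Sym.IsHom.comp_mulLeft {j : ℤ} {q : Sym k W →ₗ[k] ⨁ i, W i} (hq : IsHom j q) (i : ℤ)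
    (a : W i) : IsHom (i + j) (q ∘ₗ LinearMap.mulLeft k (gen k W i a)) := by
  intro n x hx
  have h := hq (i + n) _ (mul_mem_deg (gen_mem_deg i a) hx)
  rwa [show i + n + j = n + (i + j) by ring] at h

/-- The new letter either enters the argument of q or remains outside, where pulling it to the front
crosses q. This recursion drives the proof of the co-Leibniz rule. -/
theorem ofTaylor_gen_mul {j : ℤ} {q : Sym k W →ₗ[k] ⨁ i, W i} (hq : IsHom j q) (i : ℤ)
    (a : W i) (x : Sym k W) :
    ofTaylor k W q (gen k W i a * x) =
      ofTaylor k W (q ∘ₗ LinearMap.mulLeft k (gen k W i a)) x +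
        sgn k (i * j) • (gen k W i a * ofTaylor k W q x) := by
  simp only [ofTaylor_eq_conv, conv_apply, comul_gen_mul]
  induction comul k W x using TensorProduct.induction_on with
  | zero => simp
  | tmul x y =>
    simp only [comulGen_tmul, map_add, TensorProduct.map_tmul, LinearMap.mul'_apply,
      koszul_comp_of_deg hq.incl_mem, smul_mul_assoc, LinearMap.id_apply]
    rw [← mul_assoc (koszul k W i _), koszul_mul_gen, mul_assoc]
    rfl
  | add x y hx hy =>
    simp only [map_add, mul_add, smul_add, hx, hy]
    abel

theorem ofTaylor_mem_coder {j : ℤ} {q : Sym k W →ₗ[k] ⨁ i, W i} (hq : IsHom j q) :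
    ofTaylor k W q ∈ Coder k W j := by
  refine ⟨ofTaylor_mem_deg hq, ?_⟩
  apply hom_ext_monomial
  intro l
  simp only [LinearMap.comp_apply]
  -- The degree and the coefficients must vary: peeling off a letter w of degree i replaces q by q(w
  -- ⊙ ·), of degree i + j.
  induction l generalizing j q with
  | nil =>
    have h : ∀ a, comul k W (incl k W a) = incl k W a ⊗ₜ 1 + 1 ⊗ₜ incl k W a := by
      intro a
      induction a using DirectSum.induction_on with
      | zero => simp
      | of i a => exact comul_gen i a
      | add a b ha hb =>
        rw [map_add, map_add, ha, hb, TensorProduct.add_tmul, TensorProduct.tmul_add]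
        abel
    simp [monomial_nil, ofTaylor_one, comul_one, h]
  | cons p l ih =>
    obtain ⟨i, a⟩ := p
    rw [monomial_cons, ofTaylor_gen_mul hq, map_add, map_smul, comul_gen_mul, comul_gen_mul,
      ih hq, ih (hq.comp_mulLeft i a)]
    have hk : (koszul k W (i + j)).toLinearMap = _ := koszul_add i j
    induction comul k W (monomial k W l) using TensorProduct.induction_on with
    | zero => simp
    | tmul x y =>
      simp only [hk, comulGen_tmul, map_add, LinearMap.add_apply, TensorProduct.map_tmul,
        LinearMap.id_apply, AlgHom.toLinearMap_apply, ofTaylor_gen_mul hq, map_mul, koszul_gen,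
        koszul_comp_of_deg (ofTaylor_mem_deg hq), LinearMap.comp_apply, smul_mul_assoc,
        TensorProduct.add_tmul, TensorProduct.tmul_add, TensorProduct.smul_tmul',
        TensorProduct.tmul_smul, smul_add, koszul_comm j i, mul_comm j i]
      abel
    | add x y hx hy =>
      simp only [map_add, smul_add] at hx hy ⊢
      rw [← hx, ← hy]
      abel

end

/-! ### Formal maps with prescribed Taylor coefficients -/

section

open FormalDG.Sym

variable {k : Type u} [CommRing k]
variable {V : ℤ → Type v} [∀ i, AddCommGroup (V i)] [∀ i, Module k (V i)]
variable {W : ℤ → Type w} [∀ i, AddCommGroup (W i)] [∀ i, Module k (W i)]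

/-! ### Locally finite sums of linear maps -/

section LocSum

variable {X Y : Type*} [AddCommGroup X] [AddCommGroup Y] [Module k X] [Module k Y]

theorem finsum_eq_sum_range {E : ℕ → X →ₗ[k] Y} {x : X} {N : ℕ} (h : ∀ n, N ≤ n → E n x = 0) :
    ∑ᶠ n, E n x = ∑ n ∈ Finset.range N, E n x := by
  apply finsum_eq_sum_of_support_subset
  intro n hn
  by_contra hc
  exact hn (h n (by simpa using hc))

/-- The sum of a locally finite sequence of linear maps. -/
def locSum (E : ℕ → X →ₗ[k] Y) (h : ∀ x, ∃ N, ∀ n, N ≤ n → E n x = 0) : X →ₗ[k] Y where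
  toFun x := ∑ᶠ n, E n x
  map_add' x y := by
    obtain ⟨N, hN⟩ := h x
    obtain ⟨N', hN'⟩ := h y
    have h1 : ∀ n, max N N' ≤ n → E n x = 0 := fun n hn => hN n (le_of_max_le_left hn)
    have h2 : ∀ n, max N N' ≤ n → E n y = 0 := fun n hn => hN' n (le_of_max_le_right hn)
    rw [finsum_eq_sum_range h1, finsum_eq_sum_range h2, ← Finset.sum_add_distrib,
      finsum_eq_sum_range (N := max N N') fun n hn => by rw [map_add, h1 n hn, h2 n hn, add_zero]]
    simp
  map_smul' r x := by
    obtain ⟨N, hN⟩ := h x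
    rw [finsum_eq_sum_range hN, RingHom.id_apply, Finset.smul_sum,
      finsum_eq_sum_range (N := N) fun n hn => by rw [map_smul, hN n hn, smul_zero]]
    simp

theorem locSum_apply {E : ℕ → X →ₗ[k] Y} (h : ∀ x, ∃ N, ∀ n, N ≤ n → E n x = 0) {x : X} {N : ℕ}
    (hN : ∀ n, N ≤ n → E n x = 0) : locSum E h x = ∑ n ∈ Finset.range N, E n x :=
  finsum_eq_sum_range hN

end LocSum

theorem smul_sum_antidiagonal {X : Type*} [AddCommGroup X] [Module k X] (m : ℕ) (f : ℕ × ℕ → X) :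
    (m : k) • ∑ p ∈ Finset.HasAntidiagonal.antidiagonal m, f p =
      ∑ p ∈ Finset.HasAntidiagonal.antidiagonal m, ((p.1 : k) • f p + (p.2 : k) • f p) := by
  rw [Finset.smul_sum]
  refine Finset.sum_congr rfl fun p hp => ?_
  have e : p.1 + p.2 = m := Finset.HasAntidiagonal.mem_antidiagonal.mp hp
  rw [← add_smul, ← Nat.cast_add, e]

/-! ### Comultiplication of convolution products -/

section ComulConv

/-- The map `x ⊗ (y ⊗ z) ↦ (p x ⊙ P y) ⊗ R z`. -/
def actLeft (p P R : Sym k V →ₗ[k] Sym k W) :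
    Sym k V ⊗[k] (Sym k V ⊗[k] Sym k V) →ₗ[k] Sym k W ⊗[k] Sym k W :=
  TensorProduct.map (LinearMap.mul' k _ ∘ₗ TensorProduct.map p P) R ∘ₗ
    (TensorProduct.assoc k _ _ _).symm.toLinearMap

/-- The map `y ⊗ (x ⊗ z) ↦ P y ⊗ (p x ⊙ R z)`. -/
def actRight (p P R : Sym k V →ₗ[k] Sym k W) :
    Sym k V ⊗[k] (Sym k V ⊗[k] Sym k V) →ₗ[k] Sym k W ⊗[k] Sym k W :=
  TensorProduct.map P (LinearMap.mul' k _ ∘ₗ TensorProduct.map p R)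

theorem actLeft_comul (p P R : Sym k V →ₗ[k] Sym k W) (x : Sym k V) :
    actLeft p P R (TensorProduct.map LinearMap.id (comul k V) (comul k V x)) =
      TensorProduct.map (conv p P) R (comul k V x) := by
  rw [← coassoc, actLeft]
  simp only [LinearMap.comp_apply, LinearEquiv.coe_coe, LinearEquiv.symm_apply_apply]
  rw [map_apply_of_comp_eq]
  rfl

theorem actRight_comul (p P R : Sym k V →ₗ[k] Sym k W) (x : Sym k V) :
    actRight p P R (TensorProduct.map LinearMap.id (comul k V) (comul k V x)) =
      TensorProduct.map P (conv p R) (comul k V x) := by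
  rw [actRight, map_apply_of_comp_eq]
  rfl

variable [Algebra ℚ k]

variable (k V) in
/-- The graded exchange of the first two factors of a triple tensor product. -/
def swapFirst : Sym k V ⊗[k] (Sym k V ⊗[k] Sym k V) →ₗ[k] Sym k V ⊗[k] (Sym k V ⊗[k] Sym k V) :=
  (TensorProduct.assoc k _ _ _).toLinearMap ∘ₗ TensorProduct.map (swap k V) LinearMap.id ∘ₗ
    (TensorProduct.assoc k _ _ _).symm.toLinearMap

theorem swapFirst_comul (x : Sym k V) :
    swapFirst k V (TensorProduct.map LinearMap.id (comul k V) (comul k V x)) =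
      TensorProduct.map LinearMap.id (comul k V) (comul k V x) := by
  have h : swap k V ∘ₗ comul k V = comul k V := LinearMap.ext swap_comul
  rw [swapFirst, ← coassoc]
  simp only [LinearMap.comp_apply, LinearEquiv.coe_coe, LinearEquiv.symm_apply_apply]
  rw [map_apply_of_comp_eq, h]
  rfl

/-- The primitive element p x acts on the left factor or on the right one. In the second case it
crosses P y, and the resulting sign is that of exchanging x and y in the source. -/
theorem comulGen_map {n : ℤ} {x : Sym k V} (hx : x ∈ deg k V n) (a : W n)
    {p P R : Sym k V →ₗ[k] Sym k W} (hp : p x = gen k W n a)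
    (hP : ∀ n, ∀ x ∈ deg k V n, P x ∈ deg k W n)
    (s : Sym k V ⊗[k] Sym k V) :
    comulGen k W n a (TensorProduct.map P R s) =
      actLeft p P R (x ⊗ₜ s) + actRight p P R (swapFirst k V (x ⊗ₜ s)) := by
  have : comulGen k W n a ∘ₗ TensorProduct.map P R =
      (actLeft p P R + actRight p P R ∘ₗ swapFirst k V) ∘ₗ TensorProduct.mk k _ _ x := by
    apply tensor_ext_deg
    intro m l y hy z hz
    simp only [LinearMap.comp_apply, TensorProduct.map_tmul, comulGen_tmul, LinearMap.add_apply,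
      TensorProduct.mk_apply, actLeft, actRight, swapFirst, LinearEquiv.coe_coe,
      TensorProduct.assoc_symm_tmul, LinearMap.mul'_apply, hp, LinearMap.id_apply,
      swap_tmul hx hy, koszul_of_mem_deg n m _ (hP m y hy), ← TensorProduct.smul_tmul',
      map_smul, TensorProduct.assoc_tmul]
  exact LinearMap.congr_fun this s

/-- Since φ has primitive values, convolution with it acts as a derivation on the two tensor
factors. Coassociativity groups the argument of φ with the left factor; cocommutativity brings it to
the right factor. -/
theorem comul_conv {ι : Type*} (s : Finset ι) {φ : Sym k V →ₗ[k] ⨁ i, W i} (hφ : IsHom 0 φ)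
    {G : Sym k V →ₗ[k] Sym k W} {P R : ι → (Sym k V →ₗ[k] Sym k W)}
    (hP : ∀ i n, ∀ x ∈ deg k V n, P i x ∈ deg k W n)
    (hG : ∀ x, comul k W (G x) = ∑ i ∈ s, TensorProduct.map (P i) (R i) (comul k V x))
    (x : Sym k V) :
    comul k W (conv (incl k W ∘ₗ φ) G x) =
      ∑ i ∈ s, (TensorProduct.map (conv (incl k W ∘ₗ φ) (P i)) (R i) (comul k V x) +
        TensorProduct.map (P i) (conv (incl k W ∘ₗ φ) (R i)) (comul k V x)) := by
  set p := incl k W ∘ₗ φ with hp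
  have key : comul k W ∘ₗ LinearMap.mul' k _ ∘ₗ TensorProduct.map p G =
      (∑ i ∈ s, (actLeft p (P i) (R i) + actRight p (P i) (R i) ∘ₗ swapFirst k V)) ∘ₗ
        TensorProduct.map LinearMap.id (comul k V) := by
    apply tensor_ext_deg
    intro n m y hy z _
    have hy' := hφ n y hy
    rw [add_zero] at hy'
    obtain ⟨a, ha⟩ := hy'
    have hpy : p y = gen k W n a := by rw [hp, LinearMap.comp_apply, ha, incl_lof]
    have hmul : ∀ w, comul k W (p y * w) = comulGen k W n a (comul k W w) := by
      intro w
      rw [hpy, comul_gen_mul]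
    simp only [LinearMap.comp_apply, TensorProduct.map_tmul, LinearMap.mul'_apply, hmul, hG,
      map_sum, LinearMap.sum_apply, LinearMap.add_apply, LinearMap.id_apply]
    exact Finset.sum_congr rfl fun i _ => comulGen_map hy a hpy (hP i) _
  have h := LinearMap.congr_fun key (comul k V x)
  simp only [LinearMap.comp_apply, LinearMap.sum_apply, LinearMap.add_apply, swapFirst_comul,
    actLeft_comul, actRight_comul] at h
  exact h

end ComulConv

/-! ### Formal maps with given Taylor coefficients -/

section Exp

variable [Algebra ℚ k] (φ : Sym k V →ₗ[k] ⨁ i, W i)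

/-- The terms of the convolution exponential of `φ`. -/
def expTerm : ℕ → (Sym k V →ₗ[k] Sym k W)
  | 0 => convUnit k V (Sym k W)
  | n + 1 => algebraMap ℚ k (1 / (n + 1 : ℕ)) • conv (incl k W ∘ₗ φ) (expTerm n)

variable {φ}

theorem smul_expTerm_succ (n : ℕ) :
    ((n + 1 : ℕ) : k) • expTerm φ (n + 1) = conv (incl k W ∘ₗ φ) (expTerm φ n) := by
  have : ((n + 1 : ℕ) : k) * algebraMap ℚ k (1 / (n + 1 : ℕ)) = 1 := by
    rw [← map_natCast (algebraMap ℚ k), ← map_mul, mul_one_div_cancel (by positivity), map_one]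
  rw [expTerm, smul_smul, this, one_smul]

theorem expTerm_mem_deg (hφ : IsHom 0 φ) (n : ℕ) :
    ∀ m, ∀ x ∈ deg k V m, expTerm φ n x ∈ deg k W m := by
  induction n with
  | zero =>
    intro m x hx
    refine map_mem_of_monomial (expTerm φ 0) (deg k W) (fun l => ?_) hx
    rcases l with _ | ⟨p, l⟩
    · simpa [monomial_nil, expTerm, convUnit_apply] using one_mem_deg
    · simp [monomial_cons, expTerm, convUnit_apply, counit_gen]
  | succ n ih =>
    intro m x hx
    have := conv_mem_deg (i := 0) (j := 0) hφ.incl_mem (fun m x hx => by simpa using ih m x hx) m x hx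
    rw [add_zero, add_zero] at this
    exact Submodule.smul_mem _ _ this

theorem comul_expTerm (hφ : IsHom 0 φ) (n : ℕ) (x : Sym k V) :
    comul k W (expTerm φ n x) = ∑ p ∈ Finset.HasAntidiagonal.antidiagonal n,
      TensorProduct.map (expTerm φ p.1) (expTerm φ p.2) (comul k V x) := by
  induction n generalizing x with
  | zero =>
    have : comul k W ∘ₗ expTerm φ 0 =
        TensorProduct.map (expTerm φ 0) (expTerm φ 0) ∘ₗ comul k V := by
      apply hom_ext_gen_mul
      · simp [expTerm, convUnit_apply, comul_one]
      · intro i a l _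
        simp only [LinearMap.comp_apply, comul_gen_mul, expTerm, convUnit_apply, map_mul,
          counit_gen, zero_mul, map_zero]
        induction comul k V (monomial k V l) using TensorProduct.induction_on with
        | zero => simp
        | tmul x y => simp [comulGen_tmul, convUnit_apply, counit_gen]
        | add x y hx hy => rw [map_add, map_add, ← hx, ← hy, add_zero]
    simpa using LinearMap.congr_fun this x
  | succ n ih =>
    rw [← sub_eq_zero]
    -- The claim is the divided power rule for e_n = φ^{*n}/n!. After multiplication by n + 1, the
    -- weight p + q = n + 1 is shared between the two factors, p e_p and q e_q being convolutions of
    -- φ with the preceding terms.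
    apply smul_eq_zero_of_rat (k := k) n
    rw [smul_sub, sub_eq_zero, ← map_smul, ← LinearMap.smul_apply, smul_expTerm_succ,
      comul_conv (Finset.HasAntidiagonal.antidiagonal n) hφ
        (P := fun p : ℕ × ℕ => expTerm φ p.1) (R := fun p : ℕ × ℕ => expTerm φ p.2)
        (fun p => expTerm_mem_deg hφ p.1) ih]
    set f : ℕ × ℕ → Sym k W ⊗[k] Sym k W := fun p =>
      TensorProduct.map (expTerm φ p.1) (expTerm φ p.2) (comul k V x) with hf
    have h1 := Finset.Nat.sum_antidiagonal_succ (n := n)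
      (f := fun p : ℕ × ℕ => (p.1 : k) • f p)
    have h2 := Finset.Nat.sum_antidiagonal_succ' (n := n)
      (f := fun p : ℕ × ℕ => (p.2 : k) • f p)
    rw [Nat.cast_zero, zero_smul, zero_add] at h1
    rw [Nat.cast_zero, zero_smul, zero_add] at h2
    have h3 := smul_sum_antidiagonal (k := k) (n + 1) f
    rw [h3, Finset.sum_add_distrib, Finset.sum_add_distrib, h1, h2]
    congr 1 <;> refine Finset.sum_congr rfl fun p _ => ?_
    · rw [← smul_expTerm_succ, TensorProduct.map_smul_left]
      rfl
    · rw [← smul_expTerm_succ, TensorProduct.map_smul_right]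
      rfl

/-- As φ(1) = 0, every convolution factor φ consumes at least one letter. This makes the exponential
series locally finite. -/
theorem expTerm_monomial (h1 : φ 1 = 0) (n : ℕ) (l : List (Σ i, V i)) (hl : l.length < n) :
    expTerm φ n (monomial k V l) = 0 := by
  induction n generalizing l with
  | zero => simp at hl
  | succ n ih =>
    have h : splitSpan k l ≤ LinearMap.ker
        (LinearMap.mul' k _ ∘ₗ TensorProduct.map (incl k W ∘ₗ φ) (expTerm φ n)) := by
      rw [splitSpan, Submodule.span_le]
      rintro _ ⟨l₁, l₂, h, -, rfl⟩
      rw [SetLike.mem_coe, LinearMap.mem_ker, LinearMap.comp_apply, TensorProduct.map_tmul,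
        LinearMap.mul'_apply]
      rcases l₁ with _ | ⟨p, l₁⟩
      · rw [monomial_nil, LinearMap.comp_apply, h1, map_zero, zero_mul]
      · rw [ih l₂, mul_zero]
        simp at h
        omega
    have := h (comul_monomial_mem l)
    rw [expTerm, LinearMap.smul_apply, conv_apply]
    rw [LinearMap.mem_ker, LinearMap.comp_apply] at this
    rw [this, smul_zero]

theorem expTerm_locallyFinite (h1 : φ 1 = 0) (x : Sym k V) :
    ∃ N, ∀ n, N ≤ n → expTerm φ n x = 0 := by
  induction x using induction_monomial with
  | mono l => exact ⟨l.length + 1, fun n hn => expTerm_monomial h1 n l hn⟩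
  | add x y hx hy =>
    obtain ⟨N, hN⟩ := hx
    obtain ⟨N', hN'⟩ := hy
    exact ⟨max N N', fun n hn => by
      rw [map_add, hN n (le_of_max_le_left hn), hN' n (le_of_max_le_right hn), add_zero]⟩
  | smul r x hx =>
    obtain ⟨N, hN⟩ := hx
    exact ⟨N, fun n hn => by rw [map_smul, hN n hn, smul_zero]⟩

/-- The convolution exponential of `φ`. -/
def expMap (h1 : φ 1 = 0) : Sym k V →ₗ[k] Sym k W :=
  locSum (expTerm φ) (expTerm_locallyFinite h1)

theorem expMap_monomial (h1 : φ 1 = 0) {m : ℕ} {l : List (Σ i, V i)} (hl : l.length < m) :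
    expMap h1 (monomial k V l) = ∑ n ∈ Finset.range m, expTerm φ n (monomial k V l) :=
  locSum_apply _ fun n hn => expTerm_monomial h1 n l (hl.trans_le hn)

theorem comul_expMap (h1 : φ 1 = 0) (hφ : IsHom 0 φ) :
    comul k W ∘ₗ expMap h1 = TensorProduct.map (expMap h1) (expMap h1) ∘ₗ comul k V := by
  apply hom_ext_monomial
  intro l
  rw [LinearMap.comp_apply, expMap_monomial h1 (Nat.lt_succ_self _), map_sum,
    Finset.sum_congr rfl fun n _ => comul_expTerm hφ n _]
  have h : splitSpan k l ≤ LinearMap.eqLocus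
      (∑ n ∈ Finset.range (l.length + 1), ∑ p ∈ Finset.HasAntidiagonal.antidiagonal n,
        TensorProduct.map (expTerm φ p.1) (expTerm φ p.2))
      (TensorProduct.map (expMap h1) (expMap h1)) := by
    rw [splitSpan, Submodule.span_le]
    rintro _ ⟨l₁, l₂, h, -, rfl⟩
    rw [SetLike.mem_coe, LinearMap.mem_eqLocus, TensorProduct.map_tmul,
      expMap_monomial h1 (m := l.length + 1) (by omega),
      expMap_monomial h1 (m := l.length + 1) (l := l₂) (by omega), TensorProduct.sum_tmul]
    simp only [LinearMap.sum_apply, TensorProduct.map_tmul, TensorProduct.tmul_sum]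
    rw [← Finset.sum_product']
    -- The product of the two truncated sums runs over a square. Outside the triangle p + q ≤
    -- length, one index exceeds the length of its monomial and the term is zero; the triangle is
    -- then summed along its antidiagonals.
    rw [← Finset.sum_filter_of_ne (p := fun p : ℕ × ℕ => p.1 + p.2 < l.length + 1)]
    · rw [← Finset.sum_fiberwise_of_maps_to (t := Finset.range (l.length + 1))
        (g := fun p : ℕ × ℕ => p.1 + p.2)]
      · refine Finset.sum_congr rfl fun n hn => Finset.sum_congr ?_ fun _ _ => rfl
        ext p
        simp at hn ⊢
        omega
      · simp
    · intro p _ hp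
      by_contra hc
      rcases (by omega : l₁.length < p.1 ∨ l₂.length < p.2) with h | h
      · exact hp (by rw [expTerm_monomial h1 _ _ h, TensorProduct.zero_tmul])
      · exact hp (by rw [expTerm_monomial h1 _ _ h, TensorProduct.tmul_zero])
  have := h (comul_monomial_mem l)
  rw [LinearMap.mem_eqLocus] at this
  rw [LinearMap.comp_apply, ← this]
  simp only [LinearMap.sum_apply]

theorem counit_expTerm_succ (n : ℕ) (x : Sym k V) : counit k W (expTerm φ (n + 1) x) = 0 := by
  rw [expTerm, LinearMap.smul_apply, map_smul, conv_apply]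
  convert smul_zero _
  induction comul k V x using TensorProduct.induction_on with
  | zero => simp
  | tmul x y => simp [counit_incl]
  | add x y hx hy => rw [map_add, map_add, map_add, hx, hy, add_zero]

/-- The projection sees the factor `expTerm φ n` only through its counit, which vanishes for
positive n and is the counit of S(V) for n = 0. -/
theorem pr_expTerm_succ (n : ℕ) (x : Sym k V) :
    pr k W (expTerm φ (n + 1) x) = if n = 0 then φ x else 0 := by
  have h : ∀ t : Sym k V ⊗[k] Sym k V, pr k W (LinearMap.mul' k _ (TensorProduct.map
      (incl k W ∘ₗ φ) (expTerm φ n) t)) = if n = 0 then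
        φ (TensorProduct.rid k _ (TensorProduct.map LinearMap.id (counit k V).toLinearMap t))
        else 0 := by
    intro t
    induction t using TensorProduct.induction_on with
    | zero => simp
    | tmul x y =>
      rcases n with _ | n
      · simp [pr_incl_mul, expTerm, convUnit_apply]
      · simp [pr_incl_mul, counit_expTerm_succ]
    | add x y hx hy =>
      simp only [map_add, hx, hy]
      split_ifs <;> simp
  rw [expTerm, LinearMap.smul_apply, map_smul, conv_apply, h, comul_counit]
  split_ifs with hn
  · subst hn; simp
  · simp

theorem pr_expMap (h1 : φ 1 = 0) : pr k W ∘ₗ expMap h1 = φ := by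
  apply hom_ext_monomial
  intro l
  rw [LinearMap.comp_apply, expMap_monomial h1 (m := l.length + 2) (by omega), map_sum,
    Finset.sum_range_succ', Finset.sum_range_succ']
  simp [pr_expTerm_succ]
  simp [expTerm, convUnit_apply, Algebra.algebraMap_eq_smul_one, pr_one]

theorem exists_isFormalMap (h1 : φ 1 = 0) (hφ : IsHom 0 φ) :
    ∃ F : Sym k V →ₗ[k] Sym k W, IsFormalMap F ∧ pr k W ∘ₗ F = φ := by
  refine ⟨expMap h1, ⟨fun n x hx => ?_, comul_expMap h1 hφ, ?_⟩, pr_expMap h1⟩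
  · obtain ⟨N, hN⟩ := expTerm_locallyFinite h1 x
    rw [expMap, locSum_apply _ hN]
    exact Submodule.sum_mem _ fun m _ => expTerm_mem_deg hφ m n x hx
  · have := expMap_monomial h1 (l := []) (m := 1) (by simp)
    rw [monomial_nil] at this
    rw [this]
    simp [expTerm, convUnit_apply]

end Exp

end

/-! ### Products: S(V × W) as S(V) ⊗ S(W) -/

section

open FormalDG.Sym

variable {k : Type u} [CommRing k]
variable {V : ℤ → Type v} [∀ i, AddCommGroup (V i)] [∀ i, Module k (V i)]
variable {W : ℤ → Type w} [∀ i, AddCommGroup (W i)] [∀ i, Module k (W i)]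

/-! ### Linear formal maps -/

theorem Sym.map_gen (φ : ∀ i, W i →ₗ[k] V i) (i : ℤ) (a : W i) :
    Sym.map φ (gen k W i a) = gen k V i (φ i a) := lift_gen _ _ i a

theorem Sym.map_monomial (φ : ∀ i, W i →ₗ[k] V i) (l : List (Σ i, W i)) :
    Sym.map φ (monomial k W l) = monomial k V (l.map fun p => ⟨p.1, φ p.1 p.2⟩) := by
  induction l with
  | nil => simp [monomial_nil]
  | cons p l ih => rw [monomial_cons, map_mul, ih, map_gen, List.map_cons, monomial_cons]

theorem isFormalMap_map (φ : ∀ i, W i →ₗ[k] V i) : IsFormalMap (Sym.map φ).toLinearMap where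
  mem_deg n x hx := by
    refine map_mem_of_monomial _ (deg k V) (fun l => ?_) hx
    rw [AlgHom.toLinearMap_apply, map_monomial]
    have := monomial_mem_deg (k := k) (l.map fun p => (⟨p.1, φ p.1 p.2⟩ : Σ i, V i))
    rwa [List.map_map] at this
  comul_comp := by
    have hk : ∀ i, (Sym.map φ).toLinearMap ∘ₗ (koszul k W i).toLinearMap =
        (koszul k V i).toLinearMap ∘ₗ (Sym.map φ).toLinearMap := by
      intro i
      apply hom_ext_gen_mul
      · simp
      · intro j b l h
        simp only [LinearMap.comp_apply, AlgHom.toLinearMap_apply] at h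
        simp [koszul_gen, map_gen, h]
    apply hom_ext_gen_mul
    · simp [comul_one]
    · intro i a l h
      simp only [LinearMap.comp_apply, AlgHom.toLinearMap_apply, map_mul, map_gen,
        comul_gen_mul] at h ⊢
      rw [h]
      induction comul k W (monomial k W l) using TensorProduct.induction_on with
      | zero => simp
      | tmul x y =>
        have := LinearMap.congr_fun (hk i) x
        simp only [LinearMap.comp_apply, AlgHom.toLinearMap_apply] at this
        simp [comulGen_tmul, map_gen, this]
      | add x y hx hy => simp only [map_add, hx, hy]
  map_one := by simp

theorem pr_map (φ : ∀ i, W i →ₗ[k] V i) :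
    pr k V ∘ₗ (Sym.map φ).toLinearMap = DirectSum.lmap φ ∘ₗ pr k W := by
  apply hom_ext_monomial
  rintro (_ | ⟨p, _ | ⟨q, l⟩⟩)
  · simp [monomial_nil, pr_one]
  · simp [monomial_cons, monomial_nil, map_gen, pr_gen]
  · simp [monomial_cons, map_gen, pr_gen_mul_gen_mul]

/-! ### Products -/

theorem isFormalMap_pFst : IsFormalMap (pFst k V W) := isFormalMap_map _
theorem isFormalMap_pSnd : IsFormalMap (pSnd k V W) := isFormalMap_map _
theorem isFormalMap_iFst : IsFormalMap (iFst k V W) := isFormalMap_map _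
theorem isFormalMap_iSnd : IsFormalMap (iSnd k V W) := isFormalMap_map _

theorem pFst_gen (i : ℤ) (a : Prd V W i) :
    pFst k V W (gen k (Prd V W) i a) = gen k V i a.1 := map_gen _ i a
theorem pSnd_gen (i : ℤ) (a : Prd V W i) :
    pSnd k V W (gen k (Prd V W) i a) = gen k W i a.2 := map_gen _ i a
theorem iFst_gen (i : ℤ) (a : V i) :
    iFst k V W (gen k V i a) = gen k (Prd V W) i (a, 0) := map_gen _ i a
theorem iSnd_gen (i : ℤ) (a : W i) :
    iSnd k V W (gen k W i a) = gen k (Prd V W) i (0, a) := map_gen _ i a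

theorem pFst_mul (x y : Sym k (Prd V W)) : pFst k V W (x * y) = pFst k V W x * pFst k V W y :=
  map_mul (Sym.map _) x y
theorem pSnd_mul (x y : Sym k (Prd V W)) : pSnd k V W (x * y) = pSnd k V W x * pSnd k V W y :=
  map_mul (Sym.map _) x y
theorem iFst_mul (x y : Sym k V) : iFst k V W (x * y) = iFst k V W x * iFst k V W y :=
  map_mul (Sym.map _) x y
theorem iSnd_mul (x y : Sym k W) : iSnd k V W (x * y) = iSnd k V W x * iSnd k V W y :=
  map_mul (Sym.map _) x y

variable (k V W) in
/-- The projection `V × W → W` of total modules. -/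
def sndTot : (⨁ i, Prd V W i) →ₗ[k] ⨁ i, W i :=
  DirectSum.lmap fun i => LinearMap.snd k (V i) (W i)

theorem pr_pFst : pr k V ∘ₗ pFst k V W = fstTot k V W ∘ₗ pr k (Prd V W) := pr_map _
theorem pr_pSnd : pr k W ∘ₗ pSnd k V W = sndTot k V W ∘ₗ pr k (Prd V W) := pr_map _

theorem fstTot_inlTot (a : ⨁ i, V i) : fstTot k V W (inlTot k V W a) = a := by
  induction a using DirectSum.induction_on with
  | zero => simp
  | of i a =>
    change fstTot k V W (inlTot k V W (DirectSum.lof k ℤ V i a)) = DirectSum.lof k ℤ V i a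
    simp [fstTot, inlTot]
  | add a b ha hb => rw [map_add, map_add, ha, hb]

theorem sndTot_inlTot (a : ⨁ i, V i) : sndTot k V W (inlTot k V W a) = 0 := by
  induction a using DirectSum.induction_on with
  | zero => simp
  | of i a =>
    change sndTot k V W (inlTot k V W (DirectSum.lof k ℤ V i a)) = 0
    simp [sndTot, inlTot]
  | add a b ha hb => rw [map_add, map_add, ha, hb, add_zero]

theorem fstTot_inrTot (a : ⨁ i, W i) : fstTot k V W (inrTot k V W a) = 0 := by
  induction a using DirectSum.induction_on with
  | zero => simp
  | of i a =>
    change fstTot k V W (inrTot k V W (DirectSum.lof k ℤ W i a)) = 0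
    simp [fstTot, inrTot]
  | add a b ha hb => rw [map_add, map_add, ha, hb, add_zero]

theorem sndTot_inrTot (a : ⨁ i, W i) : sndTot k V W (inrTot k V W a) = a := by
  induction a using DirectSum.induction_on with
  | zero => simp
  | of i a =>
    change sndTot k V W (inrTot k V W (DirectSum.lof k ℤ W i a)) = DirectSum.lof k ℤ W i a
    simp [sndTot, inrTot]
  | add a b ha hb => rw [map_add, map_add, ha, hb]

theorem inlTot_fstTot_add (a : ⨁ i, Prd V W i) :
    inlTot k V W (fstTot k V W a) + inrTot k V W (sndTot k V W a) = a := by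
  induction a using DirectSum.induction_on with
  | zero => simp
  | of i a =>
    change inlTot k V W (fstTot k V W (DirectSum.lof k ℤ (Prd V W) i a)) +
      inrTot k V W (sndTot k V W (DirectSum.lof k ℤ (Prd V W) i a)) =
        DirectSum.lof k ℤ (Prd V W) i a
    simp only [inlTot, fstTot, inrTot, sndTot, DirectSum.lmap_lof, ← map_add]
    simp
  | add a b ha hb =>
    conv_rhs => rw [← ha, ← hb]
    simp only [map_add]
    abel

theorem pSnd_iSnd (x : Sym k W) : pSnd k V W (iSnd k V W x) = x := by
  have : pSnd k V W ∘ₗ iSnd k V W = LinearMap.id := by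
    apply hom_ext_gen_mul
    · simp [isFormalMap_iSnd.map_one, isFormalMap_pSnd.map_one]
    · intro i a l h
      simp only [LinearMap.comp_apply] at h ⊢
      rw [iSnd_mul, pSnd_mul, h, iSnd_gen, pSnd_gen]
      rfl
  exact LinearMap.congr_fun this x

theorem pFst_comp_iSnd : pFst k V W ∘ₗ iSnd k V W = convUnit k W (Sym k V) := by
  apply hom_ext_gen_mul
  · simp [isFormalMap_iSnd.map_one, isFormalMap_pFst.map_one, convUnit_apply]
  · intro i a l h
    simp [iSnd_mul, pFst_mul, iSnd_gen, pFst_gen, convUnit_apply, counit_gen]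

theorem pSnd_comp_iFst : pSnd k V W ∘ₗ iFst k V W = convUnit k V (Sym k W) := by
  apply hom_ext_gen_mul
  · simp [isFormalMap_iFst.map_one, isFormalMap_pSnd.map_one, convUnit_apply]
  · intro i a l h
    simp [iFst_mul, pSnd_mul, iFst_gen, pSnd_gen, convUnit_apply, counit_gen]

theorem map_convUnit_left {A X : Type*} [Ring A] [Algebra k A] [AddCommGroup X] [Module k X]
    (f : Sym k W →ₗ[k] X) (x : Sym k W) :
    TensorProduct.map (convUnit k W A) f (comul k W x) = 1 ⊗ₜ f x := by
  conv_rhs => rw [← counit_comul x]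
  induction comul k W x using TensorProduct.induction_on with
  | zero => simp
  | tmul x y => simp [convUnit_apply, Algebra.algebraMap_eq_smul_one, TensorProduct.smul_tmul]
  | add x y hx hy => simp only [map_add, TensorProduct.tmul_add, hx, hy]

theorem map_convUnit_right {A X : Type*} [Ring A] [Algebra k A] [AddCommGroup X] [Module k X]
    (f : Sym k W →ₗ[k] X) (x : Sym k W) :
    TensorProduct.map f (convUnit k W A) (comul k W x) = f x ⊗ₜ 1 := by
  conv_rhs => rw [← comul_counit x]
  induction comul k W x using TensorProduct.induction_on with
  | zero => simp
  | tmul x y => simp [convUnit_apply, Algebra.algebraMap_eq_smul_one, TensorProduct.smul_tmul]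
  | add x y hx hy => simp only [map_add, TensorProduct.add_tmul, hx, hy]

variable (k V W) in
/-- The external product `x ⊗ y ↦ x ⊙ y`, from `S(V) ⊗ S(W)` to `S(V × W)`. -/
def mu : Sym k V ⊗[k] Sym k W →ₗ[k] Sym k (Prd V W) :=
  LinearMap.mul' k _ ∘ₗ TensorProduct.map (iFst k V W) (iSnd k V W)

variable (k V W) in
/-- The inverse of the external product. -/
def nu : Sym k (Prd V W) →ₗ[k] Sym k V ⊗[k] Sym k W :=
  TensorProduct.map (pFst k V W) (pSnd k V W) ∘ₗ comul k (Prd V W)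

theorem mu_tmul (x : Sym k V) (y : Sym k W) :
    mu k V W (x ⊗ₜ y) = iFst k V W x * iSnd k V W y := rfl

/-- The map `y ↦ x ⊙ y` from `S(W)` to `S(V × W)`. -/
def muRight (x : Sym k V) : Sym k W →ₗ[k] Sym k (Prd V W) :=
  LinearMap.mulLeft k (iFst k V W x) ∘ₗ iSnd k V W

/-- The map `x ↦ x ⊙ y` from `S(V)` to `S(V × W)`. -/
def muLeft (y : Sym k W) : Sym k V →ₗ[k] Sym k (Prd V W) :=
  LinearMap.mulRight k (iSnd k V W y) ∘ₗ iFst k V W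

theorem muRight_apply (x : Sym k V) (y : Sym k W) :
    muRight x y = iFst k V W x * iSnd k V W y := rfl

theorem muLeft_apply (x : Sym k V) (y : Sym k W) :
    muLeft y x = iFst k V W x * iSnd k V W y := rfl

theorem muRight_one : muRight (1 : Sym k V) = iSnd k V W := by
  ext y
  rw [muRight_apply, isFormalMap_iFst.map_one, one_mul]

theorem muRight_gen_mul (i : ℤ) (a : V i) (x : Sym k V) (y : Sym k W) :
    muRight (gen k V i a * x) y = gen k (Prd V W) i (a, 0) * muRight x y := by
  rw [muRight_apply, muRight_apply, iFst_mul, iFst_gen, mul_assoc]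

/-- Letters of W die under the projection to V, so y stays entirely in the second factor, to the
right of the part of x found there, and no sign arises. -/
theorem map_pFst_comul (x : Sym k V) (y : Sym k W) :
    TensorProduct.map (pFst k V W) LinearMap.id (comul k _ (muRight x y)) =
      TensorProduct.map LinearMap.id (muLeft y) (comul k V x) := by
  induction x using induction_monomial with
  | mono l =>
    induction l with
    | nil =>
      rw [monomial_nil, muRight_one, ← LinearMap.comp_apply (comul k _), isFormalMap_iSnd.comul_comp,
        LinearMap.comp_apply, map_apply_of_comp_eq, pFst_comp_iSnd, LinearMap.id_comp,
        map_convUnit_left, comul_one, TensorProduct.map_tmul, muLeft_apply,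
        isFormalMap_iFst.map_one, one_mul]
      rfl
    | cons p l ih =>
      obtain ⟨i, a⟩ := p
      rw [monomial_cons, muRight_gen_mul, comul_gen_mul, comul_gen_mul]
      have h1 : ∀ t, TensorProduct.map (pFst k V W) LinearMap.id
          (comulGen k (Prd V W) i (a, 0) t) =
          (TensorProduct.map (LinearMap.mulLeft k (gen k V i a)) LinearMap.id +
            TensorProduct.map (koszul k V i).toLinearMap
              (LinearMap.mulLeft k (gen k (Prd V W) i (a, 0))) :
            Module.End k (Sym k V ⊗[k] Sym k (Prd V W)))
            (TensorProduct.map (pFst k V W) LinearMap.id t) := by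
        intro t
        induction t using TensorProduct.induction_on with
        | zero => simp
        | tmul x z =>
          have := LinearMap.congr_fun (isFormalMap_pFst (k := k) (V := V) (W := W).koszul_comp i) x
          simp only [LinearMap.comp_apply, AlgHom.toLinearMap_apply] at this
          simp [comulGen_tmul, pFst_mul, pFst_gen, this]
        | add s t hs ht => simp only [map_add, hs, ht]
      have h2 : ∀ t, TensorProduct.map LinearMap.id (muLeft y) (comulGen k V i a t) =
          (TensorProduct.map (LinearMap.mulLeft k (gen k V i a)) LinearMap.id +
            TensorProduct.map (koszul k V i).toLinearMap
              (LinearMap.mulLeft k (gen k (Prd V W) i (a, 0))) :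
            Module.End k (Sym k V ⊗[k] Sym k (Prd V W)))
            (TensorProduct.map LinearMap.id (muLeft y) t) := by
        intro t
        induction t using TensorProduct.induction_on with
        | zero => simp
        | tmul x z => simp [comulGen_tmul, muLeft_apply, iFst_mul, iFst_gen, mul_assoc]
        | add s t hs ht => simp only [map_add, hs, ht]
      rw [h1, h2, ih]
  | add x x' hx hx' =>
    simp only [muRight_apply, map_add, add_mul] at hx hx' ⊢
    rw [hx, hx']
  | smul r x hx =>
    simp only [muRight_apply, map_smul, smul_mul_assoc] at hx ⊢
    rw [hx]

theorem map_comul_pSnd (x : Sym k V) (y : Sym k W) :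
    TensorProduct.map LinearMap.id (pSnd k V W) (comul k _ (muRight x y)) =
      TensorProduct.map (muRight x) LinearMap.id (comul k W y) := by
  induction x using induction_monomial with
  | mono l =>
    induction l with
    | nil =>
      have : pSnd k V W ∘ₗ iSnd k V W = LinearMap.id := LinearMap.ext pSnd_iSnd
      rw [monomial_nil, muRight_one, ← LinearMap.comp_apply (comul k _),
        isFormalMap_iSnd.comul_comp, LinearMap.comp_apply, map_apply_of_comp_eq, this,
        LinearMap.id_comp]
    | cons p l ih =>
      obtain ⟨i, a⟩ := p
      rw [monomial_cons, muRight_gen_mul, comul_gen_mul]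
      have h1 : ∀ t, TensorProduct.map LinearMap.id (pSnd k V W)
          (comulGen k (Prd V W) i (a, 0) t) =
          TensorProduct.map (LinearMap.mulLeft k (gen k (Prd V W) i (a, 0))) LinearMap.id
            (TensorProduct.map LinearMap.id (pSnd k V W) t) := by
        intro t
        induction t using TensorProduct.induction_on with
        | zero => simp
        | tmul x z => simp [comulGen_tmul, pSnd_mul, pSnd_gen]
        | add s t hs ht => simp only [map_add, hs, ht]
      rw [h1, ih, map_apply_of_comp_eq]
      congr 2
      ext z
      exact (muRight_gen_mul i a _ z).symm
  | add x x' hx hx' =>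
    have e : muRight (W := W) (x + x') = muRight x + muRight x' := by
      ext z; simp [muRight_apply, add_mul]
    rw [e, LinearMap.add_apply, TensorProduct.map_add_left, map_add, map_add, hx, hx']
    rfl
  | smul r x hx =>
    have e : muRight (W := W) (r • x) = r • muRight x := by
      ext z; simp [muRight_apply]
    rw [e, LinearMap.smul_apply, TensorProduct.map_smul_left, map_smul, map_smul, hx]
    rfl

/-- Here x stays whole in the second factor while a part of y is moved to its left; crossing x costs
the Koszul sign of degree n. -/
theorem map_pSnd_comul {n : ℤ} {x : Sym k V} (hx : x ∈ deg k V n) (y : Sym k W) :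
    TensorProduct.map (pSnd k V W) LinearMap.id (comul k _ (muRight x y)) =
      TensorProduct.map (koszul k W n).toLinearMap (muRight x) (comul k W y) := by
  induction hx using Submodule.span_induction with
  | mem x h =>
    obtain ⟨l, rfl, rfl⟩ := h
    induction l with
    | nil =>
      have h1 : pSnd k V W ∘ₗ iSnd k V W = LinearMap.id := LinearMap.ext pSnd_iSnd
      have h2 : (koszul k W 0).toLinearMap = LinearMap.id := LinearMap.ext (koszul_even Even.zero)
      rw [monomial_nil, muRight_one, ← LinearMap.comp_apply (comul k _),
        isFormalMap_iSnd.comul_comp, LinearMap.comp_apply, map_apply_of_comp_eq, h1,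
        LinearMap.id_comp, List.map_nil, List.sum_nil, h2]
    | cons p l ih =>
      obtain ⟨i, a⟩ := p
      rw [monomial_cons, muRight_gen_mul, comul_gen_mul]
      have h1 : ∀ t, TensorProduct.map (pSnd k V W) LinearMap.id
          (comulGen k (Prd V W) i (a, 0) t) =
          TensorProduct.map (koszul k W i).toLinearMap
            (LinearMap.mulLeft k (gen k (Prd V W) i (a, 0)))
            (TensorProduct.map (pSnd k V W) LinearMap.id t) := by
        intro t
        induction t using TensorProduct.induction_on with
        | zero => simp
        | tmul x z =>
          have := LinearMap.congr_fun (isFormalMap_pSnd (k := k) (V := V) (W := W).koszul_comp i) x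
          simp only [LinearMap.comp_apply, AlgHom.toLinearMap_apply] at this
          simp [comulGen_tmul, pSnd_mul, pSnd_gen, this]
        | add s t hs ht => simp only [map_add, hs, ht]
      rw [h1, ih, map_apply_of_comp_eq, ← koszul_add, List.map_cons, List.sum_cons]
      congr 2
      ext z
      exact (muRight_gen_mul i a _ z).symm
  | zero =>
    have e : muRight (W := W) (0 : Sym k V) = 0 := by
      ext z; simp [muRight_apply]
    rw [e]
    simp
  | add x x' _ _ hx hx' =>
    have e : muRight (W := W) (x + x') = muRight x + muRight x' := by
      ext z; simp [muRight_apply, add_mul]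
    rw [e, LinearMap.add_apply, TensorProduct.map_add_right, map_add, map_add, hx, hx']
    rfl
  | smul r x _ hx =>
    have e : muRight (W := W) (r • x) = r • muRight x := by
      ext z; simp [muRight_apply]
    rw [e, LinearMap.smul_apply, TensorProduct.map_smul_right, map_smul, map_smul, hx]
    rfl

theorem nu_mu (t : Sym k V ⊗[k] Sym k W) : nu k V W (mu k V W t) = t := by
  induction t using TensorProduct.induction_on with
  | zero => simp
  | tmul x y =>
    have h := congrArg (TensorProduct.map LinearMap.id (pSnd k V W)) (map_pFst_comul x y)
    rw [map_apply_of_comp_eq, map_apply_of_comp_eq, LinearMap.id_comp, LinearMap.comp_id] at h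
    have e : pSnd k V W ∘ₗ muLeft y = LinearMap.mulRight k y ∘ₗ convUnit k V (Sym k W) := by
      ext z
      have := LinearMap.congr_fun (pSnd_comp_iFst (k := k) (V := V) (W := W)) z
      simp only [LinearMap.comp_apply] at this
      simp [muLeft_apply, pSnd_mul, pSnd_iSnd, this]
    rw [e] at h
    refine h.trans ?_
    rw [← LinearMap.comp_id (LinearMap.id ∘ₗ LinearMap.id), ← LinearMap.id_comp LinearMap.id,
      ← map_apply_of_comp_eq, LinearMap.id_comp, LinearMap.comp_id, map_convUnit_right]
    simp
  | add s t hs ht => rw [map_add, map_add, hs, ht]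

theorem mu_surjective : Function.Surjective (mu k V W) := by
  rw [← LinearMap.range_eq_top, eq_top_iff]
  intro x _
  induction x using induction_monomial with
  | mono l =>
    induction l with
    | nil =>
      exact ⟨1 ⊗ₜ 1, by
        rw [mu_tmul, isFormalMap_iFst.map_one, isFormalMap_iSnd.map_one, mul_one]; rfl⟩
    | cons p l ih =>
      obtain ⟨i, a, b⟩ := p
      obtain ⟨t, ht⟩ := ih trivial
      rw [monomial_cons, ← ht]
      have e : gen k (Prd V W) i (a, b) = gen k (Prd V W) i (a, 0) + gen k (Prd V W) i (0, b) := by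
        rw [← map_add]; simp
      rw [e, add_mul]
      clear ht
      induction t using TensorProduct.induction_on with
      | zero => simp
      | tmul x y =>
        -- A letter of V joins x directly. A letter of W has to cross x to reach y, hence the Koszul
        -- automorphism in the second witness.
        refine Submodule.add_mem _ ⟨(gen k V i a * x) ⊗ₜ y, ?_⟩
          ⟨koszul k V i x ⊗ₜ (gen k W i b * y), ?_⟩
        · rw [mu_tmul, mu_tmul, iFst_mul, iFst_gen, mul_assoc]
        · have := LinearMap.congr_fun
            (isFormalMap_iFst (k := k) (V := V) (W := W).koszul_comp i) x
          simp only [LinearMap.comp_apply, AlgHom.toLinearMap_apply] at this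
          rw [mu_tmul, mu_tmul, iSnd_mul, iSnd_gen, ← this, ← mul_assoc, koszul_mul_gen, mul_assoc]
      | add s t hs ht =>
        rw [map_add, mul_add, mul_add, add_add_add_comm]
        exact Submodule.add_mem _ hs ht
  | add x y hx hy => exact Submodule.add_mem _ (hx trivial) (hy trivial)
  | smul r x hx => exact Submodule.smul_mem _ r (hx trivial)

theorem mu_nu (x : Sym k (Prd V W)) : mu k V W (nu k V W x) = x := by
  obtain ⟨t, rfl⟩ := mu_surjective x
  rw [nu_mu]

theorem nu_injective : Function.Injective (nu k V W) :=
  Function.LeftInverse.injective mu_nu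

/-- Linear maps on `S(V × W)` are determined by their values on products. -/
theorem hom_ext_muRight {X : Type*} [AddCommGroup X] [Module k X]
    {f g : Sym k (Prd V W) →ₗ[k] X}
    (h : ∀ m, ∀ x ∈ deg k V m, ∀ n, ∀ y ∈ deg k W n, f (muRight x y) = g (muRight x y)) :
    f = g := by
  have : f ∘ₗ mu k V W = g ∘ₗ mu k V W := tensor_ext_deg fun m n x hx y hy => h m x hx n y hy
  ext x
  rw [← mu_nu x]
  exact LinearMap.congr_fun this _

end

/-! ### Vector fields on products and the Maurer-Cartan equation -/

section

open FormalDG.Sym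

variable {k : Type u} [CommRing k]
variable {V : ℤ → Type v} [∀ i, AddCommGroup (V i)] [∀ i, Module k (V i)]
variable {W : ℤ → Type w} [∀ i, AddCommGroup (W i)] [∀ i, Module k (W i)]

/-! ### Vector fields on products -/

theorem Sym.isHom_iff {j : ℤ} {q : Sym k W →ₗ[k] ⨁ i, V i} :
    IsHom j q ↔ ∀ n, ∀ x ∈ deg k W n, q x ∈ LinearMap.range (DirectSum.lof k ℤ V (n + j)) := by
  simp only [IsHom, LinearMap.mem_range, eq_comm]

theorem IsFormalMap.isHom_pr {f : Sym k W →ₗ[k] Sym k V} (hf : IsFormalMap f) :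
    IsHom 0 (pr k V ∘ₗ f) := by
  intro n x hx
  rw [add_zero]
  exact exists_pr_eq (hf.mem_deg n x hx)

theorem isHom_pr_comp {j : ℤ} {q : Sym k W →ₗ[k] Sym k V}
    (hq : ∀ n, ∀ x ∈ deg k W n, q x ∈ deg k V (n + j)) : IsHom j (pr k V ∘ₗ q) :=
  fun n x hx => exists_pr_eq (hq n x hx)

theorem Sym.IsHom.inlTot_comp {X : ℤ → Type z} [∀ i, AddCommGroup (X i)] [∀ i, Module k (X i)]
    {j : ℤ} {q : Sym k X →ₗ[k] ⨁ i, V i} (hq : IsHom j q) :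
    IsHom j (inlTot k V W ∘ₗ q) := by
  intro n x hx
  obtain ⟨a, ha⟩ := hq n x hx
  exact ⟨(a, 0), by rw [LinearMap.comp_apply, ha]; simp [inlTot]⟩

theorem Sym.IsHom.inrTot_comp {X : ℤ → Type z} [∀ i, AddCommGroup (X i)] [∀ i, Module k (X i)]
    {j : ℤ} {q : Sym k X →ₗ[k] ⨁ i, W i} (hq : IsHom j q) :
    IsHom j (inrTot k V W ∘ₗ q) := by
  intro n x hx
  obtain ⟨a, ha⟩ := hq n x hx
  exact ⟨(0, a), by rw [LinearMap.comp_apply, ha]; simp [inrTot]⟩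

theorem Sym.IsHom.add {X : ℤ → Type z} [∀ i, AddCommGroup (X i)] [∀ i, Module k (X i)]
    {j : ℤ} {p q : Sym k X →ₗ[k] ⨁ i, W i} (hp : IsHom j p) (hq : IsHom j q) :
    IsHom j (p + q) := by
  intro n x hx
  obtain ⟨a, ha⟩ := hp n x hx
  obtain ⟨b, hb⟩ := hq n x hx
  exact ⟨a + b, by rw [LinearMap.add_apply, ha, hb, map_add]⟩

theorem Sym.IsHom.smul {X : ℤ → Type z} [∀ i, AddCommGroup (X i)] [∀ i, Module k (X i)]
    {j : ℤ} {p : Sym k X →ₗ[k] ⨁ i, W i} (hp : IsHom j p) (c : k) : IsHom j (c • p) := by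
  intro n x hx
  obtain ⟨a, ha⟩ := hp n x hx
  exact ⟨c • a, by rw [LinearMap.smul_apply, ha, map_smul]⟩

section Rat

variable [Algebra ℚ k]

/-- Both sides are coderivations along the projection, so it suffices to compare linear parts. -/
theorem pFst_ofTaylor {j : ℤ} {q : Sym k (Prd V W) →ₗ[k] ⨁ i, Prd V W i} (hq : IsHom j q)
    {Q : Module.End k (Sym k V)} (hQ : Q ∈ Coder k V j)
    (h : fstTot k V W ∘ₗ q = pr k V ∘ₗ Q ∘ₗ pFst k V W) :
    pFst k V W ∘ₗ ofTaylor k _ q = Q ∘ₗ pFst k V W := by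
  refine IsCoderAlong.ext isFormalMap_pFst (isFormalMap_pFst.comp_coder (ofTaylor_mem_coder hq))
    (isFormalMap_pFst.coder_comp hQ) ?_
  rw [← LinearMap.comp_assoc, pr_pFst, LinearMap.comp_assoc, pr_ofTaylor, h]

theorem pSnd_ofTaylor {j : ℤ} {q : Sym k (Prd V W) →ₗ[k] ⨁ i, Prd V W i} (hq : IsHom j q)
    {Q : Module.End k (Sym k W)} (hQ : Q ∈ Coder k W j)
    (h : sndTot k V W ∘ₗ q = pr k W ∘ₗ Q ∘ₗ pSnd k V W) :
    pSnd k V W ∘ₗ ofTaylor k _ q = Q ∘ₗ pSnd k V W := by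
  refine IsCoderAlong.ext isFormalMap_pSnd (isFormalMap_pSnd.comp_coder (ofTaylor_mem_coder hq))
    (isFormalMap_pSnd.coder_comp hQ) ?_
  rw [← LinearMap.comp_assoc, pr_pSnd, LinearMap.comp_assoc, pr_ofTaylor, h]

variable {j : ℤ}

omit [Algebra ℚ k] in
theorem isHom_extFst {Q : Module.End k (Sym k V)} (hQ : Q ∈ Coder k V j) :
    IsHom j (inlTot k V W ∘ₗ pr k V ∘ₗ Q ∘ₗ pFst k V W) :=
  (isHom_pr_comp (q := Q ∘ₗ pFst k V W) fun n x hx => hQ.1 _ _ (isFormalMap_pFst.mem_deg n x hx)).inlTot_comp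

omit [Algebra ℚ k] in
theorem isHom_extSnd {Q : Module.End k (Sym k W)} (hQ : Q ∈ Coder k W j) :
    IsHom j (inrTot k V W ∘ₗ pr k W ∘ₗ Q ∘ₗ pSnd k V W) :=
  (isHom_pr_comp (q := Q ∘ₗ pSnd k V W) fun n x hx => hQ.1 _ _ (isFormalMap_pSnd.mem_deg n x hx)).inrTot_comp

omit [Algebra ℚ k] in
theorem extFst_mem_coder {Q : Module.End k (Sym k V)} (hQ : Q ∈ Coder k V j) :
    extFst W Q ∈ Coder k (Prd V W) j := ofTaylor_mem_coder (isHom_extFst hQ)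

omit [Algebra ℚ k] in
theorem extSnd_mem_coder {Q : Module.End k (Sym k W)} (hQ : Q ∈ Coder k W j) :
    extSnd V Q ∈ Coder k (Prd V W) j := ofTaylor_mem_coder (isHom_extSnd hQ)

theorem pFst_extFst {Q : Module.End k (Sym k V)} (hQ : Q ∈ Coder k V j) :
    pFst k V W ∘ₗ extFst W Q = Q ∘ₗ pFst k V W :=
  pFst_ofTaylor (isHom_extFst hQ) hQ (by ext x : 1; exact fstTot_inlTot _)

theorem pSnd_extFst {Q : Module.End k (Sym k V)} (hQ : Q ∈ Coder k V j) :
    pSnd k V W ∘ₗ extFst W Q = 0 :=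
  (pSnd_ofTaylor (isHom_extFst hQ) (Submodule.zero_mem _) (by
    ext x : 1; simpa using sndTot_inlTot _)).trans (LinearMap.zero_comp _)

theorem pSnd_extSnd {Q : Module.End k (Sym k W)} (hQ : Q ∈ Coder k W j) :
    pSnd k V W ∘ₗ extSnd V Q = Q ∘ₗ pSnd k V W :=
  pSnd_ofTaylor (isHom_extSnd hQ) hQ (by ext x : 1; exact sndTot_inrTot _)

theorem pFst_extSnd {Q : Module.End k (Sym k W)} (hQ : Q ∈ Coder k W j) :
    pFst k V W ∘ₗ extSnd V Q = 0 :=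
  (pFst_ofTaylor (isHom_extSnd hQ) (Submodule.zero_mem _) (by
    ext x : 1; simpa using fstTot_inrTot _)).trans (LinearMap.zero_comp _)

end Rat

/-- Only the two components of D and of F survive on the right. Injectivity of `nu` then gives
uniqueness on products without Taylor coefficients. -/
theorem nu_comp_coderAlong {A : ℤ → Type z} [∀ i, AddCommGroup (A i)] [∀ i, Module k (A i)]
    {j : ℤ} {F D : Sym k A →ₗ[k] Sym k (Prd V W)} (hD : IsCoderAlong j F D) :
    nu k V W ∘ₗ D = (TensorProduct.map (pFst k V W ∘ₗ D) (pSnd k V W ∘ₗ F) +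
      TensorProduct.map (pFst k V W ∘ₗ F ∘ₗ (koszul k A j).toLinearMap) (pSnd k V W ∘ₗ D)) ∘ₗ
        comul k A := by
  rw [nu, LinearMap.comp_assoc, hD, ← LinearMap.comp_assoc, LinearMap.comp_add,
    ← TensorProduct.map_comp, ← TensorProduct.map_comp]

/-- Coderivations along a formal map to a product are determined by their two components. -/
theorem IsCoderAlong.prd_ext {A : ℤ → Type z} [∀ i, AddCommGroup (A i)] [∀ i, Module k (A i)]
    {j : ℤ} {F D D' : Sym k A →ₗ[k] Sym k (Prd V W)} (hD : IsCoderAlong j F D)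
    (hD' : IsCoderAlong j F D') (h1 : pFst k V W ∘ₗ D = pFst k V W ∘ₗ D')
    (h2 : pSnd k V W ∘ₗ D = pSnd k V W ∘ₗ D') : D = D' := by
  have h : nu k V W ∘ₗ D = nu k V W ∘ₗ D' := by
    rw [nu_comp_coderAlong hD, nu_comp_coderAlong hD', h1, h2]
  ext x
  exact nu_injective (LinearMap.congr_fun h x)

theorem IsFormalMap.nu_comp {A : ℤ → Type z} [∀ i, AddCommGroup (A i)] [∀ i, Module k (A i)]
    {F : Sym k A →ₗ[k] Sym k (Prd V W)} (hF : IsFormalMap F) :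
    nu k V W ∘ₗ F = TensorProduct.map (pFst k V W ∘ₗ F) (pSnd k V W ∘ₗ F) ∘ₗ comul k A := by
  rw [nu, LinearMap.comp_assoc, hF.comul_comp, ← LinearMap.comp_assoc, ← TensorProduct.map_comp]

theorem IsFormalMap.prd_ext {A : ℤ → Type z} [∀ i, AddCommGroup (A i)] [∀ i, Module k (A i)]
    {F G : Sym k A →ₗ[k] Sym k (Prd V W)} (hF : IsFormalMap F) (hG : IsFormalMap G)
    (h1 : pFst k V W ∘ₗ F = pFst k V W ∘ₗ G) (h2 : pSnd k V W ∘ₗ F = pSnd k V W ∘ₗ G) :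
    F = G := by
  have h : nu k V W ∘ₗ F = nu k V W ∘ₗ G := by
    rw [hF.nu_comp, hG.nu_comp, h1, h2]
  ext x
  exact nu_injective (LinearMap.congr_fun h x)

/-- The universal property of the product of formal supermanifolds. -/
theorem exists_prd_lift [Algebra ℚ k] {A : ℤ → Type z} [∀ i, AddCommGroup (A i)]
    [∀ i, Module k (A i)] {g : Sym k A →ₗ[k] Sym k V} {h : Sym k A →ₗ[k] Sym k W}
    (hg : IsFormalMap g) (hh : IsFormalMap h) :
    ∃ F : Sym k A →ₗ[k] Sym k (Prd V W), IsFormalMap F ∧ pFst k V W ∘ₗ F = g ∧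
      pSnd k V W ∘ₗ F = h := by
  obtain ⟨F, hF, e⟩ := exists_isFormalMap
    (φ := inlTot k V W ∘ₗ pr k V ∘ₗ g + inrTot k V W ∘ₗ pr k W ∘ₗ h)
    (by simp [hg.map_one, hh.map_one, pr_one])
    (hg.isHom_pr.inlTot_comp.add hh.isHom_pr.inrTot_comp)
  refine ⟨F, hF, (isFormalMap_pFst.comp hF).ext hg ?_, (isFormalMap_pSnd.comp hF).ext hh ?_⟩
  · rw [← LinearMap.comp_assoc, pr_pFst, LinearMap.comp_assoc, e]
    ext x : 1
    simp [fstTot_inlTot, fstTot_inrTot]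
  · rw [← LinearMap.comp_assoc, pr_pSnd, LinearMap.comp_assoc, e]
    ext x : 1
    simp [sndTot_inlTot, sndTot_inrTot]

/-! ### The fibrewise component of a vector field on a product -/

/-- The component of `T` along the second factor, as a family of endomorphisms of `S(W)`
parametrized by `S(V)`. -/
def fibre (T : Module.End k (Sym k (Prd V W))) : Sym k V →ₗ[k] Module.End k (Sym k W) :=
  TensorProduct.curry (pSnd k V W ∘ₗ T ∘ₗ mu k V W)

theorem fibre_apply (T : Module.End k (Sym k (Prd V W))) (x : Sym k V) (y : Sym k W) :
    fibre T x y = pSnd k V W (T (muRight x y)) := rfl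

theorem fibre_eq_zero {T : Module.End k (Sym k (Prd V W))} (h : pSnd k V W ∘ₗ T = 0) :
    fibre T = 0 := by
  ext x y
  exact LinearMap.congr_fun h _

theorem fibre_ext {T T' : Module.End k (Sym k (Prd V W))} (h : fibre T = fibre T') :
    pSnd k V W ∘ₗ T = pSnd k V W ∘ₗ T' :=
  hom_ext_muRight fun _ x _ _ y _ => LinearMap.congr_fun (LinearMap.congr_fun h x) y

theorem muRight_mem_deg {m n : ℤ} {x : Sym k V} (hx : x ∈ deg k V m) {y : Sym k W}
    (hy : y ∈ deg k W n) : muRight x y ∈ deg k (Prd V W) (m + n) :=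
  mul_mem_deg (isFormalMap_iFst.mem_deg _ _ hx) (isFormalMap_iSnd.mem_deg _ _ hy)

theorem pSnd_muRight (x : Sym k V) (y : Sym k W) :
    pSnd k V W (muRight x y) = counit k V x • y := by
  have := LinearMap.congr_fun (pSnd_comp_iFst (k := k) (V := V) (W := W)) x
  simp only [LinearMap.comp_apply] at this
  rw [muRight_apply, pSnd_mul, pSnd_iSnd, this, convUnit_apply, ← Algebra.smul_def]

/-- After projection to W the factor untouched by T cannot contain letters of V, so x stays with T
in both terms of the co-Leibniz rule. In the second term the part of y on the left has crossed T and
x, which gives the sign of degree n + j. -/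
theorem fibre_mem_coder {j : ℤ} {T : Module.End k (Sym k (Prd V W))}
    (hT : T ∈ Coder k (Prd V W) j) {n : ℤ} {x : Sym k V} (hx : x ∈ deg k V n) :
    fibre T x ∈ Coder k W (n + j) := by
  refine ⟨fun m y hy => ?_, ?_⟩
  · have := isFormalMap_pSnd.mem_deg _ _ (hT.1 _ _ (muRight_mem_deg hx hy))
    rw [fibre_apply]
    rwa [add_assoc, add_left_comm] at this
  · ext y
    have h := LinearMap.congr_fun (isFormalMap_pSnd.comp_coder hT) (muRight x y)
    simp only [LinearMap.comp_apply, LinearMap.add_apply] at h ⊢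
    rw [fibre_apply, h]
    congr 1
    · rw [show TensorProduct.map (pSnd k V W ∘ₗ T) (pSnd k V W) =
        TensorProduct.map (pSnd k V W ∘ₗ T) LinearMap.id ∘ₗ
          TensorProduct.map LinearMap.id (pSnd k V W) by
            rw [← TensorProduct.map_comp]; rfl, LinearMap.comp_apply, map_comul_pSnd,
        map_apply_of_comp_eq]
      rfl
    · rw [← isFormalMap_pSnd.koszul_comp, show TensorProduct.map ((koszul k W j).toLinearMap ∘ₗ
          pSnd k V W) (pSnd k V W ∘ₗ T) =
        TensorProduct.map (koszul k W j).toLinearMap (pSnd k V W ∘ₗ T) ∘ₗ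
          TensorProduct.map (pSnd k V W) LinearMap.id by
            rw [← TensorProduct.map_comp]; rfl, LinearMap.comp_apply, map_pSnd_comul hx,
        map_apply_of_comp_eq, ← koszul_add, add_comm]
      rfl

theorem nu_apply_muRight {j : ℤ} {T : Module.End k (Sym k (Prd V W))}
    (hT : T ∈ Coder k (Prd V W) j) {Q : Module.End k (Sym k V)}
    (hQ : pFst k V W ∘ₗ T = Q ∘ₗ pFst k V W) (x : Sym k V) (y : Sym k W) :
    nu k V W (T (muRight x y)) = Q x ⊗ₜ y +
      TensorProduct.map (koszul k V j).toLinearMap ((fibre T).flip y) (comul k V x) := by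
  have h := LinearMap.congr_fun (nu_comp_coderAlong (isCoderAlong_of_mem hT)) (muRight x y)
  simp only [LinearMap.comp_apply, LinearMap.add_apply, LinearMap.comp_id, LinearMap.id_comp] at h
  rw [h, hQ]
  congr 1
  · have e : TensorProduct.map (Q ∘ₗ pFst k V W) (pSnd k V W) =
        TensorProduct.map Q LinearMap.id ∘ₗ TensorProduct.map (pFst k V W) (pSnd k V W) := by
      rw [← TensorProduct.map_comp]; rfl
    have h2 := nu_mu (x ⊗ₜ[k] y)
    rw [e, LinearMap.comp_apply]
    exact (congrArg _ h2).trans (by simp)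
  · rw [← isFormalMap_pFst.koszul_comp, show TensorProduct.map ((koszul k V j).toLinearMap ∘ₗ
          pFst k V W) (pSnd k V W ∘ₗ T) =
        TensorProduct.map (koszul k V j).toLinearMap (pSnd k V W ∘ₗ T) ∘ₗ
          TensorProduct.map (pFst k V W) LinearMap.id by
            rw [← TensorProduct.map_comp]; rfl, LinearMap.comp_apply, map_pFst_comul,
        map_apply_of_comp_eq]
    rfl

theorem pSnd_apply (T : Module.End k (Sym k (Prd V W))) (z : Sym k (Prd V W)) :
    pSnd k V W (T z) = TensorProduct.lift (fibre T) (nu k V W z) := by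
  conv_lhs => rw [← mu_nu z]
  have : TensorProduct.lift (fibre T) = pSnd k V W ∘ₗ T ∘ₗ mu k V W :=
    TensorProduct.ext' fun x y => by rw [TensorProduct.lift.tmul]; rfl
  rw [this]
  rfl

/-- A chain rule: T either differentiates the parameter x through Q, or x splits into x' and x'',
with T acting on y at x'' and then T' at x'. The automorphism `koszul` is the sign of moving T past
x'. -/
theorem fibre_comp {j : ℤ} (T' : Module.End k (Sym k (Prd V W)))
    {T : Module.End k (Sym k (Prd V W))} (hT : T ∈ Coder k (Prd V W) j)
    {Q : Module.End k (Sym k V)} (hQ : pFst k V W ∘ₗ T = Q ∘ₗ pFst k V W) :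
    fibre (T' ∘ₗ T) = fibre T' ∘ₗ Q +
      conv (fibre T' ∘ₗ (koszul k V j).toLinearMap) (fibre T) := by
  ext x y
  rw [fibre_apply, LinearMap.comp_apply, pSnd_apply, nu_apply_muRight hT hQ, map_add,
    TensorProduct.lift.tmul, LinearMap.add_apply, LinearMap.add_apply, conv_apply]
  congr 1
  induction comul k V x using TensorProduct.induction_on with
  | zero => simp
  | tmul x x' => simp
  | add s t hs ht => simp only [map_add, hs, ht, LinearMap.add_apply]

/-- A vector field on `V × W` is determined by its components. -/
theorem eq_of_fibre_eq {j : ℤ} {T T' : Module.End k (Sym k (Prd V W))}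
    (hT : T ∈ Coder k (Prd V W) j) (hT' : T' ∈ Coder k (Prd V W) j)
    (h : pFst k V W ∘ₗ T = pFst k V W ∘ₗ T') (hf : fibre T = fibre T') : T = T' :=
  IsCoderAlong.prd_ext (isCoderAlong_of_mem hT) (isCoderAlong_of_mem hT') h (fibre_ext hf)

/-! ### The Maurer-Cartan equation -/

section MaurerCartan

variable [Algebra ℚ k]
variable {QM : Module.End k (Sym k W)} {QB : Module.End k (Sym k V)}
variable {Q : Module.End k (Sym k (Prd V W))}

/-- The constant family with value `c`, extended by zero to positive polynomial degrees. -/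
def constFibre (k : Type u) [CommRing k] (V : ℤ → Type v) [∀ i, AddCommGroup (V i)]
    [∀ i, Module k (V i)] {A : Type*} [Ring A] [Algebra k A] (c : A) : Sym k V →ₗ[k] A :=
  LinearMap.toSpanSingleton k A c ∘ₗ (counit k V).toLinearMap

omit [Algebra ℚ k] in
theorem constFibre_conv {A : Type*} [Ring A] [Algebra k A] (c : A) (p : Sym k V →ₗ[k] A) :
    conv (constFibre k V c) p = LinearMap.mulLeft k c ∘ₗ p := by
  conv_rhs => rw [← convUnit_conv p]
  ext x
  simp only [LinearMap.comp_apply, conv_apply]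
  induction comul k V x using TensorProduct.induction_on with
  | zero => simp
  | tmul x y =>
    simp [constFibre, convUnit_apply, Algebra.algebraMap_eq_smul_one]
  | add x y hx hy => simp only [map_add, hx, hy]

omit [Algebra ℚ k] in
theorem conv_constFibre {A : Type*} [Ring A] [Algebra k A] (c : A) (p : Sym k V →ₗ[k] A) :
    conv p (constFibre k V c) = LinearMap.mulRight k c ∘ₗ p := by
  conv_rhs => rw [← conv_convUnit p]
  ext x
  simp only [LinearMap.comp_apply, conv_apply]
  induction comul k V x using TensorProduct.induction_on with
  | zero => simp
  | tmul x y =>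
    simp [constFibre, convUnit_apply, Algebra.algebraMap_eq_smul_one]
  | add x y hx hy => simp only [map_add, hx, hy]

omit [Algebra ℚ k] in
theorem total_mem_coder (hQM : QM ∈ Coder k W 1) (hQB : QB ∈ Coder k V 1)
    (hQ : Q ∈ Coder k (Prd V W) 1) : total QM QB Q ∈ Coder k (Prd V W) 1 :=
  Submodule.add_mem _ (Submodule.add_mem _ (extSnd_mem_coder hQM) (extFst_mem_coder hQB)) hQ

theorem pFst_total (hQM : QM ∈ Coder k W 1) (hQB : QB ∈ Coder k V 1) :
    pFst k V W ∘ₗ total QM QB Q = QB ∘ₗ pFst k V W + pFst k V W ∘ₗ Q := by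
  rw [total, LinearMap.comp_add, LinearMap.comp_add, pFst_extSnd hQM, pFst_extFst hQB, zero_add]

theorem pSnd_total (hQM : QM ∈ Coder k W 1) (hQB : QB ∈ Coder k V 1) :
    pSnd k V W ∘ₗ total QM QB Q = QM ∘ₗ pSnd k V W + pSnd k V W ∘ₗ Q := by
  rw [total, LinearMap.comp_add, LinearMap.comp_add, pSnd_extSnd hQM, pSnd_extFst hQB, add_zero]

theorem fibre_total (hQM : QM ∈ Coder k W 1) (hQB : QB ∈ Coder k V 1) :
    fibre (total QM QB Q) = constFibre k V QM + fibre Q := by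
  ext x y
  have := LinearMap.congr_fun (pSnd_total (Q := Q) hQM hQB) (muRight x y)
  simp only [LinearMap.comp_apply, LinearMap.add_apply] at this
  rw [fibre_apply, this, pSnd_muRight]
  simp [constFibre, fibre_apply]

/-- The fibre of the total field is the constant Q^M plus that of Q. In the expansion Q^M Q^M
vanishes by hypothesis, and the constant part at QB x vanishes because coderivations have zero
counit. -/
theorem fibre_total_sq (hQM : IsDG QM) (hQB : QB ∈ Coder k V 1)
    (hQ : Q ∈ Coder k (Prd V W) 1) (h : pFst k V W ∘ₗ Q = 0) (x : Sym k V) :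
    fibre (total QM QB Q ∘ₗ total QM QB Q) x = fibre Q (QB x) + (QM * fibre Q x +
      fibre Q (koszul k V 1 x) * QM +
        conv (fibre Q ∘ₗ (koszul k V 1).toLinearMap) (fibre Q) x) := by
  have hc : constFibre k V QM ∘ₗ (koszul k V 1).toLinearMap = constFibre k V QM := by
    ext x : 1
    simp [constFibre, counit_koszul]
  have hadd : ∀ p p' q q' : Sym k V →ₗ[k] Module.End k (Sym k W), conv (p + p') (q + q') =
      conv p q + conv p q' + (conv p' q + conv p' q') := by
    intro p p' q q'
    simp only [conv, TensorProduct.map_add_left, TensorProduct.map_add_right, LinearMap.add_comp,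
      LinearMap.comp_add]
    abel
  rw [fibre_comp _ (total_mem_coder hQM.mem_coder hQB hQ) (Q := QB)
    (by rw [pFst_total hQM.mem_coder hQB, h, add_zero]), fibre_total hQM.mem_coder hQB,
    LinearMap.add_comp, LinearMap.add_comp, hc, hadd, constFibre_conv, constFibre_conv,
    conv_constFibre]
  have h1 : QM * QM = 0 := hQM.sq_zero
  simp only [LinearMap.add_apply, LinearMap.comp_apply, LinearMap.mulLeft_apply,
    LinearMap.mulRight_apply, AlgHom.toLinearMap_apply]
  have h2 : constFibre k V QM (QB x) = 0 := by
    simp [constFibre, counit_coder hQB]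
  have h3 : QM * constFibre k V QM x = 0 := by
    simp [constFibre, h1]
  rw [h2, h3, zero_add, zero_add, add_assoc]

/-- The base component of the square is that of QB, hence zero; the fibre component is the whole
condition. -/
theorem isDG_total_iff (hQM : IsDG QM) (hQB : IsDG QB)
    (hQ : Q ∈ Coder k (Prd V W) 1) (h : pFst k V W ∘ₗ Q = 0) :
    IsDG (total QM QB Q) ↔ ∀ x, fibre Q (QB x) + (QM * fibre Q x +
      fibre Q (koszul k V 1 x) * QM +
        conv (fibre Q ∘ₗ (koszul k V 1).toLinearMap) (fibre Q) x) = 0 := by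
  have hm := total_mem_coder hQM.mem_coder hQB.mem_coder hQ
  have hf := fibre_total_sq hQM hQB.mem_coder hQ h
  constructor
  · intro hT x
    rw [← hf, hT.sq_zero]
    ext y
    simp [fibre_apply]
  · intro hx
    refine ⟨hm, eq_of_fibre_eq (sq_mem_coder hm) (Submodule.zero_mem _) ?_ ?_⟩
    · have e : pFst k V W ∘ₗ total QM QB Q = QB ∘ₗ pFst k V W := by
        rw [pFst_total hQM.mem_coder hQB.mem_coder, h, add_zero]
      rw [← LinearMap.comp_assoc, e, LinearMap.comp_assoc, e, ← LinearMap.comp_assoc, hQB.sq_zero]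
      simp
    · ext x : 1
      rw [hf, hx]
      ext y
      simp [fibre_apply]

end MaurerCartan

end

/-! ### The shifted Lie algebra of coderivations, and perturbations defined by maps into it -/

section

open FormalDG.Sym

variable {k : Type u} [CommRing k]
variable {M : ℤ → Type v} [∀ i, AddCommGroup (M i)] [∀ i, Module k (M i)]
variable {B : ℤ → Type w} [∀ i, AddCommGroup (B i)] [∀ i, Module k (B i)]

/-! ### The shift of the tangent complex -/

/-- Indices such as i - 1 + 1 and i are only propositionally equal; comparing the underlying
endomorphisms avoids casts. -/
theorem lof_eq_lof {m n : ℤ} (h : m = n) {s : UMod k M m} {t : UMod k M n} (e : s.1 = t.1) :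
    DirectSum.lof k ℤ (UMod k M) m s = DirectSum.lof k ℤ (UMod k M) n t := by
  subst h
  rw [Subtype.ext e]

theorem up_lof (n : ℤ) (s : UMod k M n) : up k M (DirectSum.lof k ℤ (UMod k M) n s) = s.1 := by
  simp [up]

theorem up_down (i : ℤ) (s : Tangent k M i) : up k M (down k M i s) = s.1 := by
  rw [down, LinearMap.comp_apply, up_lof, Submodule.coe_inclusion]

/-- The total module of a graded module. -/
abbrev Tot (W : ℤ → Type v) [∀ i, AddCommGroup (W i)] : Type v := ⨁ i, W i

/-- The inclusion of the component of degree `n` into the total module. -/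
abbrev toTot (k : Type u) [CommRing k] (W : ℤ → Type v) [∀ i, AddCommGroup (W i)]
    [∀ i, Module k (W i)] (n : ℤ) : W n →ₗ[k] Tot W := DirectSum.lof k ℤ W n

theorem up_toTot (n : ℤ) (s : UMod k M n) : up k M (toTot k (UMod k M) n s) = s.1 := up_lof n s

theorem down_mem_range {i n : ℤ} (h : i = n + 1) (s : Tangent k M i) :
    down k M i s ∈ LinearMap.range (toTot k (UMod k M) n) := by
  subst h
  rw [down, LinearMap.comp_apply]
  exact ⟨s, lof_eq_lof (by ring) (Submodule.coe_inclusion _ s).symm⟩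

/-- On a single degree `up` is the inclusion of a submodule. Homogeneity of p and q thus gives
cancellation without having to know that coderivations of different degrees are independent. -/
theorem eq_of_up_comp {j : ℤ} {p q : Sym k B →ₗ[k] Tot (UMod k M)}
    (hp : IsHom (V := UMod k M) j p) (hq : IsHom (V := UMod k M) j q)
    (h : ∀ x, up k M (p x) = up k M (q x)) : p = q := by
  apply hom_ext_deg
  intro n x hx
  obtain ⟨s, hs⟩ := hp n x hx
  obtain ⟨t, ht⟩ := hq n x hx
  have := h x
  rw [hs, ht, up_toTot, up_toTot] at this
  rw [hs, ht, Subtype.ext this]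

variable {QM : Coder k M 1}

theorem qU1_lof (i : ℤ) (s : UMod k M i) :
    qU1 QM (DirectSum.lof k ℤ (UMod k M) i s) = down k M (i + 1 + 1) (diff QM (i + 1) s) := by
  simp [qU1]

theorem qU2_lof (i j : ℤ) (s : UMod k M i) (t : UMod k M j) :
    qU2 k M (DirectSum.lof k ℤ (UMod k M) i s) (DirectSum.lof k ℤ (UMod k M) j t) =
      (-sgn k i) • down k M (i + 1 + (j + 1)) (bracket (i + 1) (j + 1) s t) := by
  simp [qU2]

theorem up_qU1_lof (i : ℤ) (s : UMod k M i) :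
    up k M (qU1 QM (DirectSum.lof k ℤ (UMod k M) i s)) =
      -(QM.1 * s.1 + sgn k i • (s.1 * QM.1)) := by
  rw [qU1_lof, up_down]
  have : (diff QM (i + 1) s).1 = sgn k (i + 1) • (s.1 ∘ₗ QM.1 - sgn k ((i + 1) * 1) •
    (QM.1 ∘ₗ s.1)) := rfl
  rw [this, mul_one, smul_sub, smul_smul, sgn_mul_self, sgn_add_one, one_smul, neg_smul]
  change _ = -(QM.1 ∘ₗ s.1 + sgn k i • (s.1 ∘ₗ QM.1))
  abel

/-- The signs show Q₂^U to be minus the graded symmetrization of (s, t) ↦ (-1)^i s t: exchanging s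
and t yields (-1)^{ij + j} t s. -/
theorem up_qU2_lof (i j : ℤ) (s : UMod k M i) (t : UMod k M j) :
    up k M (qU2 k M (DirectSum.lof k ℤ (UMod k M) i s) (DirectSum.lof k ℤ (UMod k M) j t)) =
      -(sgn k i • (s.1 * t.1) + sgn k (i * j + j) • (t.1 * s.1)) := by
  rw [qU2_lof, map_smul, up_down]
  have : (bracket (i + 1) (j + 1) s t).1 = s.1 ∘ₗ t.1 - sgn k ((i + 1) * (j + 1)) •
    (t.1 ∘ₗ s.1) := rfl
  have e : sgn k i * sgn k ((i + 1) * (j + 1)) = - sgn k (i * j + j) := by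
    rw [← sgn_add, ← sgn_add_one]
    exact sgn_congr k ⟨i, by ring⟩
  rw [this]
  refine LinearMap.ext fun y => ?_
  simp only [LinearMap.smul_apply, LinearMap.sub_apply, LinearMap.neg_apply, LinearMap.add_apply,
    Module.End.mul_apply, LinearMap.comp_apply]
  rw [smul_sub, smul_smul, neg_mul, e]
  module

/-! ### The vector field `Q^U` -/

section QU

variable [Algebra ℚ k]

variable (QM) in
/-- The Taylor coefficients of `Q^U`. -/
def taylorQU : Sym k (UMod k M) →ₗ[k] Tot (UMod k M) :=
  qU1 QM ∘ₗ pr k (UMod k M) +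
    algebraMap ℚ k (1 / 2) • (TensorProduct.lift (qU2 k M) ∘ₗ
      TensorProduct.map (pr k (UMod k M)) (pr k (UMod k M)) ∘ₗ comul k (UMod k M))

theorem isHom_taylorQU : IsHom (V := UMod k M) 1 (taylorQU QM) := by
  refine Sym.IsHom.add ?_ (Sym.IsHom.smul ?_ _)
  · rw [isHom_iff]
    intro n x hx
    obtain ⟨s, hs⟩ := exists_pr_eq hx
    rw [LinearMap.comp_apply, hs, qU1_lof]
    exact down_mem_range rfl _
  · rw [isHom_iff]
    intro n x hx
    refine map_mem_of_monomial (X := Tot (UMod k M)) _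
      (fun n => LinearMap.range (toTot k (UMod k M) (n + 1))) (fun l => ?_) hx
    have h : splitSpan k l ≤ (LinearMap.range (toTot k (UMod k M)
        ((l.map Sigma.fst).sum + 1))).comap (TensorProduct.lift (qU2 k M) ∘ₗ
          TensorProduct.map (pr k (UMod k M)) (pr k (UMod k M))) := by
      rw [splitSpan, Submodule.span_le]
      rintro _ ⟨l₁, l₂, -, h, rfl⟩
      obtain ⟨s, hs⟩ := exists_pr_eq (monomial_mem_deg (k := k) l₁)
      obtain ⟨t, ht⟩ := exists_pr_eq (monomial_mem_deg (k := k) l₂)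
      rw [SetLike.mem_coe, Submodule.mem_comap, LinearMap.comp_apply, TensorProduct.map_tmul,
        TensorProduct.lift.tmul, hs, ht, qU2_lof]
      refine Submodule.smul_mem _ _ (down_mem_range ?_ _)
      rw [← h]; ring
    exact h (comul_monomial_mem l)

theorem QU_mem_coder : QU QM ∈ Coder k (UMod k M) 1 := ofTaylor_mem_coder isHom_taylorQU

theorem pr_QU : pr k (UMod k M) ∘ₗ QU QM = taylorQU QM := pr_ofTaylor _

theorem QU_one : QU QM 1 = 0 := by
  have : taylorQU QM 1 = 0 := by
    simp [taylorQU, pr_one, comul_one]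
  exact (ofTaylor_one _).trans (by rw [← map_zero (incl k (UMod k M)), ← this]; rfl)

/-- The bracketed expression is the part of `fibre_total_sq` not involving QB. The lemma thus turns
integrability of a deformation into equivariance of f. -/
theorem up_taylorQU {f : Sym k B →ₗ[k] Sym k (UMod k M)} (hf : IsFormalMap f)
    {g : Sym k B →ₗ[k] Module.End k (Sym k M)}
    (hg : g = up k M ∘ₗ pr k (UMod k M) ∘ₗ f) (x : Sym k B) :
    up k M (taylorQU QM (f x)) = -(QM.1 * g x + g (koszul k B 1 x) * QM.1 +
      conv (g ∘ₗ (koszul k B 1).toLinearMap) g x) := by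
  have hφ : ∀ n, ∀ x ∈ deg k B n, ∃ s : UMod k M n,
      pr k (UMod k M) (f x) = DirectSum.lof k ℤ (UMod k M) n s ∧ g x = s.1 := by
    intro n x hx
    obtain ⟨s, hs⟩ := exists_pr_eq (hf.mem_deg n x hx)
    exact ⟨s, hs, by rw [hg, LinearMap.comp_apply, LinearMap.comp_apply, hs, up_lof]⟩
  set A : Sym k B ⊗[k] Sym k B →ₗ[k] Module.End k (Sym k M) :=
    LinearMap.mul' k _ ∘ₗ TensorProduct.map (g ∘ₗ (koszul k B 1).toLinearMap) g with hA
  -- On the coproduct the flip acts trivially, so A + A ∘ swap becomes 2A there, and the factor one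
  -- half in Q^U removes the 2.
  have h2 : up k M ∘ₗ TensorProduct.lift (qU2 k M) ∘ₗ
      TensorProduct.map (pr k (UMod k M) ∘ₗ f) (pr k (UMod k M) ∘ₗ f) =
        -(A + A ∘ₗ swap k B) := by
    apply tensor_ext_deg
    intro m n x hx y hy
    obtain ⟨s, hs, hs'⟩ := hφ m x hx
    obtain ⟨t, ht, ht'⟩ := hφ n y hy
    simp only [LinearMap.comp_apply, TensorProduct.map_tmul, TensorProduct.lift.tmul, hs, ht,
      up_qU2_lof, LinearMap.neg_apply, LinearMap.add_apply, swap_tmul hx hy, map_smul, hA,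
      LinearMap.mul'_apply, AlgHom.toLinearMap_apply, koszul_of_mem_deg _ _ _ hx,
      koszul_of_mem_deg _ _ _ hy, hs', ht', smul_mul_assoc, smul_smul, ← sgn_add, one_mul]
  have h1 : up k M ∘ₗ qU1 QM ∘ₗ pr k (UMod k M) ∘ₗ f =
      -(LinearMap.mulLeft k QM.1 ∘ₗ g +
        LinearMap.mulRight k QM.1 ∘ₗ g ∘ₗ (koszul k B 1).toLinearMap) := by
    apply hom_ext_deg
    intro n x hx
    obtain ⟨s, hs, hs'⟩ := hφ n x hx
    simp only [LinearMap.comp_apply, hs, up_qU1_lof, LinearMap.neg_apply, LinearMap.add_apply,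
      LinearMap.mulLeft_apply, LinearMap.mulRight_apply, AlgHom.toLinearMap_apply,
      koszul_of_mem_deg _ _ _ hx, map_smul, hs', one_mul]
  have e1 := LinearMap.congr_fun h1 x
  have e2 := LinearMap.congr_fun h2 (comul k B x)
  have hΔ := LinearMap.congr_fun hf.comul_comp x
  simp only [LinearMap.comp_apply, LinearMap.neg_apply, LinearMap.add_apply, swap_comul,
    LinearMap.mulLeft_apply, LinearMap.mulRight_apply, AlgHom.toLinearMap_apply] at e1 e2 hΔ
  have e3 := (congrArg (fun t => up k M (TensorProduct.lift (qU2 k M) t))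
    (map_apply_of_comp_eq (pr k (UMod k M)) f (pr k (UMod k M)) f (comul k B x))).trans e2
  rw [taylorQU, LinearMap.add_apply, map_add, LinearMap.comp_apply, e1, LinearMap.smul_apply,
    map_smul, LinearMap.comp_apply, LinearMap.comp_apply, hΔ, e3,
    ← two_smul k, smul_neg, smul_smul, half_add_half, one_smul, conv_apply]
  rw [hA, LinearMap.comp_apply]
  abel

end QU

/-! ### From morphisms to vector fields -/

section Perturbation

/-- The Taylor coefficients of the perturbation that corresponds to `f`. -/
def taylorOfMor (f : Sym k B →ₗ[k] Sym k (UMod k M)) :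
    Sym k (Prd B M) →ₗ[k] ⨁ i, Prd B M i :=
  inrTot k B M ∘ₗ evalU k M ∘ₗ TensorProduct.map (pr k (UMod k M) ∘ₗ f) LinearMap.id ∘ₗ nu k B M

theorem isHom_taylorOfMor {f : Sym k B →ₗ[k] Sym k (UMod k M)} (hf : IsFormalMap f) :
    IsHom 1 (taylorOfMor f) := by
  refine Sym.IsHom.inrTot_comp ?_
  rw [isHom_iff]
  intro n x hx
  refine map_mem_of_monomial _
    (fun n => LinearMap.range (DirectSum.lof k ℤ M (n + 1))) (fun l => ?_) hx
  have h : splitSpan k l ≤ (LinearMap.range (DirectSum.lof k ℤ M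
      ((l.map Sigma.fst).sum + 1))).comap (evalU k M ∘ₗ
        TensorProduct.map (pr k (UMod k M) ∘ₗ f) LinearMap.id ∘ₗ
          TensorProduct.map (pFst k B M) (pSnd k B M)) := by
    rw [splitSpan, Submodule.span_le]
    rintro _ ⟨l₁, l₂, -, h, rfl⟩
    have h1 := isFormalMap_pFst (k := k) (V := B) (W := M).mem_deg _ _ (monomial_mem_deg l₁)
    have h2 := isFormalMap_pSnd (k := k) (V := B) (W := M).mem_deg _ _ (monomial_mem_deg l₂)
    obtain ⟨s, hs⟩ := exists_pr_eq (hf.mem_deg _ _ h1)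
    obtain ⟨a, ha⟩ := exists_pr_eq (s.2.1 _ _ h2)
    rw [SetLike.mem_coe, Submodule.mem_comap]
    simp only [LinearMap.comp_apply, TensorProduct.map_tmul, hs, evalU, TensorProduct.lift.tmul,
      LinearMap.compr₂_apply, up_lof, LinearMap.id_apply, ha]
    have e : (l₂.map Sigma.fst).sum + ((l₁.map Sigma.fst).sum + 1) =
        (l.map Sigma.fst).sum + 1 := by rw [← h]; ring
    rw [← e]
    exact ⟨a, rfl⟩
  exact h (comul_monomial_mem l)

/-- The perturbation that corresponds to `f`. -/
def ofMor (f : Sym k B →ₗ[k] Sym k (UMod k M)) : Module.End k (Sym k (Prd B M)) :=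
  ofTaylor k (Prd B M) (taylorOfMor f)

theorem ofMor_mem_coder {f : Sym k B →ₗ[k] Sym k (UMod k M)} (hf : IsFormalMap f) :
    ofMor f ∈ Coder k (Prd B M) 1 := ofTaylor_mem_coder (isHom_taylorOfMor hf)

/-- The canonical perturbation is the tautological one, so its properties are instances of those of
`ofMor`. -/
theorem canonicalQ_eq_ofMor : canonicalQ k M = ofMor (LinearMap.id (M := Sym k (UMod k M))) := by
  rw [canonicalQ, ofMor, taylorOfMor, ← pr_pFst, nu]
  congr 3
  rw [← LinearMap.comp_assoc, ← TensorProduct.map_comp]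
  rfl

variable [Algebra ℚ k]

theorem pFst_ofMor {f : Sym k B →ₗ[k] Sym k (UMod k M)} (hf : IsFormalMap f) :
    pFst k B M ∘ₗ ofMor f = 0 :=
  (pFst_ofTaylor (isHom_taylorOfMor hf) (Submodule.zero_mem _) (by
    ext x : 1
    rw [LinearMap.zero_comp, LinearMap.comp_zero]
    exact fstTot_inrTot _)).trans (LinearMap.zero_comp _)

theorem fibre_ofMor {f : Sym k B →ₗ[k] Sym k (UMod k M)} (hf : IsFormalMap f) :
    fibre (ofMor f) = up k M ∘ₗ pr k (UMod k M) ∘ₗ f := by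
  apply hom_ext_deg
  intro n x hx
  obtain ⟨s, hs⟩ := exists_pr_eq (hf.mem_deg n x hx)
  rw [LinearMap.comp_apply, LinearMap.comp_apply, hs, up_lof]
  -- Both sides are coderivations of S(M) of the same degree, and only their linear parts, which
  -- `taylorOfMor` prescribes, need comparison.
  refine coder_ext (fibre_mem_coder (ofMor_mem_coder hf) hx) s.2 ?_
  ext y : 1
  have h := LinearMap.congr_fun (pr_pSnd (k := k) (V := B) (W := M)) (ofMor f (muRight x y))
  have h' := LinearMap.congr_fun (pr_ofTaylor (taylorOfMor f)) (muRight x y)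
  simp only [LinearMap.comp_apply] at h h' ⊢
  rw [fibre_apply, h, ofMor, h', taylorOfMor]
  simp only [LinearMap.comp_apply]
  rw [sndTot_inrTot, muRight_apply, ← mu_tmul, nu_mu]
  simp [evalU, hs, up_lof]

end Perturbation

end

/-! ### From perturbations back to morphisms; the classification -/

section

open FormalDG.Sym

/-! ### The decomposition of `S(W)` by linear degree -/

section Decomposition

variable {k : Type u} [CommRing k]
variable {W : ℤ → Type w} [∀ i, AddCommGroup (W i)] [∀ i, Module k (W i)]

instance : SetLike.GradedMonoid (deg k W) where
  one_mem := one_mem_deg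
  mul_mem _ _ _ _ hx hy := mul_mem_deg hx hy

theorem Sym.lof_deg_eq {m n : ℤ} (h : m = n) {x : deg k W m} {y : deg k W n}
    (e : (x : Sym k W) = y) :
    DirectSum.lof k ℤ (fun n => deg k W n) m x = DirectSum.lof k ℤ (fun n => deg k W n) n y := by
  subst h
  rw [Subtype.ext e]

theorem Sym.lof_deg_mul {m n : ℤ} (x : deg k W m) (y : deg k W n) :
    DirectSum.lof k ℤ (fun n => deg k W n) m x * DirectSum.lof k ℤ (fun n => deg k W n) n y =
      DirectSum.lof k ℤ (fun n => deg k W n) (m + n) ⟨x * y, mul_mem_deg x.2 y.2⟩ :=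
  DirectSum.of_mul_of _ _

variable (k W) in
/-- The decomposition of `S(W)` into its components of given linear degree. -/
def Sym.decompose : Sym k W →ₐ[k] ⨁ n, deg k W n :=
  lift (A := ⨁ n, deg k W n) (fun i => DirectSum.lof k ℤ (fun n => deg k W n) i ∘ₗ
    (gen k W i).codRestrict (deg k W i) (gen_mem_deg i)) (by
      intro i j a b
      simp only [LinearMap.comp_apply, lof_deg_mul]
      rw [← map_smul]
      exact lof_deg_eq (add_comm i j) (gen_mul_gen i j a b))

theorem Sym.decompose_of_mem {n : ℤ} {x : Sym k W} (hx : x ∈ deg k W n) :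
    decompose k W x = DirectSum.lof k ℤ (fun n => deg k W n) n ⟨x, hx⟩ := by
  have hm : ∀ l : List (Σ i, W i), decompose k W (monomial k W l) =
      DirectSum.lof k ℤ (fun n => deg k W n) _ ⟨monomial k W l, monomial_mem_deg l⟩ := by
    intro l
    induction l with
    | nil =>
      exact map_one (decompose k W)
    | cons p l ih =>
      refine (congrArg (decompose k W) (monomial_cons p l)).trans ?_
      rw [map_mul, ih, decompose, lift_gen, LinearMap.comp_apply, lof_deg_mul]
      exact lof_deg_eq (by simp) (monomial_cons p l).symm
  have : (decompose k W).toLinearMap ∘ₗ (deg k W n).subtype =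
      DirectSum.lof k ℤ (fun n => deg k W n) n := by
    ext ⟨x, hx⟩ : 1
    rw [LinearMap.comp_apply, Submodule.subtype_apply]
    induction hx using Submodule.span_induction with
    | mem x h =>
      obtain ⟨l, rfl, rfl⟩ := h
      exact hm l
    | zero => exact (map_zero _).trans (map_zero _).symm
    | add x y hx hy h1 h2 =>
      simp only at h1 h2 ⊢
      rw [map_add, h1, h2, ← map_add]
      rfl
    | smul r x hx h =>
      simp only at h ⊢
      rw [map_smul, h, ← map_smul]
      rfl
  exact LinearMap.congr_fun this ⟨x, hx⟩

end Decomposition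

variable {k : Type u} [CommRing k]
variable {M : ℤ → Type v} [∀ i, AddCommGroup (M i)] [∀ i, Module k (M i)]
variable {B : ℤ → Type w} [∀ i, AddCommGroup (B i)] [∀ i, Module k (B i)]
variable {QM : Coder k M 1}
variable {QB : Module.End k (Sym k B)} {Q : Module.End k (Sym k (Prd B M))}

/-! ### From vector fields to morphisms -/

/-- The values of `fibre Q` lie in End S(M); lifting them to the sum of the U^n requires choosing
the degree linearly. The decomposition of S(B) by linear degree does this. -/
theorem exists_taylor_of_fibre (hQ : Q ∈ Coder k (Prd B M) 1) :
    ∃ φ : Sym k B →ₗ[k] Tot (UMod k M), IsHom (V := UMod k M) 0 φ ∧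
      ∀ x, up k M (φ x) = fibre Q x := by
  let g : ∀ n, deg k B n →ₗ[k] Tot (UMod k M) := fun n => toTot k (UMod k M) n ∘ₗ
    (fibre Q ∘ₗ (deg k B n).subtype).codRestrict (Coder k M (n + 1))
      fun x => fibre_mem_coder hQ x.2
  let φ : Sym k B →ₗ[k] Tot (UMod k M) :=
    DirectSum.toModule k ℤ _ g ∘ₗ (decompose k B).toLinearMap
  have hφ : ∀ n, ∀ x (hx : x ∈ deg k B n),
      φ x = toTot k (UMod k M) n ⟨fibre Q x, fibre_mem_coder hQ hx⟩ := by
    intro n x hx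
    change DirectSum.toModule k ℤ _ g (decompose k B x) = _
    rw [decompose_of_mem hx, DirectSum.toModule_lof]
    rfl
  refine ⟨φ, ?_, ?_⟩
  · intro n x hx
    rw [add_zero]
    exact ⟨_, hφ n x hx⟩
  · have : up k M ∘ₗ φ = fibre Q := by
      apply hom_ext_deg
      intro n x hx
      rw [LinearMap.comp_apply, hφ n x hx, up_toTot]
    exact LinearMap.congr_fun this

/-- The fibre at 1 is the restriction to {0} × M followed by the projection to M, and for vertical Q
nothing is lost by projecting. -/
theorem fibre_one_eq_zero_iff (hQ : Q ∈ Coder k (Prd B M) 1) (h : pFst k B M ∘ₗ Q = 0) :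
    fibre Q 1 = 0 ↔ Q ∘ₗ iSnd k B M = 0 := by
  constructor
  · intro h1
    ext y
    apply nu_injective
    have := nu_apply_muRight hQ (Q := 0) (by rw [h]; rfl) 1 y
    rw [LinearMap.comp_apply, ← muRight_one, this, comul_one, TensorProduct.map_tmul,
      LinearMap.flip_apply, h1]
    simp
  · intro h1
    ext y
    rw [fibre_apply, muRight_one]
    have := LinearMap.congr_fun h1 y
    rw [LinearMap.comp_apply] at this
    rw [this]
    simp

theorem inrTot_injective : Function.Injective (inrTot k B M) :=
  Function.LeftInverse.injective sndTot_inrTot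

section Rat

variable [Algebra ℚ k]

theorem exists_mor_of_fibre (hQ : Q ∈ Coder k (Prd B M) 1) (h1 : fibre Q 1 = 0) :
    ∃ f : Sym k B →ₗ[k] Sym k (UMod k M), IsFormalMap f ∧
      fibre Q = up k M ∘ₗ pr k (UMod k M) ∘ₗ f := by
  obtain ⟨φ, hφ, hu⟩ := exists_taylor_of_fibre hQ
  have hφ1 : φ 1 = 0 := by
    obtain ⟨s, hs⟩ := hφ 0 1 one_mem_deg
    have := hu 1
    rw [hs, up_toTot, h1] at this
    rw [hs, show s = 0 from Subtype.ext this, map_zero]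
  obtain ⟨f, hf, e⟩ := exists_isFormalMap hφ1 hφ
  refine ⟨f, hf, ?_⟩
  ext x : 1
  rw [← hu x, ← e]
  rfl

theorem eq_of_up_pr_eq {f f' : Sym k B →ₗ[k] Sym k (UMod k M)} (hf : IsFormalMap f)
    (hf' : IsFormalMap f')
    (h : up k M ∘ₗ pr k (UMod k M) ∘ₗ f = up k M ∘ₗ pr k (UMod k M) ∘ₗ f') : f = f' :=
  hf.ext hf' (eq_of_up_comp hf.isHom_pr hf'.isHom_pr (LinearMap.congr_fun h))

/-- Equivariance of the projection says exactly that Q is vertical, and Q(1) = 0 already follows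
from the vanishing on S(M). -/
theorem isDeformation_iff (hQM : IsDG QM.1) (hQB : IsLocalDG QB) :
    IsDeformation QM.1 QB Q ↔ Q ∈ Coder k (Prd B M) 1 ∧ pFst k B M ∘ₗ Q = 0 ∧ fibre Q 1 = 0 ∧
      IsDG (total QM.1 QB Q) := by
  have ht := pFst_total (Q := Q) hQM.mem_coder hQB.mem_coder
  constructor
  · intro h
    have hp : pFst k B M ∘ₗ Q = 0 := by
      rw [h.proj.equivariant] at ht
      exact left_eq_add.mp ht
    exact ⟨h.mem_coder, hp, (fibre_one_eq_zero_iff h.mem_coder hp).mpr h.restrict, h.isDG⟩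
  · rintro ⟨h1, h2, h3, h4⟩
    have hr := (fibre_one_eq_zero_iff h1 h2).mp h3
    refine ⟨h1, ?_, hr, h4, ⟨isFormalMap_pFst, by rw [ht, h2, add_zero]⟩⟩
    have := LinearMap.congr_fun hr 1
    rwa [LinearMap.comp_apply, isFormalMap_iSnd.map_one] at this

theorem isDG_total_iff_equivariant (hQM : IsDG QM.1) (hQB : IsDG QB)
    (hQ : Q ∈ Coder k (Prd B M) 1) (h : pFst k B M ∘ₗ Q = 0)
    {f : Sym k B →ₗ[k] Sym k (UMod k M)} (hf : IsFormalMap f)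
    (hfQ : fibre Q = up k M ∘ₗ pr k (UMod k M) ∘ₗ f) :
    IsDG (total QM.1 QB Q) ↔ f ∘ₗ QB = QU QM ∘ₗ f := by
  have key : IsDG (total QM.1 QB Q) ↔ ∀ x, up k M ((pr k (UMod k M) ∘ₗ f ∘ₗ QB) x) =
      up k M ((pr k (UMod k M) ∘ₗ QU QM ∘ₗ f) x) := by
    rw [isDG_total_iff hQM hQB hQ h]
    refine forall_congr' fun x => ?_
    have e1 : fibre Q (QB x) = up k M ((pr k (UMod k M) ∘ₗ f ∘ₗ QB) x) := by rw [hfQ]; rfl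
    have e2 : up k M ((pr k (UMod k M) ∘ₗ QU QM ∘ₗ f) x) = up k M (taylorQU QM (f x)) := by
      rw [← LinearMap.comp_assoc, pr_QU, LinearMap.comp_apply]
    rw [← e1, e2, up_taylorQU hf hfQ, eq_neg_iff_add_eq_zero]
  rw [key]
  constructor
  · intro hx
    refine IsCoderAlong.ext hf (hf.comp_coder hQB.mem_coder) (hf.coder_comp QU_mem_coder) ?_
    refine eq_of_up_comp (j := 1)
      (isHom_pr_comp (q := f ∘ₗ QB) fun n x hx => hf.mem_deg _ _ (hQB.mem_coder.1 n x hx))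
      (isHom_pr_comp (q := QU QM ∘ₗ f) fun n x hx => QU_mem_coder.1 n _ (hf.mem_deg n x hx)) hx
  · intro he x
    rw [he]

theorem classifies_iff (hQ : Q ∈ Coder k (Prd B M) 1) (h : pFst k B M ∘ₗ Q = 0)
    (h1 : fibre Q 1 = 0) {f : Sym k B →ₗ[k] Sym k (UMod k M)} (hf : IsFormalMap f) :
    Classifies Q f ↔ fibre Q = up k M ∘ₗ pr k (UMod k M) ∘ₗ f := by
  have hpr : ∀ z, pr k (Prd B M) (Q z) = inrTot k B M (pr k M (pSnd k B M (Q z))) := by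
    intro z
    have e1 := LinearMap.congr_fun (pr_pFst (k := k) (V := B) (W := M)) (Q z)
    have e2 := LinearMap.congr_fun (pr_pSnd (k := k) (V := B) (W := M)) (Q z)
    have e3 := LinearMap.congr_fun h z
    simp only [LinearMap.comp_apply, LinearMap.zero_apply] at e1 e2 e3
    rw [e3, map_zero] at e1
    rw [e2]
    conv_lhs => rw [← inlTot_fstTot_add (k := k) (pr k (Prd B M) (Q z)), ← e1, map_zero, zero_add]
  constructor
  · intro hc
    apply hom_ext_monomial
    intro bs
    -- The rule says nothing for n = 0. There both sides vanish: the left by `h1`, the right because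
    -- f(1) = 1 has no linear part.
    rcases eq_or_ne bs [] with rfl | hbs
    · rw [monomial_nil, h1, LinearMap.comp_apply, LinearMap.comp_apply, hf.map_one, pr_one, map_zero]
    · obtain ⟨s, hs⟩ := exists_pr_eq (hf.mem_deg _ _ (monomial_mem_deg bs))
      rw [LinearMap.comp_apply, LinearMap.comp_apply, hs, up_lof]
      refine coder_ext (fibre_mem_coder hQ (monomial_mem_deg bs)) s.2 ?_
      apply hom_ext_monomial
      intro ms
      apply inrTot_injective (k := k) (B := B)
      have := hc bs ms hbs
      rw [hs, up_lof, hpr] at this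
      exact this.symm
  · intro hfQ bs ms _
    rw [hpr]
    have := LinearMap.congr_fun (LinearMap.congr_fun hfQ (monomial k B bs)) (monomial k M ms)
    rw [fibre_apply, muRight_apply] at this
    rw [this]
    rfl

/-! ### `Q^U` is a local DG structure -/

theorem QU_sq (hQM : IsDG QM.1) : QU QM ∘ₗ QU QM = 0 := by
  set Q : Module.End k (Sym k (Prd (UMod k M) M)) := ofMor LinearMap.id with hQdef
  have hid : IsFormalMap (LinearMap.id : Sym k (UMod k M) →ₗ[k] Sym k (UMod k M)) := .id
  have hQ : Q ∈ Coder k _ 1 := ofMor_mem_coder hid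
  have hp : pFst k (UMod k M) M ∘ₗ Q = 0 := pFst_ofMor hid
  have hf : fibre Q = up k M ∘ₗ pr k (UMod k M) ∘ₗ LinearMap.id := fibre_ofMor hid
  set T := total QM.1 (QU QM) Q with hT
  have hTm : T ∈ Coder k _ 1 := total_mem_coder hQM.mem_coder QU_mem_coder hQ
  have hTp : pFst k (UMod k M) M ∘ₗ T = QU QM ∘ₗ pFst k (UMod k M) M := by
    rw [hT, pFst_total hQM.mem_coder QU_mem_coder, hp, add_zero]
  have hTTp : pFst k (UMod k M) M ∘ₗ (T ∘ₗ T) = (QU QM ∘ₗ QU QM) ∘ₗ pFst k (UMod k M) M := by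
    rw [← LinearMap.comp_assoc, hTp, LinearMap.comp_assoc, hTp, ← LinearMap.comp_assoc]
  -- With f = Id the Maurer-Cartan expression vanishes identically, by the very definition of Q^U;
  -- nothing about its square is used.
  have hTT : fibre (T ∘ₗ T) = 0 := by
    ext x : 1
    rw [hT, fibre_total_sq hQM QU_mem_coder hQ hp]
    have e1 : fibre Q (QU QM x) = up k M (taylorQU QM (LinearMap.id (R := k) x)) := by
      rw [hf, ← pr_QU]; rfl
    rw [e1, up_taylorQU hid hf, neg_add_cancel]
    rfl
  have h0 : pSnd k (UMod k M) M ∘ₗ (T ∘ₗ T) = 0 := by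
    have := fibre_ext (T := T ∘ₗ T) (T' := 0) (by rw [hTT]; exact (fibre_eq_zero (by simp)).symm)
    rw [this]; simp
  -- Bracketed as T² ∘ T, this vanishes since pr_M T² = 0. Bracketed as T ∘ T², the chain rule
  -- leaves only the fibre of T composed with (Q^U)².
  have h3 : fibre (T ∘ₗ (T ∘ₗ T)) = 0 := by
    apply fibre_eq_zero
    rw [show pSnd k (UMod k M) M ∘ₗ (T ∘ₗ (T ∘ₗ T)) = (pSnd k (UMod k M) M ∘ₗ (T ∘ₗ T)) ∘ₗ T
      from rfl, h0, LinearMap.zero_comp]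
  have hsq := sq_mem_coder (QU_mem_coder (QM := QM))
  rw [fibre_comp T (sq_mem_coder hTm) hTTp, hTT, conv_zero_right, add_zero, hT,
    fibre_total hQM.mem_coder QU_mem_coder, hf] at h3
  refine coder_ext hsq (Submodule.zero_mem _) ?_
  refine eq_of_up_comp (j := 1 + 1) (isHom_pr_comp hsq.1)
    (isHom_pr_comp (Submodule.zero_mem (Coder k (UMod k M) (1 + 1))).1) fun x => ?_
  have := LinearMap.congr_fun h3 x
  -- The constant part of the fibre does not see the values of a coderivation, so h3 reduces to the
  -- vanishing of the linear part of (Q^U)².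
  have hc : constFibre k (UMod k M) QM.1 ((QU QM ∘ₗ QU QM) x) = 0 := by
    rw [constFibre, LinearMap.comp_apply, AlgHom.toLinearMap_apply, counit_coder hsq, map_zero]
  rw [LinearMap.comp_apply, LinearMap.add_apply, hc, zero_add] at this
  exact this.trans (by simp)

theorem isLocalDG_QU (hQM : IsDG QM.1) : IsLocalDG (QU QM) :=
  ⟨⟨QU_mem_coder, QU_sq hQM⟩, QU_one⟩

/-! ### The classification of deformations -/

theorem existsUnique_mor (hQM : IsDG QM.1) (hQB : IsLocalDG QB) (hQ : IsDeformation QM.1 QB Q) :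
    ∃! f : Sym k B →ₗ[k] Sym k (UMod k M), IsDGMor QB (QU QM) f ∧ Classifies Q f := by
  obtain ⟨h1, h2, h3, h4⟩ := (isDeformation_iff hQM hQB).mp hQ
  obtain ⟨f, hf, hfQ⟩ := exists_mor_of_fibre h1 h3
  refine ⟨f, ⟨⟨hf, (isDG_total_iff_equivariant hQM hQB.toIsDG h1 h2 hf hfQ).mp h4⟩,
    (classifies_iff h1 h2 h3 hf).mpr hfQ⟩, ?_⟩
  rintro f' ⟨hf', hc⟩
  exact eq_of_up_pr_eq hf'.toIsFormalMap hf
    (((classifies_iff h1 h2 h3 hf'.toIsFormalMap).mp hc).symm.trans hfQ)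

theorem isDeformation_ofMor (hQM : IsDG QM.1) (hQB : IsLocalDG QB)
    {f : Sym k B →ₗ[k] Sym k (UMod k M)} (hf : IsDGMor QB (QU QM) f) :
    IsDeformation QM.1 QB (ofMor f) := by
  have hff := hf.toIsFormalMap
  refine (isDeformation_iff hQM hQB).mpr ⟨ofMor_mem_coder hff, pFst_ofMor hff, ?_,
    (isDG_total_iff_equivariant hQM hQB.toIsDG (ofMor_mem_coder hff) (pFst_ofMor hff) hff
      (fibre_ofMor hff)).mpr hf.equivariant⟩
  rw [fibre_ofMor hff, LinearMap.comp_apply, LinearMap.comp_apply, hff.map_one, pr_one, map_zero]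

theorem existsUnique_deformation (hQM : IsDG QM.1) (hQB : IsLocalDG QB)
    {f : Sym k B →ₗ[k] Sym k (UMod k M)} (hf : IsDGMor QB (QU QM) f) :
    ∃! Q : Module.End k (Sym k (Prd B M)), IsDeformation QM.1 QB Q ∧ Classifies Q f := by
  have hff := hf.toIsFormalMap
  have hd := isDeformation_ofMor hQM hQB hf
  obtain ⟨h1, h2, h3, -⟩ := (isDeformation_iff hQM hQB).mp hd
  refine ⟨ofMor f, ⟨hd, (classifies_iff h1 h2 h3 hff).mpr (fibre_ofMor hff)⟩, ?_⟩
  rintro Q ⟨hQ, hc⟩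
  obtain ⟨h1', h2', h3', -⟩ := (isDeformation_iff hQM hQB).mp hQ
  exact eq_of_fibre_eq h1' h1 (h2'.trans h2.symm)
    (((classifies_iff h1' h2' h3' hff).mp hc).trans (fibre_ofMor hff).symm)

theorem isDeformation_canonicalQ (hQM : IsDG QM.1) :
    IsDeformation QM.1 (QU QM) (canonicalQ k M) := by
  rw [canonicalQ_eq_ofMor]
  exact isDeformation_ofMor hQM (isLocalDG_QU hQM) ⟨IsFormalMap.id, rfl⟩

/-! ### Morphisms of deformations -/

/-- The two projections force F(x ⊙ y) = f(x) ⊙ y, and the canonical field at f(x) acts on y through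
the linear part of f(x). -/
theorem pSnd_canonicalQ_comp {f : Sym k B →ₗ[k] Sym k (UMod k M)}
    {F : Sym k (Prd B M) →ₗ[k] Sym k (Prd (UMod k M) M)} (hF : IsFormalMap F)
    (h1 : pFst k (UMod k M) M ∘ₗ F = f ∘ₗ pFst k B M)
    (h2 : pSnd k (UMod k M) M ∘ₗ F = pSnd k B M) :
    pSnd k (UMod k M) M ∘ₗ canonicalQ k M ∘ₗ F = pSnd k B M ∘ₗ Q ↔
      fibre Q = up k M ∘ₗ pr k (UMod k M) ∘ₗ f := by
  have key : ∀ x y, pSnd k (UMod k M) M (canonicalQ k M (F (muRight x y))) =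
      up k M (pr k (UMod k M) (f x)) y := by
    intro x y
    have e := LinearMap.congr_fun hF.nu_comp (muRight x y)
    have e' : TensorProduct.map (f ∘ₗ pFst k B M) (pSnd k B M) ∘ₗ comul k _ =
        TensorProduct.map f LinearMap.id ∘ₗ nu k B M := by
      rw [nu, ← LinearMap.comp_assoc, ← TensorProduct.map_comp]; rfl
    rw [h1, h2, e', LinearMap.comp_apply, LinearMap.comp_apply, muRight_apply, ← mu_tmul, nu_mu,
      TensorProduct.map_tmul, mu_tmul, ← muRight_apply] at e
    rw [pSnd_apply, e, TensorProduct.lift.tmul, canonicalQ_eq_ofMor, fibre_ofMor IsFormalMap.id]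
    rfl
  constructor
  · intro h
    ext x y
    have := LinearMap.congr_fun h (muRight x y)
    simp only [LinearMap.comp_apply] at this
    rw [fibre_apply, ← this, key]
    rfl
  · intro h
    refine hom_ext_muRight fun _ x _ _ y _ => ?_
    simp only [LinearMap.comp_apply]
    rw [key, ← fibre_apply, h]
    rfl

/-- The lift j has components g and pr_M h. Its M-component of equivariance is inherited from h,
because pr_M F = pr_M. -/
theorem isDefMor_cartesian {C : ℤ → Type z} [∀ i, AddCommGroup (C i)] [∀ i, Module k (C i)]
    {A : ℤ → Type*} [∀ i, AddCommGroup (A i)] [∀ i, Module k (A i)]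
    {QA : Module.End k (Sym k A)} (hQA : IsDG QA)
    (hQ : IsDeformation QM.1 QB Q)
    {QC : Module.End k (Sym k C)} {P : Module.End k (Sym k (Prd C M))}
    {F : Sym k (Prd B M) →ₗ[k] Sym k (Prd C M)} {f : Sym k B →ₗ[k] Sym k C}
    (hF : IsDGMor (total QM.1 QB Q) (total QM.1 QC P) F)
    (h1 : pFst k C M ∘ₗ F = f ∘ₗ pFst k B M) (h2 : pSnd k C M ∘ₗ F = pSnd k B M)
    {g : Sym k A →ₗ[k] Sym k B} {h : Sym k A →ₗ[k] Sym k (Prd C M)}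
    (hg : IsDGMor QA QB g) (hh : IsDGMor QA (total QM.1 QC P) h)
    (e : f ∘ₗ g = pFst k C M ∘ₗ h) :
    ∃! j : Sym k A →ₗ[k] Sym k (Prd B M),
      IsDGMor QA (total QM.1 QB Q) j ∧ pFst k B M ∘ₗ j = g ∧ F ∘ₗ j = h := by
  obtain ⟨j, hj, j1, j2⟩ := exists_prd_lift hg.toIsFormalMap
    (isFormalMap_pSnd.comp hh.toIsFormalMap)
  have hFj : F ∘ₗ j = h := by
    refine IsFormalMap.prd_ext (hF.toIsFormalMap.comp hj) hh.toIsFormalMap ?_ ?_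
    · rw [← LinearMap.comp_assoc, h1, LinearMap.comp_assoc, j1, e]
    · rw [← LinearMap.comp_assoc, h2, j2]
  refine ⟨j, ⟨⟨hj, ?_⟩, j1, hFj⟩, ?_⟩
  · refine IsCoderAlong.prd_ext (hj.comp_coder hQA.mem_coder) (hj.coder_comp hQ.isDG.mem_coder)
      ?_ ?_
    · rw [← LinearMap.comp_assoc, j1, hg.equivariant, ← LinearMap.comp_assoc, hQ.proj.equivariant,
        LinearMap.comp_assoc, j1]
    · rw [← LinearMap.comp_assoc, j2, LinearMap.comp_assoc, hh.equivariant, ← hFj,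
        ← LinearMap.comp_assoc j F, ← hF.equivariant, LinearMap.comp_assoc,
        ← LinearMap.comp_assoc _ F, h2]
  · rintro j' ⟨hj', j1', hFj'⟩
    refine IsFormalMap.prd_ext hj'.toIsFormalMap hj (j1'.trans j1.symm) ?_
    rw [j2, ← hFj', ← LinearMap.comp_assoc, h2]

/-- The condition over M makes F equal to f × Id. Its equivariance has a base component, which is
that of f, and an M-component, which is the classifying rule. -/
theorem exists_isDefMor_iff (hQM : IsDG QM.1) (hQB : IsLocalDG QB)
    (hQ : IsDeformation QM.1 QB Q) (f : Sym k B →ₗ[k] Sym k (UMod k M)) :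
    (∃ F, IsDefMor QM.1 QB Q (QU QM) (canonicalQ k M) F f ∧
      pSnd k (UMod k M) M ∘ₗ F = pSnd k B M) ↔ IsDGMor QB (QU QM) f ∧ Classifies Q f := by
  obtain ⟨q1, q2, q3, -⟩ := (isDeformation_iff hQM hQB).mp hQ
  have hP := isDeformation_canonicalQ hQM
  have tQ := pSnd_total (Q := Q) hQM.mem_coder hQB.mem_coder
  have tP := pSnd_total (Q := canonicalQ k M) hQM.mem_coder (QU_mem_coder (QM := QM))
  constructor
  · rintro ⟨F, hF, h2⟩
    refine ⟨hF.base, (classifies_iff q1 q2 q3 hF.base.toIsFormalMap).mpr ?_⟩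
    refine (pSnd_canonicalQ_comp hF.top.toIsFormalMap hF.comm h2).mp ?_
    have := congrArg (fun D => pSnd k (UMod k M) M ∘ₗ D) hF.top.equivariant
    simp only [← LinearMap.comp_assoc] at this
    rw [h2, tQ, tP, LinearMap.add_comp, LinearMap.comp_assoc _ _ QM.1, h2] at this
    rw [← LinearMap.comp_assoc]
    -- Both total fields contribute the same term Q^M ∘ pr_M, which cancels and leaves the equality
    -- of the perturbations.
    exact (add_left_cancel this).symm
  · rintro ⟨hf, hc⟩
    have hfQ := (classifies_iff q1 q2 q3 hf.toIsFormalMap).mp hc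
    obtain ⟨F, hF, h1, h2⟩ := exists_prd_lift (hf.toIsFormalMap.comp isFormalMap_pFst)
      (isFormalMap_pSnd (k := k) (V := B) (W := M))
    have top : IsDGMor (total QM.1 QB Q) (total QM.1 (QU QM) (canonicalQ k M)) F := by
      refine ⟨hF, IsCoderAlong.prd_ext (hF.comp_coder hQ.isDG.mem_coder)
        (hF.coder_comp hP.isDG.mem_coder) ?_ ?_⟩
      · rw [← LinearMap.comp_assoc, h1, LinearMap.comp_assoc, hQ.proj.equivariant,
          ← LinearMap.comp_assoc, hf.equivariant, ← LinearMap.comp_assoc, hP.proj.equivariant,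
          LinearMap.comp_assoc, LinearMap.comp_assoc, h1]
      · have := (pSnd_canonicalQ_comp hF h1 h2).mpr hfQ
        rw [← LinearMap.comp_assoc, h2, tQ, ← LinearMap.comp_assoc, tP, LinearMap.add_comp,
          LinearMap.comp_assoc, h2, LinearMap.comp_assoc, this]
    refine ⟨F, ⟨top, hf, h1, ?_, ?_⟩, h2⟩
    · intro A _ _ QA hQA g h hg hh e
      exact isDefMor_cartesian hQA hQ top h1 h2 hg hh e
    · refine IsFormalMap.prd_ext (hF.comp isFormalMap_iSnd) isFormalMap_iSnd ?_ ?_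
      · rw [← LinearMap.comp_assoc, h1, LinearMap.comp_assoc, pFst_comp_iSnd, pFst_comp_iSnd]
        ext x
        simp [convUnit_apply, Algebra.algebraMap_eq_smul_one, hf.map_one]
      · rw [← LinearMap.comp_assoc, h2]
        ext x
        simp [pSnd_iSnd]

end Rat

end

end

end FormalDG

theorem mainTheorem2 {k : Type u} [CommRing k] [Algebra ℚ k]
    {M : ℤ → Type v} [∀ i, AddCommGroup (M i)] [∀ i, Module k (M i)]
    (QM : FormalDG.Coder k M 1) (hQM : FormalDG.IsDG (QM : Module.End k (FormalDG.Sym k M))) :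
    FormalDG.IsUniversal.{u, v, w, max u v} (QM : Module.End k (FormalDG.Sym k M))
      (FormalDG.QU QM) (FormalDG.canonicalQ k M) ∧
    ∀ (B : ℤ → Type w) [∀ i, AddCommGroup (B i)] [∀ i, Module k (B i)]
      (QB : Module.End k (FormalDG.Sym k B)), FormalDG.IsLocalDG QB →
      (∀ Q' : Module.End k (FormalDG.Sym k (FormalDG.Prd B M)),
        FormalDG.IsDeformation (QM : Module.End k (FormalDG.Sym k M)) QB Q' →
        ∃! f : FormalDG.Sym k B →ₗ[k] FormalDG.Sym k (FormalDG.UMod k M),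
          FormalDG.IsDGMor QB (FormalDG.QU QM) f ∧ FormalDG.Classifies Q' f) ∧
      (∀ f : FormalDG.Sym k B →ₗ[k] FormalDG.Sym k (FormalDG.UMod k M),
        FormalDG.IsDGMor QB (FormalDG.QU QM) f →
        ∃! Q' : Module.End k (FormalDG.Sym k (FormalDG.Prd B M)),
          FormalDG.IsDeformation (QM : Module.End k (FormalDG.Sym k M)) QB Q' ∧
            FormalDG.Classifies Q' f) := by
  refine ⟨⟨FormalDG.isLocalDG_QU hQM, FormalDG.isDeformation_canonicalQ hQM, ?_⟩, ?_⟩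
  · intro B _ _ QB hQB Q' hQ'
    exact (existsUnique_congr (FormalDG.exists_isDefMor_iff hQM hQB hQ')).mpr
      (FormalDG.existsUnique_mor hQM hQB hQ')
  · intro B _ _ QB hQB
    exact ⟨fun Q' hQ' => FormalDG.existsUnique_mor hQM hQB hQ',
      fun f hf => FormalDG.existsUnique_deformation hQM hQB hf⟩
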